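/- Let $a>1$ and $R>0$. For $s\in(0,e^{a-1})$ put $X_1(s)=(a-\log s)^{-1}$, $X_{k+1}(s)=X_1(X_k(s))$ for $k\ge 1$, and $$W_\infty(s)=1+\frac18\sum_{j=1}^{\infty}X_1(s)^2\cdots X_j(s)^2 ,$$ where the series converges. Let $B_R=\{x\in\mathbb R^3: |x|<R\}$, and let $\sigma_1,\sigma_2,\sigma_3$ be the Pauli matrices, $\sigma\cdot\nabla=\sum_{j=1}^3\sigma_j\partial_j$. Let $\mathcal W_R$ be the set of all continuous functions $W:[0,\infty)\to[0,\infty)$ that are differentiable almost everywhere, satisfy $$-r\le r\,W'(r)\le 3\,W(r)+2\,r\qquad\text{for a.e. } r\in[0,R),$$ and are such that for every $\varphi\in H^1_0(B_R,\mathbb C^2)$ (extended by zero to $\mathbb R^3$) $$\int_{\mathbb R^3}\left(\frac{|\sigma\cdot\nabla\varphi|^2}{1+\frac{W(|x|)}{|x|}}+|\varphi|^2\right)dx\ \ge\ \int_{\mathbb R^3}\frac{W(|x|)}{|x|}\,|\varphi|^2\,dx .$$ Then the optimal growth at the origin in the class $\mathcal W_R$ is, at every order, that of $W_\infty$: (i)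 for every $W\in\mathcal W_R$ and every integer $k\ge 0$, $$\liminf_{s\to0^+}\Big(W(s)-1-\frac18\sum_{j=1}^{k}X_1(s)^2\cdots X_j(s)^2\Big)X_1(s)^{-2}\cdots X_{k+1}(s)^{-2}\ \le\ \frac18 ;$$ (ii) there is a $W\in\mathcal W_R$ that coincides with $W_\infty$ on an interval $(0,\delta)$, $\delta>0$, and for which equality holds in (i) for every integer $k\ge 0$. -/

import Mathlib

open MeasureTheory Set Filter Topology
open scoped ContDiff ENNReal

namespace DiracHardy

/-- Physical space `ℝ³` with its Euclidean norm. -/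
abbrev Space : Type := EuclideanSpace ℝ (Fin 3)

/-- Two-spinors `ℂ²` with the Hermitian norm `‖φ‖² = |φ₁|² + |φ₂|²`. -/
abbrev Spinor : Type := EuclideanSpace ℂ (Fin 2)

/-- The three Pauli matrices. -/
def pauli : Fin 3 → Matrix (Fin 2) (Fin 2) ℂ :=
  ![!![0, 1; 1, 0], !![0, -Complex.I; Complex.I, 0], !![1, 0; 0, -1]]

/-- The partial derivative `∂ⱼψ` of a differentiable function on `ℝ³`. -/
noncomputable def partialDeriv {F : Type*} [NormedAddCommGroup F] [NormedSpace ℝ F]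
    (j : Fin 3) (ψ : Space → F) (x : Space) : F :=
  fderiv ℝ ψ x (EuclideanSpace.single j (1 : ℝ))

/-- `v` is the weak partial derivative `∂ⱼu` on `ℝ³`. -/
def IsWeakPartial (j : Fin 3) (u v : Space → Spinor) : Prop :=
  ∀ η : Space → ℝ, ContDiff ℝ ∞ η → HasCompactSupport η →
    ∫ x, partialDeriv j η x • u x = - ∫ x, η x • v x

/-- `φ ∈ H¹(ℝ³, ℂ²)`, and `g j` is its weak partial derivative `∂ⱼφ`. -/
structure MemH1 (φ : Space → Spinor) (g : Fin 3 → Space → Spinor) : Prop where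
  memLp : MemLp φ 2 volume
  memLp_grad : ∀ j, MemLp (g j) 2 volume
  weak : ∀ j, IsWeakPartial j φ (g j)

/-- Smooth spinors with compact support in the open ball `B_R` centred at the origin. -/
def IsTestSpinor (R : ℝ) (ψ : Space → Spinor) : Prop :=
  ContDiff ℝ ∞ ψ ∧ HasCompactSupport ψ ∧ tsupport ψ ⊆ Metric.ball 0 R

/-- `φ`, extended by zero to `ℝ³`, belongs to `H¹₀(B_R, ℂ²)`, the closure of the test spinors of
`B_R` in the `H¹` norm, and `g` is the family of its weak partial derivatives. -/
structure MemH10 (R : ℝ) (φ : Space → Spinor) (g : Fin 3 → Space → Spinor) : Prop where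
  memH1 : MemH1 φ g
  approx : ∀ ε : ℝ≥0∞, 0 < ε → ∃ ψ : Space → Spinor, IsTestSpinor R ψ ∧
    eLpNorm (φ - ψ) 2 volume < ε ∧ ∀ j, eLpNorm (g j - partialDeriv j ψ) 2 volume < ε

/-- `(σ · ∇)φ = σ₁ ∂₁φ + σ₂ ∂₂φ + σ₃ ∂₃φ`, where `g` is the family of partial derivatives of `φ`. -/
noncomputable def sigmaGrad (g : Fin 3 → Space → Spinor) (x : Space) : Spinor :=
  ∑ j, Matrix.toEuclideanLin (pauli j) (g j x)

/-- The Hardy inequality for the Dirac operator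
`∫ |σ·∇φ|² / (1 + W(|x|)/|x|) + |φ|² dx ≥ ∫ W(|x|)/|x| |φ|² dx` for all `φ ∈ H¹₀(B_R, ℂ²)`.
A surface term `C(R) ∫_{S_R} |φ|² dμ_R` does not occur, since such `φ` have trace zero on the
sphere `S_R`.  The integrands are nonnegative (for `W ≥ 0`), so that Lebesgue integrals with
values in `[0, ∞]` are used. -/
def DiracHardyOn (R : ℝ) (W : ℝ → ℝ) : Prop :=
  ∀ (φ : Space → Spinor) (g : Fin 3 → Space → Spinor), MemH10 R φ g →
    ∫⁻ x, ENNReal.ofReal (W ‖x‖ / ‖x‖ * ‖φ x‖ ^ 2) ≤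
      ∫⁻ x, ENNReal.ofReal (‖sigmaGrad g x‖ ^ 2 / (1 + W ‖x‖ / ‖x‖) + ‖φ x‖ ^ 2)

/-- Profiles `W : [0, ∞) → [0, ∞)` of radial functions `x ↦ W(|x|)` that are continuous,
differentiable almost everywhere, and satisfy `-r ≤ r W'(r) ≤ 3 W(r) + 2 r` for almost every
`r ∈ (0, R)`.  Values of `W` at negative arguments play no role. -/
structure IsProfile (R : ℝ) (W : ℝ → ℝ) : Prop where
  continuousOn : ContinuousOn W (Ici 0)
  nonneg : ∀ s, 0 ≤ s → 0 ≤ W s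
  differentiable_ae : ∀ᵐ s ∂(volume.restrict (Ioi (0 : ℝ))), DifferentiableAt ℝ W s
  deriv_bound : ∀ᵐ r ∂(volume.restrict (Ioo 0 R)),
    -r ≤ r * deriv W r ∧ r * deriv W r ≤ 3 * W r + 2 * r

/-- The iterated logarithms: `X₁(s) = (a - log s)⁻¹` and `X_{k+1} = X₁ ∘ X_k` (with `X₀ = id`). -/
noncomputable def X (a : ℝ) : ℕ → ℝ → ℝ
  | 0, s => s
  | k + 1, s => (a - Real.log (X a k s))⁻¹

/-- The product `X₁(s) ⋯ X_k(s)`. -/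
noncomputable def prodX (a : ℝ) (k : ℕ) (s : ℝ) : ℝ :=
  ∏ j ∈ Finset.Icc 1 k, X a j s

/-- `W_∞(s) = 1 + (1/8) ∑_{j ≥ 1} X₁(s)² ⋯ X_j(s)²`. -/
noncomputable def WInf (a : ℝ) (s : ℝ) : ℝ :=
  1 + 1 / 8 * ∑' j : ℕ, prodX a (j + 1) s ^ 2

/-- The lower limit, in `[-∞, ∞]`, as `s → 0⁺` of
`(W(s) - 1 - (1/8) ∑_{j=1}^k X₁(s)² ⋯ X_j(s)²) · X₁(s)⁻² ⋯ X_{k+1}(s)⁻²`. -/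
noncomputable def growthCoeff (a : ℝ) (W : ℝ → ℝ) (k : ℕ) : EReal :=
  liminf (fun s : ℝ =>
    (((W s - 1 - 1 / 8 * ∑ j ∈ Finset.Icc 1 k, prodX a j s ^ 2) / prodX a (k + 1) s ^ 2 : ℝ) :
      EReal)) (𝓝[>] (0 : ℝ))

end DiracHardy

/-!
The weighted form is computed on the real components `u` of a spinor `φ` with gradients `∇u`.
Pointwise `|σ·∇φ|² = |∇φ|² + 2C(∇u)`, where `C` (`crossTerm`) is a sum of null forms
`∂ₐv ∂ᵦw - ∂ᵦv ∂ₐw`. Against a radial weight `m` the null forms integrate by parts into the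
spin–orbit term with weight `m'/r` (`isNull_cross`). By the identity `(σ·L)² + σ·L = L²` for the
angular momentum `L`, which holds against every radial weight (`isNull_angular`), that term becomes
`-2C` of the angular gradients, and `2C(w) ≤ |w|²` for tangential `w`
(`two_mul_crossTerm_ang_le`) bounds it by the angular part of `m|∇φ|²`, as long as
`0 ≤ r m' ≤ m`. What is left is the radial part, estimated by completing the square with a
function `z` (`isNull_radial`). With `m = r/(W + r)`, these facts combine in `pointwise_bound` to
the inequality for all weights with `-1 ≤ W'`, `r W' ≤ W` that admit a supersolution `z` of
`2z + r z' - z²(W + r) + r - W ≥ 0` (`hardy_of_supersolution`). No expansion into spherical spinors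
is used. The inequality extends to `H¹₀` because a point has zero capacity in `ℝ³`
(`exists_cutoff`) and because it is closed under `H¹` limits (`HardyFor.of_approx`).

*Existence.* Writing `z = 1 + y`, `W = 1 + w`, the condition reads `riccati w r y (r y') ≥ 0`, whose
leading part is `r y' ≥ y² + 2w`. For `w = W_∞ - 1` equality holds there at
`y = (X₁ + X₁X₂ + ⋯)/2`, by the derivative formula `hasDerivAt_seriesX`; adding `X₁²` absorbs the
remainder near the origin (`eventually_riccati_innerSol`). The weight `profile` agrees with `W_∞` up
to a small `δ` and then drops, by an amount of order `r`, which lets `y = (3/4)/(κ - log r)` be a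
supersolution away from the origin, for every radius `R` (`riccati_outerSol`). Since `riccati` is
concave in `y`, the two can be glued by a monotone cutoff where the first is below the second
(`riccati_interpolate`, `exists_profile`). That the limits defining the growth coefficients of `W_∞`
equal `1/8` is `tendsto_growth_WInf`.

*Optimality.* If a growth coefficient of order `k` exceeded `1/8`, then `W + r ≥ 1 + u` near the
origin, where `u = (X₁² + ⋯ + X₁²⋯X_{k+1}²)/8 + ε X₁²⋯X_{k+1}² + r` (`comparison`). The inequality
is tested with radial spinors `g(r)/r` times a constant spinor (`radial_inequality`), where
`g = (X₁⋯X_{k+1})^{-1/2} η(v)` and `v = 1/X_{k+2}`. Up to exact derivatives and errors quadratic in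
`u`, the integrand becomes `η'² - ε η²` in the variable `v` (`radial_integrand_le`), and `v → ∞`
at the origin, so that there is room for a bump `η` wide enough to make the integral negative
(`exists_wide_bump`, `growthCoeff_le`).
-/

namespace DiracHardy

/-! ### Iterated logarithms -/

section IteratedLog

variable {a s : ℝ}

lemma X_zero (a s : ℝ) : X a 0 s = s := rfl

lemma X_succ (a : ℝ) (k : ℕ) (s : ℝ) : X a (k + 1) s = (a - Real.log (X a k s))⁻¹ := rfl

lemma prodX_zero (a s : ℝ) : prodX a 0 s = 1 := by simp [prodX]

lemma prodX_succ (a : ℝ) (k : ℕ) (s : ℝ) : prodX a (k + 1) s = prodX a k s * X a (k + 1) s := by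
  simp [prodX, Finset.prod_Icc_succ_top]

lemma X_mem (ha : 1 < a) (hs : s ∈ Ioo 0 (Real.exp (a - 1))) (k : ℕ) :
    X a k s ∈ Ioo 0 (Real.exp (a - 1)) ∧ 1 < a - Real.log (X a k s) := by
  induction k with
  | zero =>
    refine ⟨hs, ?_⟩
    have := (Real.log_lt_iff_lt_exp hs.1).2 hs.2
    simp only [X_zero]; linarith
  | succ k ih =>
    have h1 : X a (k + 1) s ∈ Ioo (0 : ℝ) 1 := by
      rw [X_succ]
      exact ⟨inv_pos.2 (by linarith [ih.2]), inv_lt_one_of_one_lt₀ ih.2⟩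
    refine ⟨⟨h1.1, h1.2.trans (Real.one_lt_exp_iff.2 (by linarith))⟩, ?_⟩
    have := Real.log_neg h1.1 h1.2
    linarith

lemma X_pos (ha : 1 < a) (hs : s ∈ Ioo 0 (Real.exp (a - 1))) (k : ℕ) : 0 < X a k s :=
  (X_mem ha hs k).1.1

lemma X_succ_lt_one (ha : 1 < a) (hs : s ∈ Ioo 0 (Real.exp (a - 1))) (k : ℕ) :
    X a (k + 1) s < 1 := by
  rw [X_succ]; exact inv_lt_one_of_one_lt₀ (X_mem ha hs k).2

lemma X_add_two_le (ha : 1 < a) (hs : s ∈ Ioo 0 (Real.exp (a - 1))) (k : ℕ) :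
    X a (k + 2) s ≤ a⁻¹ := by
  rw [X_succ]
  have := Real.log_neg (X_pos ha hs (k + 1)) (X_succ_lt_one ha hs k)
  exact inv_anti₀ (by linarith) (by linarith)

lemma prodX_pos (ha : 1 < a) (hs : s ∈ Ioo 0 (Real.exp (a - 1))) (k : ℕ) : 0 < prodX a k s :=
  Finset.prod_pos fun j _ => X_pos ha hs j

lemma prodX_one (a s : ℝ) : prodX a 1 s = X a 1 s := by simp [prodX]

lemma prodX_succ_le (ha : 1 < a) (hs : s ∈ Ioo 0 (Real.exp (a - 1))) (k : ℕ) :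
    prodX a (k + 1) s ≤ X a 1 s * a⁻¹ ^ k := by
  induction k with
  | zero => simp [prodX_one]
  | succ k ih =>
    rw [prodX_succ, pow_succ, ← mul_assoc]
    exact mul_le_mul ih (X_add_two_le ha hs k) (X_pos ha hs _).le
      ((prodX_pos ha hs _).le.trans ih)

lemma prodX_add_two_le (ha : 1 < a) (hs : s ∈ Ioo 0 (Real.exp (a - 1))) (k : ℕ) :
    prodX a (k + 2) s ≤ X a 1 s * X a 2 s * a⁻¹ ^ k := by
  induction k with
  | zero => simp [prodX_succ, prodX_zero]
  | succ k ih =>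
    rw [prodX_succ, pow_succ, ← mul_assoc]
    exact mul_le_mul ih (X_add_two_le ha hs (k + 1)) (X_pos ha hs _).le
      ((prodX_pos ha hs _).le.trans ih)

lemma prodX_le_one (ha : 1 < a) (hs : s ∈ Ioo 0 (Real.exp (a - 1))) (k : ℕ) :
    prodX a k s ≤ 1 := by
  refine Finset.prod_le_one (fun j _ => (X_pos ha hs j).le) fun j hj => ?_
  obtain ⟨i, rfl⟩ : ∃ i, j = i + 1 := ⟨j - 1, by have := (Finset.mem_Icc.1 hj).1; omega⟩
  exact (X_succ_lt_one ha hs i).le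

lemma hasDerivAt_X (ha : 1 < a) (hs : s ∈ Ioo 0 (Real.exp (a - 1))) (k : ℕ) :
    HasDerivAt (X a k) (X a k s * prodX a k s / s) s := by
  have hs0 := hs.1.ne'
  induction k with
  | zero =>
    exact (hasDerivAt_id s).congr_deriv (by simp [X_zero, prodX_zero, hs0])
  | succ k ih =>
    have hX := (X_pos ha hs k).ne'
    have hL : a - Real.log (X a k s) ≠ 0 := by linarith [(X_mem ha hs k).2]
    refine HasDerivAt.congr_deriv (((ih.log hX).const_sub a).inv hL) ?_
    rw [prodX_succ, X_succ]
    field_simp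

/-- The partial sum `X₁ + X₁X₂ + ⋯ + X₁⋯X_k`, half of which is the logarithmic derivative of
`(X₁⋯X_k)^{1/2}` with respect to `log s`. -/
noncomputable def sumX (a : ℝ) (k : ℕ) (s : ℝ) : ℝ := ∑ j ∈ Finset.Icc 1 k, prodX a j s

/-- The partial sum `X₁² + X₁²X₂² + ⋯ + X₁²⋯X_k²`. -/
noncomputable def sumSqX (a : ℝ) (k : ℕ) (s : ℝ) : ℝ := ∑ j ∈ Finset.Icc 1 k, prodX a j s ^ 2

lemma sumX_succ (a : ℝ) (k : ℕ) (s : ℝ) : sumX a (k + 1) s = sumX a k s + prodX a (k + 1) s := by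
  simp [sumX, Finset.sum_Icc_succ_top]

lemma sumSqX_succ (a : ℝ) (k : ℕ) (s : ℝ) :
    sumSqX a (k + 1) s = sumSqX a k s + prodX a (k + 1) s ^ 2 := by
  simp [sumSqX, Finset.sum_Icc_succ_top]

lemma sumX_nonneg (ha : 1 < a) (hs : s ∈ Ioo 0 (Real.exp (a - 1))) (k : ℕ) : 0 ≤ sumX a k s :=
  Finset.sum_nonneg fun j _ => (prodX_pos ha hs j).le

lemma sumSqX_nonneg (a : ℝ) (k : ℕ) (s : ℝ) : 0 ≤ sumSqX a k s :=
  Finset.sum_nonneg fun _ _ => sq_nonneg _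

lemma sumX_eq_range (a : ℝ) (k : ℕ) (s : ℝ) :
    sumX a k s = ∑ j ∈ Finset.range k, prodX a (j + 1) s := by
  induction k with
  | zero => simp [sumX]
  | succ k ih => rw [sumX_succ, Finset.sum_range_succ, ih]

lemma sumSqX_eq_range (a : ℝ) (k : ℕ) (s : ℝ) :
    sumSqX a k s = ∑ j ∈ Finset.range k, prodX a (j + 1) s ^ 2 := by
  induction k with
  | zero => simp [sumSqX]
  | succ k ih => rw [sumSqX_succ, Finset.sum_range_succ, ih]

lemma hasDerivAt_prodX (ha : 1 < a) (hs : s ∈ Ioo 0 (Real.exp (a - 1))) (k : ℕ) :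
    HasDerivAt (prodX a k) (prodX a k s * sumX a k s / s) s := by
  induction k with
  | zero =>
    have : prodX a 0 = fun _ => 1 := funext (prodX_zero a)
    simp only [this, sumX]
    simpa using hasDerivAt_const s (1 : ℝ)
  | succ k ih =>
    have : prodX a (k + 1) = prodX a k * X a (k + 1) := funext (prodX_succ a k)
    rw [this]
    refine (ih.mul (hasDerivAt_X ha hs (k + 1))).congr_deriv ?_
    rw [← this, sumX_succ, prodX_succ]
    ring

/-- Since `S_k = X₁ + ⋯ + X₁⋯X_k` has derivative `∑ X₁⋯X_j S_j` with respect to `log s`, twice that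
derivative is `S_k² + ∑ (X₁⋯X_j)²`. -/
lemma hasDerivAt_sumX (ha : 1 < a) (hs : s ∈ Ioo 0 (Real.exp (a - 1))) (k : ℕ) :
    HasDerivAt (sumX a k) ((sumX a k s ^ 2 + sumSqX a k s) / (2 * s)) s := by
  have hs0 := hs.1.ne'
  induction k with
  | zero =>
    have : sumX a 0 = fun _ => 0 := by funext s; simp [sumX]
    simp only [this, sumSqX]
    simpa using hasDerivAt_const s (0 : ℝ)
  | succ k ih =>
    have : sumX a (k + 1) = sumX a k + prodX a (k + 1) := funext (sumX_succ a k)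
    rw [this]
    refine (ih.add (hasDerivAt_prodX ha hs (k + 1))).congr_deriv ?_
    rw [← this, sumX_succ, sumSqX_succ]
    field_simp
    ring

lemma hasDerivAt_prodX_sq (ha : 1 < a) (hs : s ∈ Ioo 0 (Real.exp (a - 1))) (k : ℕ) :
    HasDerivAt (fun s => prodX a k s ^ 2) (2 * prodX a k s ^ 2 * sumX a k s / s) s := by
  refine ((hasDerivAt_prodX ha hs k).fun_pow 2).congr_deriv ?_
  ring

lemma tendsto_log_inv {f : ℝ → ℝ} (a : ℝ) (hf : Tendsto f (𝓝[>] 0) (𝓝[>] 0)) :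
    Tendsto (fun s => (a - Real.log (f s))⁻¹) (𝓝[>] 0) (𝓝[>] 0) := by
  have h1 : Tendsto (fun s => a - Real.log (f s)) (𝓝[>] 0) atTop := by
    have := (tendsto_neg_atBot_atTop.comp (Real.tendsto_log_nhdsGT_zero.comp hf))
    exact (tendsto_atTop_add_const_left _ a this).congr fun s => by simp [sub_eq_add_neg]
  exact tendsto_inv_atTop_nhdsGT_zero.comp h1

lemma tendsto_X (a : ℝ) (k : ℕ) : Tendsto (X a k) (𝓝[>] 0) (𝓝[>] 0) := by
  induction k with
  | zero => exact tendsto_id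
  | succ k ih => exact tendsto_log_inv a ih

lemma Ioo_exp_mem (a : ℝ) : Ioo (0 : ℝ) (Real.exp (a - 1)) ∈ 𝓝[>] (0 : ℝ) :=
  Ioo_mem_nhdsGT (Real.exp_pos _)

/-- Every power of `s` is eventually negligible against every power of `X₁(s)`. -/
lemma tendsto_div_X_one_pow (a : ℝ) (n : ℕ) :
    Tendsto (fun s => s / X a 1 s ^ n) (𝓝[>] 0) (𝓝 0) := by
  have h : Tendsto (fun t : ℝ => (1 * t + a) ^ n * Real.exp (-t)) atTop (𝓝 0) := by
    have := Real.tendsto_pow_mul_exp_neg_atTop_nhds_zero n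
    have h2 := (this.comp (tendsto_atTop_add_const_right atTop a tendsto_id)).mul_const (Real.exp a)
    simp only [zero_mul] at h2
    refine h2.congr fun t => ?_
    simp only [Function.comp, id, one_mul, mul_assoc, ← Real.exp_add]
    congr 2; ring
  have := h.comp (tendsto_neg_atBot_atTop.comp Real.tendsto_log_nhdsGT_zero)
  refine this.congr' ?_
  filter_upwards [self_mem_nhdsWithin] with s hs
  simp only [Function.comp, X_succ, X_zero, neg_neg, Real.exp_log hs]
  rw [inv_pow, div_inv_eq_mul, mul_comm]
  congr 2; ring

lemma contDiffAt_X (ha : 1 < a) (hs : s ∈ Ioo 0 (Real.exp (a - 1))) (k : ℕ) :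
    ContDiffAt ℝ ∞ (X a k) s := by
  induction k with
  | zero => exact contDiffAt_id
  | succ k ih =>
    exact (contDiffAt_const.sub (ih.log (X_pos ha hs k).ne')).inv
      (by linarith [(X_mem ha hs k).2])

lemma contDiffAt_prodX (ha : 1 < a) (hs : s ∈ Ioo 0 (Real.exp (a - 1))) (k : ℕ) :
    ContDiffAt ℝ ∞ (prodX a k) s := by
  unfold prodX
  exact contDiffAt_prod fun j _ => contDiffAt_X ha hs j

end IteratedLog

/-! ### The infinite series -/

section Series

variable {a s : ℝ}

/-- The sum of the series `X₁ + X₁X₂ + X₁X₂X₃ + ⋯`. -/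
noncomputable def seriesX (a : ℝ) (s : ℝ) : ℝ := ∑' j : ℕ, prodX a (j + 1) s

/-- The sum of the series `X₁² + X₁²X₂² + ⋯`. -/
noncomputable def seriesSqX (a : ℝ) (s : ℝ) : ℝ := ∑' j : ℕ, prodX a (j + 1) s ^ 2

/-- The derivative of `seriesSqX` with respect to `log s`. -/
noncomputable def seriesDerivX (a : ℝ) (s : ℝ) : ℝ :=
  ∑' j : ℕ, 2 * prodX a (j + 1) s ^ 2 * sumX a (j + 1) s

lemma summable_geom (ha : 1 < a) : Summable fun k : ℕ => a⁻¹ ^ k :=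
  summable_geometric_of_lt_one (by positivity) (inv_lt_one_of_one_lt₀ ha)

lemma prodX_succ_le_geom (ha : 1 < a) (hs : s ∈ Ioo 0 (Real.exp (a - 1))) (k : ℕ) :
    prodX a (k + 1) s ≤ a⁻¹ ^ k :=
  (prodX_succ_le ha hs k).trans (mul_le_of_le_one_left (by positivity) (X_succ_lt_one ha hs 0).le)

lemma summable_prodX (ha : 1 < a) (hs : s ∈ Ioo 0 (Real.exp (a - 1))) :
    Summable fun j : ℕ => prodX a (j + 1) s :=
  Summable.of_nonneg_of_le (fun _ => (prodX_pos ha hs _).le) (prodX_succ_le_geom ha hs)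
    (summable_geom ha)

lemma prodX_sq_le (ha : 1 < a) (hs : s ∈ Ioo 0 (Real.exp (a - 1))) (k : ℕ) :
    prodX a (k + 1) s ^ 2 ≤ X a 1 s * prodX a (k + 1) s := by
  rw [sq]
  refine mul_le_mul_of_nonneg_right ((prodX_succ_le ha hs k).trans ?_) (prodX_pos ha hs _).le
  exact mul_le_of_le_one_right (X_pos ha hs 1).le
    (pow_le_one₀ (by positivity) (inv_lt_one_of_one_lt₀ ha).le)

lemma prodX_sq_le_geom (ha : 1 < a) (hs : s ∈ Ioo 0 (Real.exp (a - 1))) (k : ℕ) :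
    prodX a (k + 1) s ^ 2 ≤ a⁻¹ ^ k := by
  refine le_trans ?_ (prodX_succ_le_geom ha hs k)
  rw [sq]
  exact mul_le_of_le_one_left (prodX_pos ha hs _).le (prodX_le_one ha hs _)

lemma summable_prodX_sq (ha : 1 < a) (hs : s ∈ Ioo 0 (Real.exp (a - 1))) :
    Summable fun j : ℕ => prodX a (j + 1) s ^ 2 :=
  Summable.of_nonneg_of_le (fun _ => sq_nonneg _) (prodX_sq_le_geom ha hs) (summable_geom ha)

lemma sumX_le_series (ha : 1 < a) (hs : s ∈ Ioo 0 (Real.exp (a - 1))) (k : ℕ) :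
    sumX a k s ≤ seriesX a s := by
  rw [sumX_eq_range]
  exact (summable_prodX ha hs).sum_le_tsum _ fun j _ => (prodX_pos ha hs _).le

lemma seriesX_le_geom (ha : 1 < a) (hs : s ∈ Ioo 0 (Real.exp (a - 1))) :
    seriesX a s ≤ ∑' k : ℕ, a⁻¹ ^ k :=
  (summable_prodX ha hs).tsum_le_tsum (prodX_succ_le_geom ha hs) (summable_geom ha)

lemma seriesSqX_nonneg (a s : ℝ) : 0 ≤ seriesSqX a s := tsum_nonneg fun _ => sq_nonneg _

lemma WInf_eq (a s : ℝ) : WInf a s = 1 + seriesSqX a s / 8 := by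
  simp only [WInf, seriesSqX]; ring

lemma tendsto_sumX (ha : 1 < a) (hs : s ∈ Ioo 0 (Real.exp (a - 1))) :
    Tendsto (fun k => sumX a k s) atTop (𝓝 (seriesX a s)) := by
  simp only [sumX_eq_range]
  exact (summable_prodX ha hs).hasSum.tendsto_sum_nat

lemma tendsto_sumSqX (ha : 1 < a) (hs : s ∈ Ioo 0 (Real.exp (a - 1))) :
    Tendsto (fun k => sumSqX a k s) atTop (𝓝 (seriesSqX a s)) := by
  simp only [sumSqX_eq_range]
  exact (summable_prodX_sq ha hs).hasSum.tendsto_sum_nat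

lemma derivX_term_bounds (ha : 1 < a) (hs : s ∈ Ioo 0 (Real.exp (a - 1))) (k : ℕ) :
    0 ≤ prodX a (k + 1) s * sumX a (k + 1) s ∧
    prodX a (k + 1) s * sumX a (k + 1) s ≤ a⁻¹ ^ k * ∑' k : ℕ, a⁻¹ ^ k := by
  have h1 := (prodX_pos ha hs (k + 1)).le
  have h2 := sumX_nonneg ha hs (k + 1)
  refine ⟨by positivity, mul_le_mul (prodX_succ_le_geom ha hs k) ?_ h2 (by positivity)⟩
  exact (sumX_le_series ha hs _).trans (seriesX_le_geom ha hs)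

lemma derivSqX_term_bounds (ha : 1 < a) (hs : s ∈ Ioo 0 (Real.exp (a - 1))) (k : ℕ) :
    0 ≤ 2 * prodX a (k + 1) s ^ 2 * sumX a (k + 1) s ∧
    2 * prodX a (k + 1) s ^ 2 * sumX a (k + 1) s ≤ 2 * (a⁻¹ ^ k * ∑' k : ℕ, a⁻¹ ^ k) := by
  have h1 := (prodX_pos ha hs (k + 1)).le
  have h2 := derivX_term_bounds ha hs k
  have h3 := prodX_le_one ha hs (k + 1)
  constructor
  · nlinarith
  · nlinarith

lemma exists_half_lt (hs : s ∈ Ioo 0 (Real.exp (a - 1))) :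
    s ∈ Ioo (s / 2) (Real.exp (a - 1)) ∧ Ioo (s / 2) (Real.exp (a - 1)) ⊆ Ioo 0 (Real.exp (a - 1)) :=
  ⟨⟨by linarith [hs.1], hs.2⟩, fun _ ht => ⟨by linarith [hs.1, ht.1], ht.2⟩⟩

lemma hasDerivAt_seriesX (ha : 1 < a) (hs : s ∈ Ioo 0 (Real.exp (a - 1))) :
    HasDerivAt (seriesX a) ((seriesX a s ^ 2 + seriesSqX a s) / (2 * s)) s := by
  obtain ⟨hmem, hsub⟩ := exists_half_lt hs
  have hu : Summable fun k : ℕ => a⁻¹ ^ k * (∑' k : ℕ, a⁻¹ ^ k) / (s / 2) :=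
    ((summable_geom ha).mul_right _).div_const _
  have hbd : ∀ (k : ℕ) (t : ℝ), t ∈ Ioo (s / 2) (Real.exp (a - 1)) →
      ‖prodX a (k + 1) t * sumX a (k + 1) t / t‖ ≤ a⁻¹ ^ k * (∑' k : ℕ, a⁻¹ ^ k) / (s / 2) := by
    intro k t ht
    obtain ⟨h0, h1⟩ := derivX_term_bounds ha (hsub ht) k
    rw [Real.norm_of_nonneg (div_nonneg h0 (hsub ht).1.le)]
    exact div_le_div₀ (h0.trans h1) h1 (by linarith [hs.1]) ht.1.le
  have key := hasDerivAt_tsum_of_isPreconnected hu isOpen_Ioo isPreconnected_Ioo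
    (fun k t ht => hasDerivAt_prodX ha (hsub ht) (k + 1)) hbd hmem (summable_prodX ha hs) hmem
  refine key.congr_deriv ?_
  have hsum : Summable fun k : ℕ => prodX a (k + 1) s * sumX a (k + 1) s / s :=
    Summable.of_norm_bounded hu fun k => hbd k s hmem
  -- both sides are limits of the derivatives of the partial sums
  refine tendsto_nhds_unique hsum.hasSum.tendsto_sum_nat ?_
  have hlim := (((tendsto_sumX ha hs).pow 2).add (tendsto_sumSqX ha hs)).div_const (2 * s)
  refine hlim.congr fun k => ?_
  have h1 := hasDerivAt_sumX ha hs k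
  have h2 : HasDerivAt (sumX a k)
      (∑ j ∈ Finset.range k, prodX a (j + 1) s * sumX a (j + 1) s / s) s := by
    have : sumX a k = fun s => ∑ j ∈ Finset.range k, prodX a (j + 1) s := funext (sumX_eq_range a k)
    rw [this]
    exact HasDerivAt.fun_sum fun j _ => hasDerivAt_prodX ha hs (j + 1)
  exact h1.unique h2

lemma hasDerivAt_seriesSqX (ha : 1 < a) (hs : s ∈ Ioo 0 (Real.exp (a - 1))) :
    HasDerivAt (seriesSqX a) (seriesDerivX a s / s) s := by
  obtain ⟨hmem, hsub⟩ := exists_half_lt hs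
  have hu : Summable fun k : ℕ => 2 * (a⁻¹ ^ k * (∑' k : ℕ, a⁻¹ ^ k)) / (s / 2) :=
    (((summable_geom ha).mul_right _).mul_left _).div_const _
  have hbd : ∀ (k : ℕ) (t : ℝ), t ∈ Ioo (s / 2) (Real.exp (a - 1)) →
      ‖2 * prodX a (k + 1) t ^ 2 * sumX a (k + 1) t / t‖ ≤
        2 * (a⁻¹ ^ k * (∑' k : ℕ, a⁻¹ ^ k)) / (s / 2) := by
    intro k t ht
    obtain ⟨h0, h1⟩ := derivSqX_term_bounds ha (hsub ht) k
    rw [Real.norm_of_nonneg (div_nonneg h0 (hsub ht).1.le)]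
    exact div_le_div₀ (h0.trans h1) h1 (by linarith [hs.1]) ht.1.le
  have key := hasDerivAt_tsum_of_isPreconnected hu isOpen_Ioo isPreconnected_Ioo
    (fun k t ht => hasDerivAt_prodX_sq ha (hsub ht) (k + 1)) hbd hmem (summable_prodX_sq ha hs) hmem
  refine key.congr_deriv ?_
  rw [seriesDerivX, tsum_div_const]

lemma continuousOn_seriesDerivX (ha : 1 < a) :
    ContinuousOn (seriesDerivX a) (Ioo 0 (Real.exp (a - 1))) := by
  refine continuousOn_tsum (u := fun k : ℕ => 2 * (a⁻¹ ^ k * (∑' k : ℕ, a⁻¹ ^ k))) (fun k => ?_)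
    (((summable_geom ha).mul_right _).mul_left _) fun k t ht => ?_
  · intro t ht
    exact ((hasDerivAt_prodX_sq ha ht (k + 1)).continuousAt.const_mul 2 |>.mul
      (hasDerivAt_sumX ha ht (k + 1)).continuousAt).continuousWithinAt
  · obtain ⟨h0, h1⟩ := derivSqX_term_bounds ha ht k
    rwa [Real.norm_of_nonneg h0]

lemma seriesDerivX_nonneg (ha : 1 < a) (hs : s ∈ Ioo 0 (Real.exp (a - 1))) :
    0 ≤ seriesDerivX a s := tsum_nonneg fun k => (derivSqX_term_bounds ha hs k).1

lemma seriesDerivX_le (ha : 1 < a) (hs : s ∈ Ioo 0 (Real.exp (a - 1))) :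
    seriesDerivX a s ≤ 2 * seriesSqX a s * seriesX a s := by
  rw [seriesDerivX, seriesSqX, ← tsum_mul_left, ← tsum_mul_right]
  refine Summable.tsum_le_tsum (fun k => ?_) ?_ (((summable_prodX_sq ha hs).mul_left 2).mul_right _)
  · exact mul_le_mul_of_nonneg_left (sumX_le_series ha hs _) (by positivity)
  · exact Summable.of_nonneg_of_le (fun k => (derivSqX_term_bounds ha hs k).1)
      (fun k => (derivSqX_term_bounds ha hs k).2) (((summable_geom ha).mul_right _).mul_left _)

lemma seriesSqX_le (ha : 1 < a) (hs : s ∈ Ioo 0 (Real.exp (a - 1))) :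
    seriesSqX a s ≤ X a 1 s * seriesX a s := by
  rw [seriesX, ← tsum_mul_left]
  exact (summable_prodX_sq ha hs).tsum_le_tsum (prodX_sq_le ha hs)
    ((summable_prodX ha hs).mul_left _)

lemma seriesX_le (ha : 1 < a) (hs : s ∈ Ioo 0 (Real.exp (a - 1))) :
    seriesX a s ≤ X a 1 s * (1 + X a 2 s * ∑' k : ℕ, a⁻¹ ^ k) := by
  rw [seriesX, (summable_prodX ha hs).tsum_eq_zero_add, zero_add, prodX_one, mul_add, mul_one,
    ← mul_assoc, ← tsum_mul_left]
  refine add_le_add_right ?_ _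
  exact ((summable_nat_add_iff 1).2 (summable_prodX ha hs)).tsum_le_tsum (prodX_add_two_le ha hs)
    ((summable_geom ha).mul_left _)

lemma X_one_le_seriesX (ha : 1 < a) (hs : s ∈ Ioo 0 (Real.exp (a - 1))) : X a 1 s ≤ seriesX a s := by
  simpa [sumX, prodX_one] using sumX_le_series ha hs 1

/-- `X₁ + X₁X₂ + ⋯` is asymptotic to its first term at the origin. -/
lemma eventually_seriesX_le (ha : 1 < a) {c : ℝ} (hc : 1 < c) :
    ∀ᶠ s in 𝓝[>] (0 : ℝ), seriesX a s ≤ c * X a 1 s := by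
  have h : Tendsto (fun s => 1 + X a 2 s * ∑' k : ℕ, a⁻¹ ^ k) (𝓝[>] 0)
      (𝓝 (1 + 0 * ∑' k : ℕ, a⁻¹ ^ k)) :=
    (((tendsto_X a 2).mono_right nhdsWithin_le_nhds).mul_const _).const_add 1
  rw [zero_mul, add_zero] at h
  filter_upwards [h.eventually_lt_const hc, Ioo_exp_mem a] with s h1 h2
  refine (seriesX_le ha h2).trans ?_
  rw [mul_comm]
  exact mul_le_mul_of_nonneg_right h1.le (X_pos ha h2 1).le

lemma tendsto_seriesSqX (ha : 1 < a) : Tendsto (seriesSqX a) (𝓝[>] 0) (𝓝 0) := by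
  have h1 : Tendsto (fun s => X a 1 s * ∑' k : ℕ, a⁻¹ ^ k) (𝓝[>] 0) (𝓝 (0 * ∑' k : ℕ, a⁻¹ ^ k)) :=
    ((tendsto_X a 1).mono_right nhdsWithin_le_nhds).mul_const _
  rw [zero_mul] at h1
  refine tendsto_of_tendsto_of_tendsto_of_le_of_le' tendsto_const_nhds h1
    (Eventually.of_forall fun s => seriesSqX_nonneg a s) ?_
  filter_upwards [Ioo_exp_mem a] with s hs
  exact (seriesSqX_le ha hs).trans
    (mul_le_mul_of_nonneg_left (seriesX_le_geom ha hs) (X_pos ha hs 1).le)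

lemma tendsto_seriesDerivX (ha : 1 < a) : Tendsto (seriesDerivX a) (𝓝[>] 0) (𝓝 0) := by
  have h1 : Tendsto (fun s => 2 * seriesSqX a s * ∑' k : ℕ, a⁻¹ ^ k) (𝓝[>] 0)
      (𝓝 (2 * 0 * ∑' k : ℕ, a⁻¹ ^ k)) := ((tendsto_seriesSqX ha).const_mul 2).mul_const _
  rw [mul_zero, zero_mul] at h1
  refine tendsto_of_tendsto_of_tendsto_of_le_of_le' tendsto_const_nhds h1 ?_ ?_
  · filter_upwards [Ioo_exp_mem a] with s hs using seriesDerivX_nonneg ha hs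
  · filter_upwards [Ioo_exp_mem a] with s hs
    exact (seriesDerivX_le ha hs).trans
      (mul_le_mul_of_nonneg_left (seriesX_le_geom ha hs) (by linarith [seriesSqX_nonneg a s]))

lemma seriesSqX_mono (ha : 1 < a) {s t : ℝ} (hs : 0 < s) (hst : s ≤ t) (ht : t < Real.exp (a - 1)) :
    seriesSqX a s ≤ seriesSqX a t := by
  have hmono : MonotoneOn (seriesSqX a) (Ioo 0 (Real.exp (a - 1))) := by
    refine monotoneOn_of_deriv_nonneg (convex_Ioo _ _)
      (fun t ht => (hasDerivAt_seriesSqX ha ht).continuousAt.continuousWithinAt)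
      (fun t ht => ?_) fun t ht => ?_
    · rw [interior_Ioo] at ht
      exact (hasDerivAt_seriesSqX ha ht).differentiableAt.differentiableWithinAt
    · rw [interior_Ioo] at ht
      rw [(hasDerivAt_seriesSqX ha ht).deriv]
      exact div_nonneg (seriesDerivX_nonneg ha ht) ht.1.le
  exact hmono ⟨hs, hst.trans_lt ht⟩ ⟨hs.trans_le hst, ht⟩ hst

/-- The growth coefficients of `W_∞` are limits. -/
lemma tendsto_growth_WInf (ha : 1 < a) (k : ℕ) :
    Tendsto (fun s => (WInf a s - 1 - 1 / 8 * ∑ j ∈ Finset.Icc 1 k, prodX a j s ^ 2) /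
      prodX a (k + 1) s ^ 2) (𝓝[>] 0) (𝓝 (1 / 8)) := by
  set C := ∑' k : ℕ, a⁻¹ ^ k
  have h1 : Tendsto (fun s => 1 / 8 * (1 + X a (k + 2) s * C)) (𝓝[>] 0)
      (𝓝 (1 / 8 * (1 + 0 * C))) :=
    ((((tendsto_X a (k + 2)).mono_right nhdsWithin_le_nhds).mul_const _).const_add 1).const_mul _
  rw [zero_mul, add_zero, mul_one] at h1
  have key : ∀ s ∈ Ioo (0 : ℝ) (Real.exp (a - 1)),
      seriesSqX a s - sumSqX a k s =
        prodX a (k + 1) s ^ 2 + ∑' j : ℕ, prodX a (k + j + 2) s ^ 2 := by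
    intro s hs
    have h := (summable_prodX_sq ha hs).sum_add_tsum_nat_add (k + 1)
    rw [← sumSqX_eq_range, sumSqX_succ] at h
    have e : ∀ j : ℕ, j + (k + 1) + 1 = k + j + 2 := fun j => by ring
    simp only [e] at h
    rw [seriesSqX]
    linarith
  refine tendsto_of_tendsto_of_tendsto_of_le_of_le' tendsto_const_nhds h1 ?_ ?_
  · filter_upwards [Ioo_exp_mem a] with s hs
    have h0 := prodX_pos ha hs (k + 1)
    rw [le_div_iff₀ (by positivity), WInf_eq]
    have := key s hs
    have h2 : 0 ≤ ∑' j : ℕ, prodX a (k + j + 2) s ^ 2 := tsum_nonneg fun _ => sq_nonneg _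
    rw [sumSqX] at this
    linarith
  · filter_upwards [Ioo_exp_mem a] with s hs
    have h0 := prodX_pos ha hs (k + 1)
    have hX := X_pos ha hs (k + 2)
    rw [div_le_iff₀ (by positivity), WInf_eq]
    have := key s hs
    rw [sumSqX] at this
    have hpow : ∀ j : ℕ, prodX a (k + j + 2) s ≤ prodX a (k + 1) s * X a (k + 2) s * a⁻¹ ^ j := by
      intro j
      induction j with
      | zero => simp [prodX_succ a (k + 1)]
      | succ j ih =>
        rw [show k + (j + 1) + 2 = (k + j + 2) + 1 by ring, prodX_succ, pow_succ, ← mul_assoc]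
        exact mul_le_mul ih (X_add_two_le ha hs (k + j + 1)) (X_pos ha hs _).le (by positivity)
    have hle : ∑' j : ℕ, prodX a (k + j + 2) s ^ 2 ≤ prodX a (k + 1) s ^ 2 * X a (k + 2) s * C := by
      rw [← tsum_mul_left]
      have hterm : ∀ j : ℕ, prodX a (k + j + 2) s ^ 2 ≤
          prodX a (k + 1) s ^ 2 * X a (k + 2) s * a⁻¹ ^ j := by
        intro j
        have h3 := prodX_pos ha hs (k + j + 2)
        have h4 : prodX a (k + j + 2) s ≤ prodX a (k + 1) s := by
          refine (hpow j).trans ?_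
          have h5 : X a (k + 2) s * a⁻¹ ^ j ≤ 1 :=
            mul_le_one₀ (X_succ_lt_one ha hs _).le (by positivity)
              (pow_le_one₀ (by positivity) (inv_lt_one_of_one_lt₀ ha).le)
          nlinarith
        calc prodX a (k + j + 2) s ^ 2
            ≤ prodX a (k + 1) s * (prodX a (k + 1) s * X a (k + 2) s * a⁻¹ ^ j) := by
              rw [sq]; exact mul_le_mul h4 (hpow j) h3.le h0.le
          _ = _ := by ring
      refine Summable.tsum_le_tsum hterm ?_ ((summable_geom ha).mul_left _)
      exact Summable.of_nonneg_of_le (fun _ => sq_nonneg _) hterm ((summable_geom ha).mul_left _)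
    nlinarith

end Series

/-! ### Integration by parts -/

section IntegrationByParts

/-- `F` is integrable with vanishing integral, as the divergence of a compactly supported
vector field is. -/
def IsNull (F : Space → ℝ) : Prop := Integrable F ∧ ∫ x, F x = 0

lemma IsNull.add {F G : Space → ℝ} (hF : IsNull F) (hG : IsNull G) :
    IsNull fun x => F x + G x :=
  ⟨hF.1.add hG.1, by rw [integral_add hF.1 hG.1, hF.2, hG.2, add_zero]⟩

lemma IsNull.const_mul {F : Space → ℝ} (hF : IsNull F) (c : ℝ) : IsNull fun x => c * F x :=
  ⟨hF.1.const_mul c, by rw [integral_const_mul, hF.2, mul_zero]⟩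

lemma IsNull.congr {F G : Space → ℝ} (hF : IsNull F) (h : ∀ x, F x = G x) : IsNull G := by
  rwa [← funext h]

lemma contDiffAt_partialDeriv {F : Type*} [NormedAddCommGroup F] [NormedSpace ℝ F]
    {u : Space → F} {x : Space} {n : ℕ∞ω} (j : Fin 3)
    (hu : ContDiffAt ℝ (n + 1) u x) : ContDiffAt ℝ n (partialDeriv j u) x :=
  (hu.fderiv_right le_rfl).clm_apply contDiffAt_const

lemma continuous_partialDeriv {F : Type*} [NormedAddCommGroup F] [NormedSpace ℝ F]
    {u : Space → F} (j : Fin 3) (hu : ContDiff ℝ 1 u) : Continuous (partialDeriv j u) :=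
  (hu.continuous_fderiv (by norm_num)).clm_apply continuous_const

lemma partialDeriv_eq_zero {F : Type*} [NormedAddCommGroup F] [NormedSpace ℝ F]
    {u : Space → F} {x : Space} (hx : x ∉ tsupport u) (j : Fin 3) : partialDeriv j u x = 0 := by
  have : fderiv ℝ u x = 0 := by
    have h := image_eq_zero_of_notMem_tsupport (fun h => hx (tsupport_fderiv_subset ℝ h))
    exact h
  simp [partialDeriv, this]

lemma tsupport_partialDeriv_subset {F : Type*} [NormedAddCommGroup F] [NormedSpace ℝ F]
    (u : Space → F) (j : Fin 3) : tsupport (partialDeriv j u) ⊆ tsupport u := by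
  refine closure_minimal (fun x hx => ?_) isClosed_closure
  by_contra h
  exact hx (partialDeriv_eq_zero h j)

lemma partialDeriv_mul {u v : Space → ℝ} {x : Space} (hu : DifferentiableAt ℝ u x)
    (hv : DifferentiableAt ℝ v x) (j : Fin 3) :
    partialDeriv j (fun y => u y * v y) x = partialDeriv j u x * v x + u x * partialDeriv j v x := by
  simp only [partialDeriv, fderiv_fun_mul hu hv, FunLike.coe_add, FunLike.coe_smul,
    Pi.add_apply, Pi.smul_apply, smul_eq_mul]
  ring

lemma partialDeriv_comm {u : Space → ℝ} (hu : ContDiff ℝ 2 u) (a b : Fin 3) (x : Space) :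
    partialDeriv a (partialDeriv b u) x = partialDeriv b (partialDeriv a u) x := by
  have hd : DifferentiableAt ℝ (fderiv ℝ u) x :=
    (hu.fderiv_right (m := 1) (by norm_num)).differentiable (by norm_num) x
  have h : ∀ i j : Fin 3, partialDeriv i (partialDeriv j u) x =
      fderiv ℝ (fderiv ℝ u) x (EuclideanSpace.single i 1) (EuclideanSpace.single j 1) := by
    intro i j
    have : partialDeriv j u = fun y => fderiv ℝ u y (EuclideanSpace.single j 1) := rfl
    rw [this]
    simp only [partialDeriv]
    rw [fderiv_clm_apply hd (differentiableAt_const _)]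
    simp
  rw [h, h]
  exact (hu.contDiffAt.isSymmSndFDerivAt (by simp)) _ _

lemma integrable_mul_of_tsupport {A g : Space → ℝ} (hA : ∀ x ∈ tsupport g, ContinuousAt A x)
    (hg : Continuous g) (hc : HasCompactSupport g) : Integrable fun x => A x * g x := by
  have hcont : Continuous fun x => A x * g x := by
    refine continuous_of_tsupport fun x hx => ?_
    exact (hA x (closure_mono (fun y hy => right_ne_zero_of_mul hy) hx)).mul hg.continuousAt
  exact hcont.integrable_of_hasCompactSupport hc.mul_left

lemma isNull_partialDeriv {w g : Space → ℝ} (hw : ∀ x ∈ tsupport g, ContDiffAt ℝ 1 w x)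
    (hg : ContDiff ℝ 1 g) (hc : HasCompactSupport g) (j : Fin 3) :
    IsNull fun x => w x * partialDeriv j g x + partialDeriv j w x * g x := by
  have hsub := tsupport_partialDeriv_subset g j
  have hc' : HasCompactSupport (partialDeriv j g) :=
    hc.of_isClosed_subset (isClosed_tsupport _) hsub
  have h1 : Integrable fun x => w x * partialDeriv j g x :=
    integrable_mul_of_tsupport (fun x hx => (hw x (hsub hx)).continuousAt)
      (continuous_partialDeriv j hg) hc'
  have h2 : Integrable fun x => partialDeriv j w x * g x :=
    integrable_mul_of_tsupport
      (fun x hx => (contDiffAt_partialDeriv (n := 0) j (by simpa using hw x hx)).continuousAt)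
      hg.continuous hc
  have h3 : Integrable fun x => w x * g x :=
    integrable_mul_of_tsupport (fun x hx => (hw x hx).continuousAt) hg.continuous hc
  refine ⟨h1.add h2, ?_⟩
  rw [integral_add h1 h2]
  have := integral_mul_fderiv_eq_neg_fderiv_mul_of_integrable (μ := (volume : Measure Space))
    (v := EuclideanSpace.single j (1 : ℝ)) h2 h1 h3
    (fun x hx => (hw x hx).differentiableAt (by norm_num))
    (fun x _ => hg.differentiable (by norm_num) x)
  simp only [partialDeriv] at this ⊢
  rw [this]; ring

/-- The null form `∂ₐu ∂ᵦv - ∂ᵦu ∂ₐv` is a divergence: against a weight `w` only the derivatives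
of `w` survive, and no second derivatives of `u` and `v`. -/
lemma isNull_nullForm {w u v : Space → ℝ} (hw : ∀ x ∈ tsupport u, ContDiffAt ℝ 1 w x)
    (hu : ContDiff ℝ 1 u) (hv : ContDiff ℝ 2 v) (hc : HasCompactSupport u) (a b : Fin 3) :
    IsNull fun x => w x * (partialDeriv a u x * partialDeriv b v x -
        partialDeriv b u x * partialDeriv a v x) +
      u x * (partialDeriv a w x * partialDeriv b v x - partialDeriv b w x * partialDeriv a v x) := by
  have hv' : ∀ (j : Fin 3) (x : Space), ContDiffAt ℝ 1 (partialDeriv j v) x := fun j x =>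
    contDiffAt_partialDeriv j (by simpa [one_add_one_eq_two] using hv.contDiffAt)
  have h1 := isNull_partialDeriv (w := fun x => w x * partialDeriv b v x)
    (fun x hx => (hw x hx).mul (hv' b x)) hu hc a
  have h2 := isNull_partialDeriv (w := fun x => w x * partialDeriv a v x)
    (fun x hx => (hw x hx).mul (hv' a x)) hu hc b
  refine (h1.add (h2.const_mul (-1))).congr fun x => ?_
  by_cases hx : x ∈ tsupport u
  · have hd := (hw x hx).differentiableAt (by norm_num)
    rw [partialDeriv_mul hd ((hv' b x).differentiableAt (by norm_num)),
      partialDeriv_mul hd ((hv' a x).differentiableAt (by norm_num)), partialDeriv_comm hv a b]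
    ring
  · rw [partialDeriv_eq_zero hx, partialDeriv_eq_zero hx, image_eq_zero_of_notMem_tsupport hx]
    ring

lemma contDiffAt_radial {f : ℝ → ℝ} {x : Space} {n : ℕ∞ω} (hx : x ≠ 0)
    (hf : ContDiffAt ℝ n f ‖x‖) : ContDiffAt ℝ n (fun y : Space => f ‖y‖) x :=
  hf.comp x (contDiffAt_norm ℝ hx)

lemma partialDeriv_coord (i j : Fin 3) (x : Space) :
    partialDeriv j (fun y : Space => y i) x = if i = j then 1 else 0 := by
  have : (fun y : Space => y i) = (EuclideanSpace.proj i : Space →L[ℝ] ℝ) := rfl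
  rw [partialDeriv, this, ContinuousLinearMap.fderiv]
  simp

lemma contDiff_coord (i : Fin 3) {n : ℕ∞ω} : ContDiff ℝ n (fun y : Space => y i) :=
  (EuclideanSpace.proj i : Space →L[ℝ] ℝ).contDiff

lemma norm_sq_eq (x : Space) : ‖x‖ ^ 2 = x 0 ^ 2 + x 1 ^ 2 + x 2 ^ 2 := by
  rw [EuclideanSpace.real_norm_sq_eq, Fin.sum_univ_three]

lemma partialDeriv_norm_sq (j : Fin 3) (x : Space) :
    partialDeriv j (fun y : Space => ‖y‖ ^ 2) x = 2 * x j := by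
  have h : HasFDerivAt (fun y : Space => ‖y‖ ^ 2) (2 • innerSL ℝ x) x :=
    (hasStrictFDerivAt_norm_sq x).hasFDerivAt
  rw [partialDeriv, h.fderiv]
  simp [EuclideanSpace.inner_single_right]

lemma partialDeriv_comp_real {f : ℝ → ℝ} {g : Space → ℝ} {x : Space}
    (hf : DifferentiableAt ℝ f (g x)) (hg : DifferentiableAt ℝ g x) (j : Fin 3) :
    partialDeriv j (fun y => f (g y)) x = deriv f (g x) * partialDeriv j g x := by
  have := (hf.hasDerivAt.comp_hasFDerivAt x hg.hasFDerivAt).fderiv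
  simp only [partialDeriv]
  have h2 : (fun y => f (g y)) = f ∘ g := rfl
  rw [h2, this]; simp

lemma partialDeriv_norm {x : Space} (hx : x ≠ 0) (j : Fin 3) :
    partialDeriv j (fun y : Space => ‖y‖) x = x j / ‖x‖ := by
  have hn : 0 < ‖x‖ := norm_pos_iff.2 hx
  have hd : DifferentiableAt ℝ (fun y : Space => ‖y‖) x :=
    (contDiffAt_norm ℝ hx (n := 1)).differentiableAt (by norm_num)
  have h1 := partialDeriv_norm_sq j x
  have h2 := partialDeriv_mul hd hd j
  simp only [← sq] at h2
  rw [h1] at h2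
  field_simp
  linarith

lemma partialDeriv_radial {f : ℝ → ℝ} {x : Space} (hx : x ≠ 0) (hf : DifferentiableAt ℝ f ‖x‖)
    (j : Fin 3) : partialDeriv j (fun y : Space => f ‖y‖) x = deriv f ‖x‖ * (x j / ‖x‖) := by
  rw [partialDeriv_comp_real hf ((contDiffAt_norm ℝ hx (n := 1)).differentiableAt (by norm_num)),
    partialDeriv_norm hx]

/-- A continuous radial weight may be approximated by polynomials in `‖x‖²`. -/
lemma integral_radial_mul_eq_zero {R : ℝ} {H : Space → ℝ} {ν : ℝ → ℝ} (hH : Continuous H)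
    (hc : HasCompactSupport H) (hs : ∀ x ∈ tsupport H, ‖x‖ ∈ Ioo 0 R)
    (hν : ContinuousOn ν (Ioo 0 R))
    (hp : ∀ p : Polynomial ℝ, ∫ x, p.eval (‖x‖ ^ 2) * H x = 0) :
    IsNull fun x => ν ‖x‖ * H x := by
  have hνH : Integrable fun x => ν ‖x‖ * H x := integrable_mul_of_tsupport
    (fun x hx => ((hν _ (hs x hx)).continuousAt (Ioo_mem_nhds (hs x hx).1 (hs x hx).2)).comp
      continuous_norm.continuousAt) hH hc
  refine ⟨hνH, ?_⟩
  rcases (tsupport H).eq_empty_or_nonempty with he | hne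
  · have : ∀ x, H x = 0 := fun x => image_eq_zero_of_notMem_tsupport (by simp [he])
    simp [this]
  obtain ⟨x₀, hx₀, hmin⟩ := hc.isCompact.exists_isMinOn hne continuous_norm.continuousOn
  obtain ⟨x₁, hx₁, hmax⟩ := hc.isCompact.exists_isMaxOn hne continuous_norm.continuousOn
  have h0 := hs x₀ hx₀
  have h1 := hs x₁ hx₁
  have hint : Integrable fun x => ‖H x‖ := (hH.integrable_of_hasCompactSupport hc).norm
  set I := ∫ x, ‖H x‖ with hI
  have hI0 : 0 ≤ I := integral_nonneg fun x => norm_nonneg _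
  have hcont : ContinuousOn (fun t => ν (√t)) (Icc (‖x₀‖ ^ 2) (‖x₁‖ ^ 2)) := by
    refine hν.comp Real.continuous_sqrt.continuousOn fun t ht => ⟨?_, ?_⟩
    · exact Real.sqrt_pos.2 ((pow_pos h0.1 2).trans_le ht.1)
    · calc √t ≤ √(‖x₁‖ ^ 2) := Real.sqrt_le_sqrt ht.2
        _ = ‖x₁‖ := Real.sqrt_sq (norm_nonneg _)
        _ < R := h1.2
  rw [← abs_nonpos_iff]
  refine le_of_forall_pos_le_add fun ε hε => ?_
  obtain ⟨p, hp'⟩ := exists_polynomial_near_of_continuousOn _ _ _ hcont (ε / (I + 1)) (by positivity)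
  have hpint : Integrable fun x : Space => p.eval (‖x‖ ^ 2) * H x :=
    integrable_mul_of_tsupport (fun x _ => by fun_prop) hH hc
  calc |∫ x, ν ‖x‖ * H x| = ‖∫ x, (ν ‖x‖ * H x - p.eval (‖x‖ ^ 2) * H x)‖ := by
        rw [integral_sub hνH hpint, hp p, sub_zero, Real.norm_eq_abs]
    _ ≤ ∫ x, ε / (I + 1) * ‖H x‖ := by
        refine norm_integral_le_of_norm_le (hint.const_mul _) (Eventually.of_forall fun x => ?_)
        by_cases hx : x ∈ tsupport H
        · rw [← sub_mul, norm_mul]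
          refine mul_le_mul_of_nonneg_right ?_ (norm_nonneg _)
          have := hp' (‖x‖ ^ 2) ⟨pow_le_pow_left₀ (norm_nonneg _) (hmin hx) 2,
            pow_le_pow_left₀ (norm_nonneg _) (hmax hx) 2⟩
          rw [Real.sqrt_sq (norm_nonneg _), abs_sub_comm] at this
          exact this.le
        · simp [image_eq_zero_of_notMem_tsupport hx]
    _ = ε / (I + 1) * I := by rw [integral_const_mul]
    _ ≤ 0 + ε := by
        rw [zero_add, div_mul_eq_mul_div, div_le_iff₀ (by positivity)]
        nlinarith

end IntegrationByParts

/-! ### The angular part of the Dirac operator -/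

section Algebra

/-- For the gradients `g c` of the four real components of a spinor
`(u₀ + i u₁, u₂ + i u₃)`, half of the difference `|σ·∇φ|² - |∇φ|²`: a sum of null forms. -/
def crossTerm (g : Fin 4 → Fin 3 → ℝ) : ℝ :=
  (g 0 2 * g 2 0 - g 0 0 * g 2 2) + (g 0 2 * g 3 1 - g 0 1 * g 3 2) +
  (g 2 0 * g 3 1 - g 2 1 * g 3 0) + (g 1 2 * g 3 0 - g 1 0 * g 3 2) +
  (g 1 1 * g 2 2 - g 1 2 * g 2 1) + (g 0 1 * g 1 0 - g 0 0 * g 1 1)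

/-- `|∇φ|²`. -/
def gradSq (g : Fin 4 → Fin 3 → ℝ) : ℝ := ∑ c, ∑ j, g c j ^ 2

/-- `|x·∇φ|²`. -/
def eulerSq (x : Fin 3 → ℝ) (g : Fin 4 → Fin 3 → ℝ) : ℝ := ∑ c, (∑ j, x j * g c j) ^ 2

/-- The angular derivatives `x × ∇u` of the components. -/
def ang (x : Fin 3 → ℝ) (g : Fin 4 → Fin 3 → ℝ) : Fin 4 → Fin 3 → ℝ := fun c =>
  ![x 1 * g c 2 - x 2 * g c 1, x 2 * g c 0 - x 0 * g c 2, x 0 * g c 1 - x 1 * g c 0]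

/-- Up to null terms, `⟨φ, σ·L φ⟩` with the angular momentum `L = -i x × ∇`. -/
def spinOrbit (x : Fin 3 → ℝ) (u : Fin 4 → ℝ) (g : Fin 4 → Fin 3 → ℝ) : ℝ :=
  -2 * (u 0 * ang x g 2 1 - u 0 * ang x g 3 0 + u 2 * ang x g 3 2 + u 1 * ang x g 3 1 +
    u 1 * ang x g 2 0 - u 0 * ang x g 1 2)

lemma gradSq_ang (x : Fin 3 → ℝ) (g : Fin 4 → Fin 3 → ℝ) :
    gradSq (ang x g) = (x 0 ^ 2 + x 1 ^ 2 + x 2 ^ 2) * gradSq g - eulerSq x g := by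
  simp only [gradSq, eulerSq, ang, Fin.sum_univ_four, Fin.sum_univ_three, Matrix.cons_val]
  ring

/-- For tangential `w` one has `|σ·w|² = |w|² + 2C(w)`, and `2|x|²(|w|² - 2C(w))` is the square
`|x × w - i(σ·x)w|²`. The bound says `|σ·w|² ≤ 2|w|²`. -/
lemma two_mul_crossTerm_ang_le (x : Fin 3 → ℝ) (g : Fin 4 → Fin 3 → ℝ)
    (hx : 0 < x 0 ^ 2 + x 1 ^ 2 + x 2 ^ 2) : 2 * crossTerm (ang x g) ≤ gradSq (ang x g) := by
  set w := ang x g with hw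
  have key : 2 * (x 0 ^ 2 + x 1 ^ 2 + x 2 ^ 2) * (gradSq w - 2 * crossTerm w) =
      ∑ j, ((ang x w 0 j - (-x 2 * w 1 j + x 1 * w 2 j - x 0 * w 3 j)) ^ 2 +
        (ang x w 1 j - (x 2 * w 0 j + x 0 * w 2 j + x 1 * w 3 j)) ^ 2 +
        (ang x w 2 j - (-x 1 * w 0 j - x 0 * w 1 j + x 2 * w 3 j)) ^ 2 +
        (ang x w 3 j - (x 0 * w 0 j - x 1 * w 1 j - x 2 * w 2 j)) ^ 2) := by
    simp only [hw, crossTerm, gradSq, ang, Fin.sum_univ_four, Fin.sum_univ_three, Matrix.cons_val]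
    ring
  have h : 0 ≤ 2 * (x 0 ^ 2 + x 1 ^ 2 + x 2 ^ 2) * (gradSq w - 2 * crossTerm w) := by
    rw [key]; positivity
  have := nonneg_of_mul_nonneg_right h (by positivity)
  linarith

end Algebra

section Angular

/-- The gradients at `x` of four real functions. -/
noncomputable def gradients (u : Fin 4 → Space → ℝ) (x : Space) : Fin 4 → Fin 3 → ℝ :=
  fun c j => partialDeriv j (u c) x

/-- The cross product of the angular derivatives `x × ∇u` and `x × ∇v` is `x (x·(∇u × ∇v))`. Against a
radial weight `P`, one integration by parts turns its components into `u (x × ∇v)_l`: the commutation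
relations of the angular momentum. The radial derivative `P'` drops out. -/
lemma isNull_triple {u v P P' : Space → ℝ} (hP : ContDiff ℝ 1 P)
    (hP' : ∀ j x, partialDeriv j P x = 2 * x j * P' x)
    (hu : ContDiff ℝ 1 u) (hv : ContDiff ℝ 2 v) (hc : HasCompactSupport u) (l : Fin 3) :
    IsNull fun x => P x * (x l * (
      x 0 * (partialDeriv 1 u x * partialDeriv 2 v x - partialDeriv 2 u x * partialDeriv 1 v x) +
      x 1 * (partialDeriv 2 u x * partialDeriv 0 v x - partialDeriv 0 u x * partialDeriv 2 v x) +
      x 2 * (partialDeriv 0 u x * partialDeriv 1 v x - partialDeriv 1 u x * partialDeriv 0 v x)) -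
      u x * (x (l + 1) * partialDeriv (l + 2) v x - x (l + 2) * partialDeriv (l + 1) v x)) := by
  have hw : ∀ k : Fin 3, ContDiff ℝ 1 (fun x : Space => (x l * x k) * P x) := fun k =>
    ((contDiff_coord l).mul (contDiff_coord k)).mul hP
  have hd : ∀ (k a : Fin 3) (x : Space), partialDeriv a (fun x : Space => (x l * x k) * P x) x =
      ((if l = a then 1 else 0) * x k + x l * (if k = a then 1 else 0)) * P x +
        (x l * x k) * (2 * x a * P' x) := by
    intro k a x
    have h1 := ((contDiff_coord l (n := 1)).differentiable (by norm_num)) x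
    have h2 := ((contDiff_coord k (n := 1)).differentiable (by norm_num)) x
    rw [partialDeriv_mul (h1.fun_mul h2) (hP.differentiable (by norm_num) x),
      partialDeriv_mul h1 h2, hP', partialDeriv_coord, partialDeriv_coord]
  have J := fun k a b => isNull_nullForm (fun x _ => (hw k).contDiffAt) hu hv hc a b
  refine (((J 0 1 2).add (J 1 2 0)).add (J 2 0 1)).congr fun x => ?_
  simp only [hd]
  fin_cases l <;> simp <;> ring

variable {u : Fin 4 → Space → ℝ}

/-- The identity `(σ·L)² + σ·L = L²` against a polynomial radial weight. -/
lemma isNull_poly_angular (hu : ∀ c, ContDiff ℝ 2 (u c)) (hc : ∀ c, HasCompactSupport (u c))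
    (p : Polynomial ℝ) :
    IsNull fun x => p.eval (‖x‖ ^ 2) * (2 * crossTerm (ang x.ofLp (gradients u x)) +
      spinOrbit x.ofLp (fun c => u c x) (gradients u x)) := by
  have hP : ContDiff ℝ 1 fun x : Space => p.eval (‖x‖ ^ 2) :=
    (p.contDiff_aeval 1).comp (contDiff_norm_sq ℝ)
  have hP' : ∀ (j : Fin 3) (x : Space), partialDeriv j (fun x : Space => p.eval (‖x‖ ^ 2)) x =
      2 * x j * p.derivative.eval (‖x‖ ^ 2) := by
    intro j x
    rw [partialDeriv_comp_real (f := fun t => p.eval t) p.differentiableAt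
      ((contDiff_norm_sq ℝ (n := 1)).differentiable (by norm_num) x), partialDeriv_norm_sq,
      Polynomial.deriv]
    ring
  have K := fun c d l => isNull_triple hP hP' ((hu c).of_le (by norm_num)) (hu d) (hc c) l
  refine ((((((K 0 2 1).const_mul 2).add ((K 0 3 0).const_mul (-2))).add
    ((K 2 3 2).const_mul 2)).add ((K 1 3 1).const_mul 2)).add ((K 1 2 0).const_mul 2)).add
    ((K 0 1 2).const_mul (-2)) |>.congr fun x => ?_
  simp only [crossTerm, spinOrbit, ang, gradients, Matrix.cons_val,
    show (1 : Fin 3) + 1 = 2 from rfl, show (1 : Fin 3) + 2 = 0 from rfl,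
    show (2 : Fin 3) + 1 = 0 from rfl, show (2 : Fin 3) + 2 = 1 from rfl, zero_add]
  ring

lemma continuous_crossTerm_ang (hu : ∀ c, ContDiff ℝ 2 (u c)) :
    Continuous fun x : Space => 2 * crossTerm (ang x.ofLp (gradients u x)) +
      spinOrbit x.ofLp (fun c => u c x) (gradients u x) := by
  have h1 : ∀ c j, Continuous (partialDeriv j (u c)) := fun c j =>
    continuous_partialDeriv j ((hu c).of_le (by norm_num))
  have h2 : ∀ c, Continuous (u c) := fun c => (hu c).continuous
  simp only [crossTerm, spinOrbit, ang, gradients, Matrix.cons_val]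
  fun_prop

/-- The identity `(σ·L)² + σ·L = L²` against a continuous radial weight. -/
lemma isNull_angular {R : ℝ} {ν : ℝ → ℝ} (hu : ∀ c, ContDiff ℝ 2 (u c))
    {K : Set Space} (hK : IsCompact K) (hKR : ∀ x ∈ K, ‖x‖ ∈ Ioo 0 R)
    (hs : ∀ c, tsupport (u c) ⊆ K) (hν : ContinuousOn ν (Ioo 0 R)) :
    IsNull fun x => ν ‖x‖ * (2 * crossTerm (ang x.ofLp (gradients u x)) +
      spinOrbit x.ofLp (fun c => u c x) (gradients u x)) := by
  have hc : ∀ c, HasCompactSupport (u c) := fun c =>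
    hK.of_isClosed_subset (isClosed_tsupport _) (hs c)
  have hts : tsupport (fun x : Space => 2 * crossTerm (ang x.ofLp (gradients u x)) +
      spinOrbit x.ofLp (fun c => u c x) (gradients u x)) ⊆ K := by
    refine closure_minimal (fun x hx => ?_) hK.isClosed
    by_contra h
    refine hx ?_
    have h1 : ∀ c, u c x = 0 := fun c => image_eq_zero_of_notMem_tsupport fun h' => h (hs c h')
    have h2 : ∀ c j, partialDeriv j (u c) x = 0 := fun c j =>
      partialDeriv_eq_zero (fun h' => h (hs c h')) j
    simp [crossTerm, spinOrbit, ang, gradients, h1, h2]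
  exact integral_radial_mul_eq_zero (continuous_crossTerm_ang hu)
    (hK.of_isClosed_subset (isClosed_tsupport _) hts) (fun x hx => hKR x (hts hx)) hν
    fun p => (isNull_poly_angular hu hc p).2

/-- Integration by parts turns the cross terms into the spin–orbit term. -/
lemma isNull_cross {R : ℝ} {m : ℝ → ℝ} (hu : ∀ c, ContDiff ℝ 2 (u c))
    {K : Set Space} (hK : IsCompact K) (hKR : ∀ x ∈ K, ‖x‖ ∈ Ioo 0 R)
    (hs : ∀ c, tsupport (u c) ⊆ K) (hm : ContDiffOn ℝ 1 m (Ioo 0 R)) :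
    IsNull fun x => m ‖x‖ * (2 * crossTerm (gradients u x)) -
      deriv m ‖x‖ / ‖x‖ * spinOrbit x.ofLp (fun c => u c x) (gradients u x) := by
  have hc : ∀ c, HasCompactSupport (u c) := fun c =>
    hK.of_isClosed_subset (isClosed_tsupport _) (hs c)
  have hx0 : ∀ x ∈ K, x ≠ 0 := fun x hx => norm_pos_iff.1 (hKR x hx).1
  have hmx : ∀ x ∈ K, ContDiffAt ℝ 1 m ‖x‖ := fun x hx =>
    hm.contDiffAt (Ioo_mem_nhds (hKR x hx).1 (hKR x hx).2)
  have J := fun c d a b => isNull_nullForm (w := fun x => m ‖x‖) (u := u c) (v := u d)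
    (fun x hx => contDiffAt_radial (hx0 x (hs c hx)) (hmx x (hs c hx)))
    ((hu c).of_le (by norm_num)) (hu d) (hc c) a b
  refine (((((((J 0 2 2 0).add (J 0 3 2 1)).add (J 2 3 0 1)).add (J 1 3 2 0)).add
    (J 1 2 1 2)).add (J 0 1 1 0)).const_mul 2).congr fun x => ?_
  by_cases hx : x ∈ K
  · have h := fun j => partialDeriv_radial (hx0 x hx)
      ((hmx x hx).differentiableAt (by norm_num)) j
    simp only [h, crossTerm, spinOrbit, ang, gradients, Matrix.cons_val]
    ring
  · have h1 : ∀ c, u c x = 0 := fun c => image_eq_zero_of_notMem_tsupport fun h' => hx (hs c h')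
    have h2 : ∀ c j, partialDeriv j (u c) x = 0 := fun c j =>
      partialDeriv_eq_zero (fun h' => hx (hs c h')) j
    simp [crossTerm, spinOrbit, ang, gradients, h1, h2]

/-- The function is the divergence of the vector field `(z/r) |φ|² x`. -/
lemma isNull_radial {R : ℝ} {z : ℝ → ℝ} (hu : ∀ c, ContDiff ℝ 2 (u c))
    {K : Set Space} (hK : IsCompact K) (hKR : ∀ x ∈ K, ‖x‖ ∈ Ioo 0 R)
    (hs : ∀ c, tsupport (u c) ⊆ K) (hz : ContDiffOn ℝ 1 z (Ioo 0 R)) :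
    IsNull fun x => ∑ c, (2 * (z ‖x‖ / ‖x‖) * u c x * (∑ j, x j * gradients u x c j) +
      (deriv z ‖x‖ + 2 * z ‖x‖ / ‖x‖) * u c x ^ 2) := by
  have hc : ∀ c, HasCompactSupport (u c) := fun c =>
    hK.of_isClosed_subset (isClosed_tsupport _) (hs c)
  have hx0 : ∀ x ∈ K, x ≠ 0 := fun x hx => norm_pos_iff.1 (hKR x hx).1
  have hzx : ∀ x ∈ K, ContDiffAt ℝ 1 z ‖x‖ := fun x hx =>
    hz.contDiffAt (Ioo_mem_nhds (hKR x hx).1 (hKR x hx).2)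
  have hq : ∀ x ∈ K, ContDiffAt ℝ 1 (fun r => z r / r) ‖x‖ := fun x hx =>
    (hzx x hx).div contDiffAt_id (hKR x hx).1.ne'
  have hu1 : ∀ c, ContDiff ℝ 1 (u c) := fun c => (hu c).of_le (by norm_num)
  have hsq : ∀ c, tsupport (fun x => u c x * u c x) ⊆ K := fun c =>
    (closure_mono fun x hx => left_ne_zero_of_mul hx).trans (hs c)
  have J := fun c j => isNull_partialDeriv (w := fun x : Space => x j * (z ‖x‖ / ‖x‖))
    (g := fun x => u c x * u c x)
    (fun x hx => (contDiff_coord j).contDiffAt.mul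
      (contDiffAt_radial (f := fun r => z r / r) (hx0 x (hsq c hx)) (hq x (hsq c hx))))
    ((hu1 c).mul (hu1 c)) ((hc c).mul_left) j
  have J3 := fun c => ((J c 0).add (J c 1)).add (J c 2)
  refine (((J3 0).add (J3 1)).add (J3 2)).add (J3 3) |>.congr fun x => ?_
  by_cases hx : x ∈ K
  · have hdq := (hq x hx).differentiableAt (by norm_num)
    have h := fun j => partialDeriv_radial (f := fun r => z r / r) (hx0 x hx) hdq j
    have hdz := (hzx x hx).differentiableAt (by norm_num)
    have hr := (hKR x hx).1.ne'
    have hderiv : deriv (fun r => z r / r) ‖x‖ = (deriv z ‖x‖ * ‖x‖ - z ‖x‖) / ‖x‖ ^ 2 := by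
      simpa using (hdz.hasDerivAt.fun_div (hasDerivAt_id' ‖x‖) hr).deriv
    have h2 := fun j => partialDeriv_mul (((contDiff_coord j (n := 1)).differentiable (by norm_num)) x)
      ((contDiffAt_radial (f := fun r => z r / r) (hx0 x hx) (hq x hx)).differentiableAt
        (by norm_num)) j
    have h3 := fun c j => partialDeriv_mul ((hu1 c).differentiable (by norm_num) x)
      ((hu1 c).differentiable (by norm_num) x) j
    simp only [h2, h, h3, hderiv, partialDeriv_coord, gradients, Fin.sum_univ_four,
      Fin.sum_univ_three, if_true]
    have hn := norm_sq_eq x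
    have hn2 : x 2 ^ 2 = ‖x‖ ^ 2 - x 0 ^ 2 - x 1 ^ 2 := by linarith
    field_simp
    ring_nf
    simp only [hn2]
    ring
  · have h1 : ∀ c, u c x = 0 := fun c => image_eq_zero_of_notMem_tsupport fun h' => hx (hs c h')
    have h2 : ∀ c j, partialDeriv j (fun x => u c x * u c x) x = 0 := fun c j =>
      partialDeriv_eq_zero (fun h' => hx (hsq c h')) j
    simp [h1, h2]

end Angular

/-! ### The inequality for smooth spinors vanishing near the origin -/

section Smooth

/-- The real coordinates `Re φ₁, Im φ₁, Re φ₂, Im φ₂` of a spinor. -/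
noncomputable def coord (c : Fin 4) : Spinor →L[ℝ] ℝ :=
  ![Complex.reCLM.comp ((EuclideanSpace.proj 0 : Spinor →L[ℂ] ℂ).restrictScalars ℝ),
    Complex.imCLM.comp ((EuclideanSpace.proj 0 : Spinor →L[ℂ] ℂ).restrictScalars ℝ),
    Complex.reCLM.comp ((EuclideanSpace.proj 1 : Spinor →L[ℂ] ℂ).restrictScalars ℝ),
    Complex.imCLM.comp ((EuclideanSpace.proj 1 : Spinor →L[ℂ] ℂ).restrictScalars ℝ)] c

lemma coord_zero (φ : Spinor) : coord 0 φ = (φ 0).re := rfl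
lemma coord_one (φ : Spinor) : coord 1 φ = (φ 0).im := rfl
lemma coord_two (φ : Spinor) : coord 2 φ = (φ 1).re := rfl
lemma coord_three (φ : Spinor) : coord 3 φ = (φ 1).im := rfl

lemma norm_sq_spinor (φ : Spinor) : ‖φ‖ ^ 2 = ∑ c, coord c φ ^ 2 := by
  rw [EuclideanSpace.norm_sq_eq, Fin.sum_univ_two, Fin.sum_univ_four, coord_zero, coord_one,
    coord_two, coord_three, Complex.sq_norm, Complex.sq_norm, Complex.normSq_apply,
    Complex.normSq_apply]
  ring

lemma norm_sq_sigmaGrad (g : Fin 3 → Space → Spinor) (x : Space) :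
    ‖sigmaGrad g x‖ ^ 2 = gradSq (fun c j => coord c (g j x)) +
      2 * crossTerm (fun c j => coord c (g j x)) := by
  rw [norm_sq_spinor]
  simp only [gradSq, crossTerm, sigmaGrad, Fin.sum_univ_three, Fin.sum_univ_four, map_add]
  simp only [coord_zero, coord_one, coord_two, coord_three, Matrix.toEuclideanLin, pauli,
    Matrix.toLpLin_apply, Matrix.mulVec, dotProduct, Fin.sum_univ_two, Matrix.cons_val,
    Matrix.of_apply, Complex.add_re, Complex.add_im, Complex.mul_re, Complex.mul_im,
    Complex.neg_re, Complex.neg_im, Complex.I_re, Complex.I_im, Complex.zero_re, Complex.zero_im,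
    Complex.one_re, Complex.one_im]
  ring

lemma partialDeriv_coord_comp {ψ : Space → Spinor} {x : Space} (hψ : DifferentiableAt ℝ ψ x)
    (c : Fin 4) (j : Fin 3) :
    partialDeriv j (fun y => coord c (ψ y)) x = coord c (partialDeriv j ψ x) := by
  have := ((coord c).hasFDerivAt.comp x hψ.hasFDerivAt).fderiv
  simp only [partialDeriv]
  have h2 : (fun y => coord c (ψ y)) = coord c ∘ ψ := rfl
  rw [h2, this]; rfl

lemma gradSq_nonneg (g : Fin 4 → Fin 3 → ℝ) : 0 ≤ gradSq g :=
  Finset.sum_nonneg fun _ _ => Finset.sum_nonneg fun _ _ => sq_nonneg _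

/-- The pointwise form of the inequality: up to null terms the integrand
`m|σ·∇φ|²` dominates `(z' + 2z/r - z²/m)|φ|²`. Here `μ` and `ζ` stand for `m'` and `z'`. -/
lemma pointwise_bound {x : Fin 3 → ℝ} {u : Fin 4 → ℝ} {g : Fin 4 → Fin 3 → ℝ} {r m μ z ζ : ℝ}
    (hr : 0 < r) (hx : r ^ 2 = x 0 ^ 2 + x 1 ^ 2 + x 2 ^ 2) (hm : 0 < m) (hμ : 0 ≤ μ)
    (hμm : r * μ ≤ m) :
    (ζ + 2 * z / r - z ^ 2 / m) * (∑ c, u c ^ 2) +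
      ((m * (2 * crossTerm g) - μ / r * spinOrbit x u g) +
        μ / r * (2 * crossTerm (ang x g) + spinOrbit x u g) -
        ∑ c, (2 * (z / r) * u c * (∑ j, x j * g c j) + (ζ + 2 * z / r) * u c ^ 2))
      ≤ m * (gradSq g + 2 * crossTerm g) := by
  have hL := gradSq_ang x g
  have hC := two_mul_crossTerm_ang_le x g (by rw [← hx]; positivity)
  rw [← hx] at hL
  have h1 : μ / r * (2 * crossTerm (ang x g)) ≤ m * gradSq g - m * eulerSq x g / r ^ 2 := by
    have h2 : r * μ * (2 * crossTerm (ang x g)) ≤ m * gradSq (ang x g) :=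
      (mul_le_mul_of_nonneg_left hC (by positivity)).trans
        (mul_le_mul_of_nonneg_right hμm (gradSq_nonneg _))
    rw [hL] at h2
    have h3 : μ / r * (2 * crossTerm (ang x g)) = r * μ * (2 * crossTerm (ang x g)) / r ^ 2 := by
      field_simp
    rw [h3, div_le_iff₀ (by positivity)]
    calc _ ≤ _ := h2
      _ = _ := by field_simp
  have h4 : ∀ c, -(2 * (z / r) * u c * (∑ j, x j * g c j)) - z ^ 2 / m * u c ^ 2 ≤
      m * (∑ j, x j * g c j) ^ 2 / r ^ 2 := by
    intro c
    set e := ∑ j, x j * g c j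
    have : m * e ^ 2 / r ^ 2 + 2 * (z / r) * u c * e + z ^ 2 / m * u c ^ 2 =
        (m * (e / r) + z * u c) ^ 2 / m := by field_simp; ring
    have h5 : 0 ≤ (m * (e / r) + z * u c) ^ 2 / m := by positivity
    linarith
  have h6 := Finset.sum_le_sum fun c (_ : c ∈ Finset.univ) => h4 c
  have h7 : ∑ c, m * (∑ j, x j * g c j) ^ 2 / r ^ 2 = m * eulerSq x g / r ^ 2 := by
    rw [eulerSq, ← Finset.sum_div, ← Finset.mul_sum]
  rw [h7] at h6
  simp only [Finset.sum_sub_distrib, Finset.sum_neg_distrib, Finset.sum_add_distrib,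
    ← Finset.mul_sum] at h6 ⊢
  nlinarith

variable {R : ℝ} {W z : ℝ → ℝ}

/-- The Dirac–Hardy inequality for a radial weight `W` admitting a supersolution `z` of the Riccati
equation that governs the radial spinors, for smooth spinors supported away from the origin. -/
theorem hardy_of_supersolution (hW : ContDiffOn ℝ 1 W (Ioo 0 R)) (hz : ContDiffOn ℝ 1 z (Ioo 0 R))
    (hW0 : ∀ r ∈ Ioo 0 R, 0 ≤ W r) (hW1 : ∀ r ∈ Ioo 0 R, -1 ≤ deriv W r)
    (hW2 : ∀ r ∈ Ioo 0 R, r * deriv W r ≤ W r)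
    (hric : ∀ r ∈ Ioo 0 R, 0 ≤ 2 * z r + r * deriv z r - z r ^ 2 * (W r + r) + r - W r)
    {ψ : Space → Spinor} (hψ : IsTestSpinor R ψ) (h0 : (0 : Space) ∉ tsupport ψ) :
    ∫⁻ x, ENNReal.ofReal (W ‖x‖ / ‖x‖ * ‖ψ x‖ ^ 2) ≤
      ∫⁻ x, ENNReal.ofReal (‖sigmaGrad (fun j => partialDeriv j ψ) x‖ ^ 2 / (1 + W ‖x‖ / ‖x‖) +
        ‖ψ x‖ ^ 2) := by
  obtain ⟨hψs, hψc, hψR⟩ := hψ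
  set K := tsupport ψ with hKdef
  have hK : IsCompact K := hψc
  have hKR : ∀ x ∈ K, ‖x‖ ∈ Ioo 0 R := fun x hx =>
    ⟨norm_pos_iff.2 fun h => h0 (h ▸ hx), by simpa using hψR hx⟩
  set m : ℝ → ℝ := fun r => r / (W r + r) with hmdef
  have hpos : ∀ r ∈ Ioo 0 R, 0 < W r + r := fun r hr => by linarith [hW0 r hr, hr.1]
  have hm : ContDiffOn ℝ 1 m (Ioo 0 R) :=
    contDiffOn_id.div (hW.add contDiffOn_id) fun r hr => (hpos r hr).ne'
  have hdW : ∀ r ∈ Ioo 0 R, HasDerivAt W (deriv W r) r := fun r hr =>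
    ((hW.contDiffAt (Ioo_mem_nhds hr.1 hr.2)).differentiableAt (by norm_num)).hasDerivAt
  have hdm : ∀ r ∈ Ioo 0 R, deriv m r = (W r - r * deriv W r) / (W r + r) ^ 2 := fun r hr => by
    have := ((hasDerivAt_id' r).fun_div ((hdW r hr).fun_add (hasDerivAt_id' r)) (hpos r hr).ne').deriv
    rw [hmdef, this]; ring
  set u : Fin 4 → Space → ℝ := fun c x => coord c (ψ x) with hudef
  have hu : ∀ c, ContDiff ℝ 2 (u c) := fun c =>
    (coord c).contDiff.comp (by exact_mod_cast contDiff_infty.1 hψs 2)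
  have hs : ∀ c, tsupport (u c) ⊆ K := fun c => by
    refine closure_mono fun x hx hx' => hx ?_
    simp [hudef, hx']
  have hν : ContinuousOn (fun r => deriv m r / r) (Ioo 0 R) :=
    (hm.continuousOn_deriv_of_isOpen isOpen_Ioo le_rfl).div continuousOn_id fun r hr => hr.1.ne'
  have N := ((isNull_cross hu hK hKR hs hm).add (isNull_angular hu hK hKR hs hν)).add
    ((isNull_radial hu hK hKR hs hz).const_mul (-1))
  have hψd : Differentiable ℝ ψ := hψs.differentiable (by norm_num)
  have hgrad : ∀ x, (fun c j => coord c (partialDeriv j ψ x)) = gradients u x := fun x => by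
    funext c j
    exact (partialDeriv_coord_comp (hψd x) c j).symm
  -- the integrands are continuous with compact support in the punctured ball
  have hcont : ∀ f : ℝ → ℝ, ContinuousOn f (Ioo 0 R) → ∀ x ∈ K,
      ContinuousAt (fun x : Space => f ‖x‖) x := fun f hf x hx =>
    (hf.continuousAt (Ioo_mem_nhds (hKR x hx).1 (hKR x hx).2)).comp continuous_norm.continuousAt
  have hcsupp : ∀ G : Space → ℝ, (∀ x, x ∉ K → G x = 0) → tsupport G ⊆ K := fun G hG =>
    closure_minimal (fun x hx => by_contra fun h => hx (hG x h)) hK.isClosed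
  have hint : ∀ (f : ℝ → ℝ) (G : Space → ℝ), ContinuousOn f (Ioo 0 R) → Continuous G →
      (∀ x, x ∉ K → G x = 0) → Integrable fun x => f ‖x‖ * G x := fun f G hf hG h =>
    integrable_mul_of_tsupport (fun x hx => hcont f hf x (hcsupp G h hx)) hG
      (hK.of_isClosed_subset (isClosed_tsupport _) (hcsupp G h))
  have hψ0 : ∀ x, x ∉ K → ψ x = 0 := fun x hx => image_eq_zero_of_notMem_tsupport hx
  have hG1 : Continuous fun x => ‖ψ x‖ ^ 2 := by have := hψs.continuous; fun_prop
  have hSg : ∀ x, ‖sigmaGrad (fun j => partialDeriv j ψ) x‖ ^ 2 =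
      gradSq (gradients u x) + 2 * crossTerm (gradients u x) := fun x => by
    rw [norm_sq_sigmaGrad, hgrad]
  have hG2 : Continuous fun x => ‖sigmaGrad (fun j => partialDeriv j ψ) x‖ ^ 2 := by
    simp only [hSg]
    have h1 : ∀ c j, Continuous (partialDeriv j (u c)) := fun c j =>
      continuous_partialDeriv j ((hu c).of_le (by norm_num))
    simp only [gradSq, crossTerm, gradients]
    fun_prop
  have hSg0 : ∀ x, x ∉ K → ‖sigmaGrad (fun j => partialDeriv j ψ) x‖ ^ 2 = 0 := fun x hx => by
    have h2 : ∀ c j, partialDeriv j (u c) x = 0 := fun c j =>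
      partialDeriv_eq_zero (fun h' => hx (hs c h')) j
    rw [hSg]; simp [gradSq, crossTerm, gradients, h2]
  have hI1 : Integrable fun x => W ‖x‖ / ‖x‖ * ‖ψ x‖ ^ 2 :=
    hint (fun r => W r / r) _ (hW.continuousOn.div continuousOn_id fun r hr => hr.1.ne') hG1
      fun x hx => by simp [hψ0 x hx]
  have hI2 : Integrable fun x => m ‖x‖ * ‖sigmaGrad (fun j => partialDeriv j ψ) x‖ ^ 2 +
      ‖ψ x‖ ^ 2 := by
    refine (hint m _ hm.continuousOn hG2 hSg0).add ?_
    exact hG1.integrable_of_hasCompactSupport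
      (hK.of_isClosed_subset (isClosed_tsupport _) (hcsupp _ fun x hx => by simp [hψ0 x hx]))
  have hm0 : ∀ x ∈ K, 0 < m ‖x‖ := fun x hx => div_pos (hKR x hx).1 (hpos _ (hKR x hx))
  have hRHS : ∀ x, ‖sigmaGrad (fun j => partialDeriv j ψ) x‖ ^ 2 / (1 + W ‖x‖ / ‖x‖) + ‖ψ x‖ ^ 2 =
      m ‖x‖ * ‖sigmaGrad (fun j => partialDeriv j ψ) x‖ ^ 2 + ‖ψ x‖ ^ 2 := fun x => by
    by_cases hx : x ∈ K
    · have h1 := (hKR x hx).1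
      have h2 := hpos _ (hKR x hx)
      have h3 : 1 + W ‖x‖ / ‖x‖ = (W ‖x‖ + ‖x‖) / ‖x‖ := by field_simp; ring
      rw [h3, hmdef]; field_simp
    · rw [hSg0 x hx]; simp
  simp only [hRHS]
  rw [← ofReal_integral_eq_lintegral_ofReal hI1, ← ofReal_integral_eq_lintegral_ofReal hI2]
  · refine ENNReal.ofReal_le_ofReal ?_
    rw [← add_zero (∫ x, W ‖x‖ / ‖x‖ * ‖ψ x‖ ^ 2), ← N.2, ← integral_add hI1 N.1]
    refine integral_mono (hI1.add N.1) hI2 fun x => ?_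
    by_cases hx : x ∈ K
    · have hr := hKR x hx
      have hp := hpos _ hr
      have hW2' := hW2 _ hr
      have hW1' := hW1 _ hr
      have hr0 := hr.1
      have hb := pointwise_bound (u := fun c => u c x) (g := gradients u x) (x := x.ofLp)
        (z := z ‖x‖) (ζ := deriv z ‖x‖) hr0 (norm_sq_eq x) (hm0 x hx)
        (μ := deriv m ‖x‖) (by rw [hdm _ hr]; exact div_nonneg (by linarith) (by positivity))
        (by
          rw [hdm _ hr, hmdef, mul_div_assoc', div_le_div_iff₀ (by positivity) hp]
          nlinarith [mul_nonneg (mul_pos hr0 hp).le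
            (mul_nonneg hr0.le (show 0 ≤ 1 + deriv W ‖x‖ by linarith))])
      have hn : ‖ψ x‖ ^ 2 = ∑ c, u c x ^ 2 := norm_sq_spinor _
      have hc : W ‖x‖ / ‖x‖ ≤
          deriv z ‖x‖ + 2 * z ‖x‖ / ‖x‖ - z ‖x‖ ^ 2 / m ‖x‖ + 1 := by
        have h3 : deriv z ‖x‖ + 2 * z ‖x‖ / ‖x‖ - z ‖x‖ ^ 2 / m ‖x‖ + 1 =
          (2 * z ‖x‖ + ‖x‖ * deriv z ‖x‖ - z ‖x‖ ^ 2 * (W ‖x‖ + ‖x‖) + ‖x‖) / ‖x‖ := by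
          rw [hmdef]; field_simp; ring
        rw [h3, div_le_div_iff_of_pos_right hr0]
        linarith [hric _ hr]
      have hmul := mul_le_mul_of_nonneg_right hc (sq_nonneg ‖ψ x‖)
      beta_reduce
      rw [hSg x]
      rw [hn] at hmul ⊢
      linarith
    · have h1 : ∀ c, u c x = 0 := fun c => image_eq_zero_of_notMem_tsupport fun h' => hx (hs c h')
      have h2 : ∀ c j, partialDeriv j (u c) x = 0 := fun c j =>
        partialDeriv_eq_zero (fun h' => hx (hs c h')) j
      beta_reduce
      rw [hSg0 x hx, hψ0 x hx]
      simp [crossTerm, spinOrbit, ang, gradients, h1, h2]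
  · refine Eventually.of_forall fun x => ?_
    by_cases hx : x ∈ K
    · have := (hm0 x hx).le
      simp only [Pi.zero_apply]; positivity
    · simp [hSg0 x hx]
  · refine Eventually.of_forall fun x => ?_
    by_cases hx : x ∈ K
    · have := hW0 _ (hKR x hx)
      simp only [Pi.zero_apply]; positivity
    · simp [hψ0 x hx]

end Smooth

/-! ### Passage to `H¹₀` -/

section Density

lemma norm_pauli (j : Fin 3) (φ : Spinor) : ‖Matrix.toEuclideanLin (pauli j) φ‖ = ‖φ‖ := by
  rw [← sq_eq_sq₀ (norm_nonneg _) (norm_nonneg _), norm_sq_spinor, norm_sq_spinor]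
  simp only [Fin.sum_univ_four, coord_zero, coord_one, coord_two, coord_three,
    Matrix.toEuclideanLin, pauli, Matrix.toLpLin_apply, Matrix.mulVec, dotProduct,
    Fin.sum_univ_two]
  fin_cases j <;> simp <;> ring

lemma norm_sigmaGrad_le (g : Fin 3 → Space → Spinor) (x : Space) :
    ‖sigmaGrad g x‖ ≤ ∑ j, ‖g j x‖ :=
  (norm_sum_le _ _).trans (Finset.sum_le_sum fun j _ => (norm_pauli j _).le)

lemma sigmaGrad_sub (g h : Fin 3 → Space → Spinor) (x : Space) :
    sigmaGrad (g - h) x = sigmaGrad g x - sigmaGrad h x := by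
  simp [sigmaGrad, Finset.sum_sub_distrib]

lemma aestronglyMeasurable_sigmaGrad {g : Fin 3 → Space → Spinor}
    (hg : ∀ j, AEStronglyMeasurable (g j) volume) : AEStronglyMeasurable (sigmaGrad g) volume := by
  unfold sigmaGrad
  refine Finset.aestronglyMeasurable_fun_sum _ fun j _ => ?_
  exact (LinearMap.continuous_of_finiteDimensional
    (Matrix.toEuclideanLin (pauli j))).comp_aestronglyMeasurable (hg j)

lemma eLpNorm_sigmaGrad_le {g : Fin 3 → Space → Spinor}
    (hg : ∀ j, AEStronglyMeasurable (g j) volume) :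
    eLpNorm (sigmaGrad g) 2 volume ≤ ∑ j, eLpNorm (g j) 2 volume := by
  refine le_trans (eLpNorm_mono (g := ∑ j, fun x => ‖g j x‖) fun x => ?_) ?_
  · rw [Finset.sum_apply, Real.norm_of_nonneg (Finset.sum_nonneg fun _ _ => norm_nonneg _)]
    exact norm_sigmaGrad_le g x
  · refine (eLpNorm_sum_le (fun j _ => (hg j).norm) (by norm_num)).trans ?_
    exact Finset.sum_le_sum fun j _ => (eLpNorm_norm _).le

lemma lintegral_weight_eq {E : Type*} [NormedAddCommGroup E] [NormedSpace ℝ E] {c : Space → ℝ}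
    (hc : ∀ x, 0 ≤ c x) (f : Space → E) :
    ∫⁻ x, ENNReal.ofReal (c x * ‖f x‖ ^ 2) = eLpNorm (fun x => √(c x) • f x) 2 volume ^ 2 := by
  have h := eLpNorm_nnreal_pow_eq_lintegral (μ := (volume : Measure Space))
    (f := fun x => √(c x) • f x) (p := 2) two_ne_zero
  simp only [NNReal.coe_ofNat, ENNReal.rpow_ofNat, ENNReal.coe_ofNat] at h
  rw [h]
  refine lintegral_congr fun x => ?_
  rw [← ofReal_norm, ← ENNReal.ofReal_pow (norm_nonneg _), norm_smul, mul_pow,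
    Real.norm_of_nonneg (Real.sqrt_nonneg _), Real.sq_sqrt (hc x)]

/-- The Dirac–Hardy inequality with potential `V` for `φ` with partial derivatives `g`. -/
def HardyFor (V : Space → ℝ) (φ : Space → Spinor) (g : Fin 3 → Space → Spinor) : Prop :=
  ∫⁻ x, ENNReal.ofReal (V x * ‖φ x‖ ^ 2) ≤
    ∫⁻ x, ENNReal.ofReal (‖sigmaGrad g x‖ ^ 2 / (1 + V x) + ‖φ x‖ ^ 2)

lemma lintegral_energy_eq {V : Space → ℝ} (hV : ∀ x, 0 ≤ V x) {φ : Space → Spinor}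
    (hφ : AEStronglyMeasurable φ volume) (g : Fin 3 → Space → Spinor) :
    ∫⁻ x, ENNReal.ofReal (‖sigmaGrad g x‖ ^ 2 / (1 + V x) + ‖φ x‖ ^ 2) =
      eLpNorm (fun x => √((1 + V x)⁻¹) • sigmaGrad g x) 2 volume ^ 2 +
        eLpNorm φ 2 volume ^ 2 := by
  have hV' : ∀ x, 0 ≤ (1 + V x)⁻¹ := fun x => by have := hV x; positivity
  rw [← lintegral_weight_eq hV']
  have h1 : eLpNorm φ 2 volume ^ 2 = ∫⁻ x, ENNReal.ofReal (‖φ x‖ ^ 2) := by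
    have := lintegral_weight_eq (c := fun _ => 1) (fun _ => zero_le_one) φ
    simpa using this.symm
  rw [h1, ← lintegral_add_right' _ (by fun_prop)]
  refine lintegral_congr fun x => ?_
  rw [← ENNReal.ofReal_add (mul_nonneg (hV' x) (sq_nonneg _)) (sq_nonneg _), div_eq_inv_mul]

/-- The Dirac–Hardy inequality is closed under `H¹` limits. -/
lemma HardyFor.of_approx {V : Space → ℝ} (hV : ∀ x, 0 ≤ V x) (hVm : Measurable V)
    {φ : Space → Spinor} {g : Fin 3 → Space → Spinor} (hφ : AEStronglyMeasurable φ volume)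
    (hg : ∀ j, AEStronglyMeasurable (g j) volume)
    (happ : ∀ ε : ℝ≥0∞, 0 < ε → ∃ (ψ : Space → Spinor) (h : Fin 3 → Space → Spinor),
      HardyFor V ψ h ∧ AEStronglyMeasurable ψ volume ∧ (∀ j, AEStronglyMeasurable (h j) volume) ∧
      eLpNorm (φ - ψ) 2 volume < ε ∧ ∀ j, eLpNorm (g j - h j) 2 volume < ε) :
    HardyFor V φ g := by
  choose ψ h hH hψ hh hlt hlt' using fun n : ℕ => happ ((n : ℝ≥0∞) + 1)⁻¹ (by simp)
  have hε : Tendsto (fun n : ℕ => ((n : ℝ≥0∞) + 1)⁻¹) atTop (𝓝 0) := by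
    have := (ENNReal.tendsto_inv_nat_nhds_zero).comp (tendsto_add_atTop_nat 1)
    refine this.congr fun n => ?_
    simp
  have hmeas : TendstoInMeasure volume ψ atTop φ := by
    refine tendstoInMeasure_of_tendsto_eLpNorm (p := 2) (by norm_num) hψ hφ ?_
    refine tendsto_of_tendsto_of_tendsto_of_le_of_le tendsto_const_nhds hε (fun n => zero_le)
      fun n => ?_
    rw [eLpNorm_sub_comm]
    exact (hlt n).le
  obtain ⟨ns, hns, hae⟩ := hmeas.exists_seq_tendsto_ae
  set B := eLpNorm (fun x => √((1 + V x)⁻¹) • sigmaGrad g x) 2 volume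
  set C := eLpNorm φ 2 volume
  have hD : ∀ n, ∫⁻ x, ENNReal.ofReal (V x * ‖ψ n x‖ ^ 2) ≤
      (B + 3 * ((n : ℝ≥0∞) + 1)⁻¹) ^ 2 + (C + ((n : ℝ≥0∞) + 1)⁻¹) ^ 2 := by
    intro n
    refine (hH n).trans ?_
    rw [lintegral_energy_eq hV (hψ n)]
    have hw : Measurable fun x => √((1 + V x)⁻¹) := by fun_prop
    gcongr
    · have e : (fun x => √((1 + V x)⁻¹) • sigmaGrad (h n) x) =
          (fun x => √((1 + V x)⁻¹) • sigmaGrad g x) -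
            fun x => √((1 + V x)⁻¹) • sigmaGrad (g - h n) x := by
        funext x
        simp only [Pi.sub_apply, sigmaGrad_sub, smul_sub]
        abel
      rw [e]
      refine (eLpNorm_sub_le ?_ ?_ (by norm_num)).trans (add_le_add le_rfl ?_)
      · exact hw.aestronglyMeasurable.smul (aestronglyMeasurable_sigmaGrad hg)
      · exact hw.aestronglyMeasurable.smul
          (aestronglyMeasurable_sigmaGrad fun j => (hg j).sub (hh n j))
      · calc eLpNorm (fun x => √((1 + V x)⁻¹) • sigmaGrad (g - h n) x) 2 volume
            ≤ eLpNorm (sigmaGrad (g - h n)) 2 volume := by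
              refine eLpNorm_mono fun x => ?_
              rw [norm_smul, Real.norm_of_nonneg (Real.sqrt_nonneg _)]
              refine mul_le_of_le_one_left (norm_nonneg _) ?_
              rw [Real.sqrt_le_one]
              exact inv_le_one_of_one_le₀ (by linarith [hV x])
          _ ≤ ∑ j, eLpNorm ((g - h n) j) 2 volume :=
              eLpNorm_sigmaGrad_le fun j => (hg j).sub (hh n j)
          _ ≤ ∑ _j : Fin 3, ((n : ℝ≥0∞) + 1)⁻¹ := Finset.sum_le_sum fun j _ => (hlt' n j).le
          _ = 3 * ((n : ℝ≥0∞) + 1)⁻¹ := by simp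
    · have e : ψ n = φ - (φ - ψ n) := by abel
      rw [e]
      exact (eLpNorm_sub_le hφ (hφ.sub (hψ n)) (by norm_num)).trans (add_le_add le_rfl (hlt n).le)
  have hDlim : Tendsto (fun n : ℕ => (B + 3 * ((n : ℝ≥0∞) + 1)⁻¹) ^ 2 +
      (C + ((n : ℝ≥0∞) + 1)⁻¹) ^ 2) atTop (𝓝 (B ^ 2 + C ^ 2)) := by
    have h1 := ((ENNReal.Tendsto.const_mul (a := 3) hε (Or.inr (by norm_num))).const_add B)
    have h2 := hε.const_add C
    rw [mul_zero, add_zero] at h1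
    rw [add_zero] at h2
    exact ((ENNReal.continuous_pow 2).tendsto _ |>.comp h1).add
      ((ENNReal.continuous_pow 2).tendsto _ |>.comp h2)
  rw [HardyFor, lintegral_energy_eq hV hφ]
  have hlim := hDlim.comp hns.tendsto_atTop
  calc ∫⁻ x, ENNReal.ofReal (V x * ‖φ x‖ ^ 2)
      = ∫⁻ x, liminf (fun n => ENNReal.ofReal (V x * ‖ψ (ns n) x‖ ^ 2)) atTop := by
        refine lintegral_congr_ae ?_
        filter_upwards [hae] with x hx
        refine (Tendsto.liminf_eq ?_).symm
        exact (ENNReal.continuous_ofReal.tendsto _).comp ((hx.norm.pow 2).const_mul (V x))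
    _ ≤ liminf (fun n => ∫⁻ x, ENNReal.ofReal (V x * ‖ψ (ns n) x‖ ^ 2)) atTop := by
        refine lintegral_liminf_le' fun n => ?_
        have := (hψ (ns n)).aemeasurable
        fun_prop
    _ ≤ liminf (fun n => (B + 3 * ((ns n : ℝ≥0∞) + 1)⁻¹) ^ 2 +
          (C + ((ns n : ℝ≥0∞) + 1)⁻¹) ^ 2) atTop := liminf_le_liminf (Eventually.of_forall fun n => hD _)
    _ = B ^ 2 + C ^ 2 := hlim.liminf_eq

/-- In three dimensions a function of size `1/t` on a ball of radius `2t` has `L²` norm of order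
`t^{1/2}`. -/
lemma eLpNorm_le_of_closedBall {F : Space → Spinor} {M t : ℝ} (ht : 0 < t) (hM : 0 ≤ M)
    (hF : ∀ x, ‖F x‖ ≤ M / t) (hF0 : ∀ x, 2 * t < ‖x‖ → F x = 0) :
    eLpNorm F 2 volume ≤
      ENNReal.ofReal (M * √(8 * (volume.real (Metric.ball (0 : Space) 1)) * t)) := by
  have h1 : eLpNorm F 2 volume ≤
      eLpNorm ((Metric.closedBall (0 : Space) (2 * t)).indicator fun _ => M / t) 2 volume := by
    refine eLpNorm_mono fun x => ?_
    by_cases hx : x ∈ Metric.closedBall (0 : Space) (2 * t)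
    · rw [indicator_of_mem hx]
      exact (hF x).trans (le_abs_self _)
    · rw [indicator_of_notMem hx, hF0 x (by simpa using hx)]
      simp
  refine h1.trans ?_
  rw [eLpNorm_indicator_const Metric.isClosed_closedBall.measurableSet (by norm_num) (by norm_num),
    Measure.addHaar_closedBall _ _ (by positivity)]
  set c := volume.real (Metric.ball (0 : Space) 1)
  have hc : volume (Metric.ball (0 : Space) 1) = ENNReal.ofReal c :=
    (ofReal_measureReal (by exact measure_ball_lt_top.ne)).symm
  have hc0 : 0 ≤ c := measureReal_nonneg
  rw [hc, ← ENNReal.ofReal_mul (by positivity), Real.enorm_of_nonneg (by positivity),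
    ENNReal.ofReal_rpow_of_nonneg (by positivity) (by norm_num),
    ← ENNReal.ofReal_mul (by positivity)]
  refine ENNReal.ofReal_le_ofReal (le_of_eq ?_)
  have : (1 : ℝ) / (2 : ℝ≥0∞).toReal = 1 / 2 := by simp
  rw [this, ← Real.sqrt_eq_rpow]
  have e : (2 * t) ^ Module.finrank ℝ Space * c = t ^ 2 * (8 * c * t) := by
    rw [finrank_euclideanSpace_fin]; ring
  rw [e, Real.sqrt_mul (by positivity), Real.sqrt_sq ht.le]
  field_simp

/-- A point has zero capacity in `ℝ³`: test spinors can be cut off at the origin. -/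
lemma exists_cutoff {R : ℝ} {ψ : Space → Spinor} (hψ : IsTestSpinor R ψ) {ε : ℝ≥0∞} (hε : 0 < ε) :
    ∃ ψ' : Space → Spinor, IsTestSpinor R ψ' ∧ (0 : Space) ∉ tsupport ψ' ∧
      eLpNorm (ψ - ψ') 2 volume < ε ∧
      ∀ j, eLpNorm (partialDeriv j ψ - partialDeriv j ψ') 2 volume < ε := by
  obtain ⟨hs, hc, hR⟩ := hψ
  let b : ContDiffBump (0 : Space) := ⟨1, 2, by norm_num, by norm_num⟩
  obtain ⟨M₀, hM₀⟩ := hs.continuous.bounded_above_of_compact_support hc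
  have hpart : ∀ j, ∃ M, ∀ x, ‖partialDeriv j ψ x‖ ≤ M := fun j =>
    (continuous_partialDeriv j (hs.of_le (by exact_mod_cast le_top))).bounded_above_of_compact_support
      (hc.of_isClosed_subset (isClosed_tsupport _) (tsupport_partialDeriv_subset ψ j))
  choose M₁ hM₁ using hpart
  have hb : ContDiff ℝ ∞ b := b.contDiff
  have hbpart : ∀ j, ∃ M, ∀ x, ‖partialDeriv j b x‖ ≤ M := fun j =>
    (continuous_partialDeriv j (hb.of_le (by exact_mod_cast le_top))).bounded_above_of_compact_support
      (b.hasCompactSupport.of_isClosed_subset (isClosed_tsupport _)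
        (tsupport_partialDeriv_subset b j))
  choose M₂ hM₂ using hbpart
  have hM₀0 : 0 ≤ M₀ := (norm_nonneg _).trans (hM₀ 0)
  have hM₁0 : ∀ j, 0 ≤ M₁ j := fun j => (norm_nonneg _).trans (hM₁ j 0)
  have hM₂0 : ∀ j, 0 ≤ M₂ j := fun j => (norm_nonneg _).trans (hM₂ j 0)
  set M := M₀ + ∑ j, (M₂ j * M₀ + M₁ j) with hM
  have hMj : ∀ j, M₂ j * M₀ + M₁ j ≤ M := fun j => by
    have := Finset.single_le_sum (f := fun j => M₂ j * M₀ + M₁ j)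
      (fun i _ => add_nonneg (mul_nonneg (hM₂0 i) hM₀0) (hM₁0 i)) (Finset.mem_univ j)
    linarith
  have hM0 : M₀ ≤ M := by
    have := Finset.sum_nonneg fun j (_ : j ∈ Finset.univ) =>
      add_nonneg (mul_nonneg (hM₂0 j) hM₀0) (hM₁0 j)
    linarith
  have hlim : Tendsto (fun t : ℝ =>
      ENNReal.ofReal (M * √(8 * (volume.real (Metric.ball (0 : Space) 1)) * t))) (𝓝[>] 0) (𝓝 0) := by
    have h : Continuous fun t : ℝ =>
      ENNReal.ofReal (M * √(8 * (volume.real (Metric.ball (0 : Space) 1)) * t)) :=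
      ENNReal.continuous_ofReal.comp (by fun_prop)
    have := h.tendsto 0
    simp only [mul_zero, Real.sqrt_zero, ENNReal.ofReal_zero] at this
    exact this.mono_left nhdsWithin_le_nhds
  obtain ⟨t, htε, ht0, ht1⟩ := ((hlim.eventually_lt_const hε).and
    (Ioo_mem_nhdsGT (zero_lt_one' ℝ))).exists
  -- the part near the origin that is cut off
  set B : Space → ℝ := fun x => b (t⁻¹ • x) with hBdef
  have hB : ContDiff ℝ ∞ B := hb.comp (contDiff_const_smul _)
  have hB1 : ∀ x, ‖B x‖ ≤ 1 := fun x => by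
    rw [Real.norm_of_nonneg b.nonneg]; exact b.le_one
  have hB0 : ∀ x, 2 * t < ‖x‖ → x ∉ tsupport B := fun x hx hx' => by
    have : tsupport B ⊆ Metric.closedBall 0 (2 * t) := by
      refine closure_minimal (fun y hy => ?_) Metric.isClosed_closedBall
      have : t⁻¹ • y ∈ Function.support b := hy
      rw [b.support_eq, mem_ball_zero_iff, norm_smul, norm_inv, Real.norm_of_nonneg ht0.le,
        inv_mul_lt_iff₀ ht0] at this
      simp only [mem_closedBall_zero_iff]
      change ‖y‖ < t * 2 at this
      linarith
    have := this hx'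
    rw [mem_closedBall_zero_iff] at this
    linarith
  have hBpart : ∀ j x, ‖partialDeriv j B x‖ ≤ M₂ j / t := fun j x => by
    have h := ((hb.differentiable (by norm_num) (t⁻¹ • x)).hasFDerivAt.comp x
      ((hasFDerivAt_id x).const_smul t⁻¹)).fderiv
    have h2 : partialDeriv j B x = t⁻¹ * partialDeriv j b (t⁻¹ • x) := by
      have h3 : B = b ∘ HSMul.hSMul t⁻¹ := rfl
      simp only [partialDeriv]
      rw [h3, h]
      simp
    rw [h2, norm_mul, norm_inv, Real.norm_of_nonneg ht0.le, inv_mul_eq_div]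
    exact div_le_div_of_nonneg_right (hM₂ j _) ht0.le
  set ψ' : Space → Spinor := fun x => ψ x - B x • ψ x with hψ'
  have hprod : ContDiff ℝ ∞ fun x => B x • ψ x := hB.smul hs
  have hψ's : ContDiff ℝ ∞ ψ' := hs.sub hprod
  have hsub : tsupport ψ' ⊆ tsupport ψ := closure_mono fun x hx hx' => hx (by simp [hψ', hx'])
  refine ⟨ψ', ⟨hψ's, hc.of_isClosed_subset (isClosed_tsupport _) hsub, hsub.trans hR⟩, ?_, ?_, ?_⟩
  · rw [notMem_tsupport_iff_eventuallyEq]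
    have : ∀ᶠ x in 𝓝 (0 : Space), x ∈ Metric.ball (0 : Space) t := Metric.ball_mem_nhds _ ht0
    filter_upwards [this] with x hx
    have h1 : B x = 1 := b.one_of_mem_closedBall (by
      rw [mem_closedBall_zero_iff, norm_smul, norm_inv, Real.norm_of_nonneg ht0.le]
      rw [mem_ball_zero_iff] at hx
      change t⁻¹ * ‖x‖ ≤ 1
      rw [inv_mul_le_iff₀ ht0]; linarith)
    simp [hψ', h1]
  · refine lt_of_le_of_lt (eLpNorm_le_of_closedBall ht0 (hM₀0.trans hM0) (fun x => ?_)
      fun x hx => ?_) htε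
    · have : (ψ - ψ') x = B x • ψ x := by simp [hψ']
      rw [this, norm_smul, le_div_iff₀ ht0]
      calc ‖B x‖ * ‖ψ x‖ * t ≤ 1 * M₀ * 1 := by
            gcongr
            · exact hB1 x
            · exact hM₀ x
        _ ≤ M := by linarith
    · have := image_eq_zero_of_notMem_tsupport (hB0 x hx)
      simp [hψ', this]
  · intro j
    have hfd : ∀ x, (partialDeriv j ψ - partialDeriv j ψ') x =
        B x • partialDeriv j ψ x + partialDeriv j B x • ψ x := fun x => by
      have hd1 := hB.differentiable (by norm_num) x
      have hd2 := hs.differentiable (by norm_num) x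
      simp only [Pi.sub_apply, partialDeriv, hψ']
      rw [fderiv_fun_sub hd2 (hd1.fun_smul hd2), fderiv_fun_smul hd1 hd2]
      simp
    refine lt_of_le_of_lt (eLpNorm_le_of_closedBall ht0 (hM₀0.trans hM0) (fun x => ?_)
      fun x hx => ?_) htε
    · rw [hfd, le_div_iff₀ ht0]
      have h1 : ‖B x • partialDeriv j ψ x‖ ≤ 1 * M₁ j := by
        rw [norm_smul]
        exact mul_le_mul (hB1 x) (hM₁ j x) (norm_nonneg _) zero_le_one
      have h2 : ‖partialDeriv j B x • ψ x‖ ≤ M₂ j / t * M₀ := by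
        rw [norm_smul]
        exact mul_le_mul (hBpart j x) (hM₀ x) (norm_nonneg _) (div_nonneg (hM₂0 j) ht0.le)
      calc _ ≤ (1 * M₁ j + M₂ j / t * M₀) * t :=
            mul_le_mul_of_nonneg_right ((norm_add_le _ _).trans (add_le_add h1 h2)) ht0.le
        _ = M₁ j * t + M₂ j * M₀ := by field_simp
        _ ≤ M₁ j * 1 + M₂ j * M₀ := by
            have := hM₁0 j
            gcongr
        _ ≤ M := by linarith [hMj j]
    · rw [hfd, image_eq_zero_of_notMem_tsupport (hB0 x hx), partialDeriv_eq_zero (hB0 x hx)]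
      simp

variable {R : ℝ} {W z : ℝ → ℝ}

/-- The Dirac–Hardy inequality on `H¹₀(B_R, ℂ²)` for a radial weight with a supersolution. -/
theorem diracHardyOn_of_supersolution (hWc : ContinuousOn W (Ici 0)) (hWnn : ∀ s, 0 ≤ s → 0 ≤ W s)
    (hW : ContDiffOn ℝ 1 W (Ioo 0 R)) (hz : ContDiffOn ℝ 1 z (Ioo 0 R))
    (hW1 : ∀ r ∈ Ioo 0 R, -1 ≤ deriv W r) (hW2 : ∀ r ∈ Ioo 0 R, r * deriv W r ≤ W r)
    (hric : ∀ r ∈ Ioo 0 R, 0 ≤ 2 * z r + r * deriv z r - z r ^ 2 * (W r + r) + r - W r) :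
    DiracHardyOn R W := by
  intro φ g hφ
  have hV : ∀ x : Space, 0 ≤ W ‖x‖ / ‖x‖ := fun x =>
    div_nonneg (hWnn _ (norm_nonneg _)) (norm_nonneg _)
  have hVm : Measurable fun x : Space => W ‖x‖ / ‖x‖ := by
    have h : Continuous fun x : Space => W ‖x‖ :=
      hWc.comp_continuous continuous_norm fun x => norm_nonneg _
    exact h.measurable.div measurable_norm
  refine HardyFor.of_approx hV hVm hφ.memH1.memLp.aestronglyMeasurable
    (fun j => (hφ.memH1.memLp_grad j).aestronglyMeasurable) fun ε hε => ?_
  have hε2 : 0 < ε / 2 := ENNReal.half_pos hε.ne'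
  obtain ⟨ψ, hψ, h1, h2⟩ := hφ.approx (ε / 2) hε2
  obtain ⟨ψ', hψ', h0, h3, h4⟩ := exists_cutoff hψ hε2
  have hm : ∀ {χ : Space → Spinor}, IsTestSpinor R χ → ∀ j,
      AEStronglyMeasurable (partialDeriv j χ) volume := fun hχ j =>
    (continuous_partialDeriv j (hχ.1.of_le (by exact_mod_cast le_top))).aestronglyMeasurable
  have hφm := hφ.memH1.memLp.aestronglyMeasurable
  refine ⟨ψ', fun j => partialDeriv j ψ', ?_, hψ'.1.continuous.aestronglyMeasurable, hm hψ', ?_, ?_⟩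
  · exact hardy_of_supersolution hW hz (fun r hr => hWnn r hr.1.le) hW1 hW2 hric hψ' h0
  · have e : φ - ψ' = (φ - ψ) + (ψ - ψ') := by abel
    rw [e, ← ENNReal.add_halves ε]
    refine lt_of_le_of_lt (eLpNorm_add_le (hφm.sub hψ.1.continuous.aestronglyMeasurable)
      (hψ.1.continuous.sub hψ'.1.continuous).aestronglyMeasurable (by norm_num)) ?_
    exact ENNReal.add_lt_add h1 h3
  · intro j
    have e : g j - partialDeriv j ψ' =
        (g j - partialDeriv j ψ) + (partialDeriv j ψ - partialDeriv j ψ') := by abel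
    rw [e, ← ENNReal.add_halves ε]
    refine lt_of_le_of_lt (eLpNorm_add_le
      ((hφ.memH1.memLp_grad j).aestronglyMeasurable.sub (hm hψ j))
      ((hm hψ j).sub (hm hψ' j)) (by norm_num)) ?_
    exact ENNReal.add_lt_add (h2 j) (h4 j)

end Density

/-! ### An optimal profile -/

section Profile

lemma contDiffOn_one_of_hasDerivAt {f f' : ℝ → ℝ} {s : Set ℝ} (hs : IsOpen s)
    (h : ∀ x ∈ s, HasDerivAt f (f' x) x) (hf' : ContinuousOn f' s) : ContDiffOn ℝ 1 f s := by
  rw [contDiffOn_one_iff_derivWithin hs.uniqueDiffOn]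
  refine ⟨fun x hx => (h x hx).differentiableAt.differentiableWithinAt, hf'.congr fun x hx => ?_⟩
  rw [derivWithin_of_isOpen hs hx, (h x hx).deriv]

/-- The positive part of `r - δ`, whose square is continuously differentiable. -/
noncomputable def excess (δ r : ℝ) : ℝ := max (r - δ) 0

lemma excess_nonneg (δ r : ℝ) : 0 ≤ excess δ r := le_max_right _ _

lemma excess_le {δ r : ℝ} (hδ : 0 < δ) (hr : 0 < r) : excess δ r ≤ r :=
  max_le (by linarith) hr.le

lemma continuous_excess (δ : ℝ) : Continuous (excess δ) := by unfold excess; fun_prop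

lemma hasDerivAt_excess_sq (δ r : ℝ) :
    HasDerivAt (fun r => excess δ r ^ 2) (2 * excess δ r) r := by
  rcases lt_trichotomy r δ with h | h | h
  · have e : (fun r => excess δ r ^ 2) =ᶠ[𝓝 r] fun _ => 0 := by
      filter_upwards [gt_mem_nhds h] with t ht
      simp [excess, max_eq_right (sub_nonpos.2 ht.le)]
    have e2 : excess δ r = 0 := max_eq_right (by linarith)
    rw [e2, mul_zero]
    exact (hasDerivAt_const r (0 : ℝ)).congr_of_eventuallyEq e
  · have e2 : excess δ r = 0 := max_eq_right (by linarith)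
    rw [e2, mul_zero, hasDerivAt_iff_hasFDerivAt]
    have hO : (fun t => excess δ t ^ 2) =O[𝓝 r] fun t => ‖t - r‖ ^ 2 := by
      refine Asymptotics.IsBigO.of_bound 1 (Eventually.of_forall fun t => ?_)
      rw [one_mul, norm_pow, norm_pow, norm_norm]
      refine pow_le_pow_left₀ (norm_nonneg _) ?_ 2
      rw [Real.norm_of_nonneg (excess_nonneg _ _), h]
      exact max_le (le_abs_self _) (abs_nonneg _)
    simpa using hO.hasFDerivAt (𝕜 := ℝ) one_lt_two
  · have e : (fun r => excess δ r ^ 2) =ᶠ[𝓝 r] fun t => (t - δ) ^ 2 := by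
      filter_upwards [lt_mem_nhds h] with t ht
      simp [excess, max_eq_left (sub_nonneg.2 ht.le)]
    have e2 : excess δ r = r - δ := max_eq_left (by linarith)
    rw [e2]
    refine HasDerivAt.congr_of_eventuallyEq ?_ e
    refine (((hasDerivAt_id' r).sub_const δ).fun_pow 2).congr_deriv ?_
    simp

/-- A change of variables that is the identity up to `δ` and bounded by its limit `2δ`. -/
noncomputable def saturate (δ r : ℝ) : ℝ := r - excess δ r ^ 2 / r

/-- A loss vanishing up to `δ`, of slope at most one and smaller than one, that is of order `r`
soon after `δ`. -/
noncomputable def loss (δ r : ℝ) : ℝ := excess δ r ^ 2 / (r + excess δ r ^ 2)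

/-- The profile: equal to `W_∞` up to `δ`, and lowered by `loss` afterwards, where the argument of
the series is kept below `2δ`. The value for `r ≤ 0` is `W_∞(0⁺) = 1`. -/
noncomputable def profile (a δ r : ℝ) : ℝ :=
  if r ≤ 0 then 1 else 1 + seriesSqX a (saturate δ r) / 8 - loss δ r

/-- The derivative of `profile`. -/
noncomputable def profileDeriv (a δ r : ℝ) : ℝ :=
  seriesDerivX a (saturate δ r) / saturate δ r * (1 - excess δ r / r) ^ 2 / 8 -
    (2 * excess δ r * r - excess δ r ^ 2) / (r + excess δ r ^ 2) ^ 2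

variable {a δ r : ℝ}

lemma saturate_eq (h : r ≤ δ) : saturate δ r = r := by
  have : excess δ r = 0 := max_eq_right (by linarith)
  simp [saturate, this]

lemma saturate_le_self (hr : 0 < r) : saturate δ r ≤ r := by
  have : 0 ≤ excess δ r ^ 2 / r := by positivity
  rw [saturate]; linarith

lemma saturate_pos (hδ : 0 < δ) (hr : 0 < r) : 0 < saturate δ r := by
  have h1 : excess δ r < r := max_lt (by linarith) hr
  have h0 := excess_nonneg δ r
  rw [saturate, sub_pos, div_lt_iff₀ hr]
  nlinarith

lemma saturate_le (hδ : 0 < δ) (hr : 0 < r) : saturate δ r ≤ 2 * δ := by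
  rcases le_total r δ with h | h
  · rw [saturate_eq h]; linarith
  · have e2 : excess δ r = r - δ := max_eq_left (by linarith)
    rw [saturate, e2, sub_le_iff_le_add, ← sub_le_iff_le_add', le_div_iff₀ hr]
    nlinarith [sq_nonneg δ]

/-- The logarithmic derivative of `saturate` with respect to `log r` is at most one. -/
lemma mul_sq_le_saturate (hδ : 0 < δ) (hr : 0 < r) :
    r * (1 - excess δ r / r) ^ 2 ≤ saturate δ r := by
  have h1 := excess_le hδ hr
  have h0 := excess_nonneg δ r
  have e : r * (1 - excess δ r / r) ^ 2 =
      saturate δ r - 2 * excess δ r * (r - excess δ r) / r := by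
    rw [saturate]; field_simp; ring
  have : 0 ≤ 2 * excess δ r * (r - excess δ r) / r :=
    div_nonneg (mul_nonneg (by linarith) (by linarith)) hr.le
  linarith

lemma hasDerivAt_saturate (hr : 0 < r) :
    HasDerivAt (saturate δ) ((1 - excess δ r / r) ^ 2) r := by
  refine ((hasDerivAt_id' r).fun_sub
    ((hasDerivAt_excess_sq δ r).fun_div (hasDerivAt_id' r) hr.ne')).congr_deriv ?_
  field_simp; ring

lemma hasDerivAt_loss (hr : 0 < r) :
    HasDerivAt (loss δ) ((2 * excess δ r * r - excess δ r ^ 2) / (r + excess δ r ^ 2) ^ 2) r := by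
  have h : r + excess δ r ^ 2 ≠ 0 := by positivity
  refine ((hasDerivAt_excess_sq δ r).fun_div
    ((hasDerivAt_id' r).fun_add (hasDerivAt_excess_sq δ r)) h).congr_deriv ?_
  ring

lemma loss_nonneg (hr : 0 < r) : 0 ≤ loss δ r := by unfold loss; positivity

lemma one_sub_loss (hr : 0 < r) : 1 - loss δ r = r / (r + excess δ r ^ 2) := by
  have h : r + excess δ r ^ 2 ≠ 0 := by positivity
  rw [loss]; field_simp; ring

lemma inv_le_one_sub_loss (hδ : 0 < δ) (hr : 0 < r) : (1 + r)⁻¹ ≤ 1 - loss δ r := by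
  rw [one_sub_loss hr, inv_le_comm₀ (by positivity) (by positivity), inv_div,
    div_le_iff₀ hr]
  nlinarith [excess_le hδ hr, excess_nonneg δ r]

lemma le_loss (hδ : 0 < δ) (h : 2 * δ ≤ r) : r / (4 + r) ≤ loss δ r := by
  have hr : 0 < r := by linarith
  have e : excess δ r = r - δ := max_eq_left (by linarith)
  have h1 : r / 2 ≤ excess δ r := by rw [e]; linarith
  rw [loss, div_le_div_iff₀ (by positivity) (by positivity)]
  nlinarith [mul_self_le_mul_self (by positivity) h1]

lemma saturate_mem (hδ : 0 < δ) (hδa : 2 * δ < Real.exp (a - 1)) (hr : 0 < r) :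
    saturate δ r ∈ Ioo 0 (Real.exp (a - 1)) :=
  ⟨saturate_pos hδ hr, (saturate_le hδ hr).trans_lt hδa⟩

lemma profile_of_pos (hr : 0 < r) :
    profile a δ r = 1 + seriesSqX a (saturate δ r) / 8 - loss δ r := if_neg hr.not_ge

lemma hasDerivAt_profile (ha : 1 < a) (hδ : 0 < δ) (hδa : 2 * δ < Real.exp (a - 1)) (hr : 0 < r) :
    HasDerivAt (profile a δ) (profileDeriv a δ r) r := by
  have e : profile a δ =ᶠ[𝓝 r] fun r => 1 + seriesSqX a (saturate δ r) / 8 - loss δ r := by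
    filter_upwards [lt_mem_nhds hr] with t ht using profile_of_pos ht
  refine HasDerivAt.congr_of_eventuallyEq ?_ e
  have h1 := (hasDerivAt_seriesSqX ha (saturate_mem hδ hδa hr)).comp r
    (hasDerivAt_saturate (δ := δ) hr)
  exact ((h1.div_const 8).const_add 1).fun_sub (hasDerivAt_loss hr)

lemma continuousOn_profileDeriv (ha : 1 < a) (hδ : 0 < δ) (hδa : 2 * δ < Real.exp (a - 1)) :
    ContinuousOn (profileDeriv a δ) (Ioi 0) := by
  have hs : ContinuousOn (saturate δ) (Ioi 0) := fun r hr =>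
    (hasDerivAt_saturate hr).continuousAt.continuousWithinAt
  have hd : ContinuousOn (fun r => seriesDerivX a (saturate δ r)) (Ioi 0) :=
    (continuousOn_seriesDerivX ha).comp hs fun r hr => saturate_mem hδ hδa hr
  have he := (continuous_excess δ).continuousOn (s := Ioi 0)
  have hid := continuousOn_id (α := ℝ) (s := Ioi 0)
  unfold profileDeriv
  refine ContinuousOn.sub ?_ ?_
  · refine ((hd.div hs fun r hr => (saturate_pos hδ hr).ne').mul ?_).div_const 8
    exact ((continuousOn_const).sub (he.div hid fun r (hr : 0 < r) => hr.ne')).pow 2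
  · refine (((continuousOn_const.mul he).mul hid).sub (he.pow 2)).div
      ((hid.add (he.pow 2)).pow 2) fun r (hr : 0 < r) => ?_
    positivity

lemma contDiffOn_profile (ha : 1 < a) (hδ : 0 < δ) (hδa : 2 * δ < Real.exp (a - 1)) :
    ContDiffOn ℝ 1 (profile a δ) (Ioi 0) :=
  contDiffOn_one_of_hasDerivAt isOpen_Ioi (fun _ hr => hasDerivAt_profile ha hδ hδa hr)
    (continuousOn_profileDeriv ha hδ hδa)

lemma profile_eq_WInf (hr : 0 < r) (h : r ≤ δ) : profile a δ r = WInf a r := by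
  have e : excess δ r = 0 := max_eq_right (by linarith)
  rw [profile_of_pos hr, saturate_eq h, WInf_eq, loss, e]
  simp

lemma profile_lower (hδ : 0 < δ) (hr : 0 < r) : (1 + r)⁻¹ ≤ profile a δ r := by
  have h1 := inv_le_one_sub_loss hδ hr
  have h2 := seriesSqX_nonneg a (saturate δ r)
  rw [profile_of_pos hr]
  linarith

lemma profile_nonneg (hδ : 0 < δ) (r : ℝ) : 0 ≤ profile a δ r := by
  rcases le_or_gt r 0 with h | h
  · rw [profile, if_pos h]; exact zero_le_one
  · exact (by positivity : 0 ≤ (1 + r)⁻¹).trans (profile_lower hδ h)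

lemma continuousOn_profile (ha : 1 < a) (hδ : 0 < δ) (hδa : 2 * δ < Real.exp (a - 1)) :
    ContinuousOn (profile a δ) (Ici 0) := by
  intro r hr
  rcases eq_or_lt_of_le (show 0 ≤ r from hr) with h | h
  · rw [← h, ← continuousWithinAt_Ioi_iff_Ici, ContinuousWithinAt]
    have h0 : profile a δ 0 = 1 := if_pos le_rfl
    have hlim : Tendsto (WInf a) (𝓝[>] 0) (𝓝 (1 + 0 / 8)) := by
      simp only [funext (WInf_eq a)]
      exact ((tendsto_seriesSqX ha).div_const 8).const_add 1
    rw [h0]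
    simp only [zero_div, add_zero] at hlim
    refine hlim.congr' ?_
    filter_upwards [Ioo_mem_nhdsGT hδ] with t ht using (profile_eq_WInf ht.1 ht.2.le).symm
  · exact (hasDerivAt_profile ha hδ hδa h).continuousAt.continuousWithinAt

lemma neg_one_le_profileDeriv (ha : 1 < a) (hδ : 0 < δ) (hδa : 2 * δ < Real.exp (a - 1))
    (hr : 0 < r) : -1 ≤ profileDeriv a δ r := by
  have hs := saturate_mem hδ hδa hr
  have h1 : 0 ≤ seriesDerivX a (saturate δ r) / saturate δ r * (1 - excess δ r / r) ^ 2 / 8 := by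
    have := seriesDerivX_nonneg ha hs
    have := hs.1
    positivity
  have h2 : (2 * excess δ r * r - excess δ r ^ 2) / (r + excess δ r ^ 2) ^ 2 ≤ 1 := by
    rw [div_le_one (by positivity)]
    nlinarith [sq_nonneg (r - excess δ r), sq_nonneg (excess δ r), sq_nonneg (excess δ r ^ 2),
      mul_nonneg hr.le (sq_nonneg (excess δ r))]
  rw [profileDeriv]; linarith

lemma mul_profileDeriv_le (ha : 1 < a) (hδ : 0 < δ) (hδa : 2 * δ < Real.exp (a - 1))
    (hr : 0 < r) : r * profileDeriv a δ r ≤ seriesDerivX a (saturate δ r) / 8 := by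
  have hs := saturate_mem hδ hδa hr
  have hD := seriesDerivX_nonneg ha hs
  have h2 : 0 ≤ (2 * excess δ r * r - excess δ r ^ 2) / (r + excess δ r ^ 2) ^ 2 := by
    have h1 := excess_le hδ hr
    have h0 := excess_nonneg δ r
    refine div_nonneg ?_ (by positivity)
    nlinarith
  have h3 : r * (seriesDerivX a (saturate δ r) / saturate δ r * (1 - excess δ r / r) ^ 2 / 8) ≤
      seriesDerivX a (saturate δ r) / 8 := by
    have h4 := mul_le_mul_of_nonneg_left (mul_sq_le_saturate hδ hr)
      (div_nonneg hD hs.1.le)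
    rw [div_mul_cancel₀ _ hs.1.ne'] at h4
    linarith
  rw [profileDeriv, mul_sub]
  nlinarith [mul_nonneg hr.le h2]

lemma isProfile_profile {R : ℝ} (ha : 1 < a) (hδ : 0 < δ) (hδa : 2 * δ < Real.exp (a - 1))
    (hR : ∀ r ∈ Ioo 0 R, r * profileDeriv a δ r ≤ profile a δ r) : IsProfile R (profile a δ) where
  continuousOn := continuousOn_profile ha hδ hδa
  nonneg s _ := profile_nonneg hδ s
  differentiable_ae := by
    filter_upwards [ae_restrict_mem measurableSet_Ioi] with r hr
    exact (hasDerivAt_profile ha hδ hδa hr).differentiableAt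
  deriv_bound := by
    filter_upwards [ae_restrict_mem measurableSet_Ioo] with r hr
    rw [(hasDerivAt_profile ha hδ hδa hr.1).deriv]
    have h1 := neg_one_le_profileDeriv ha hδ hδa hr.1
    have h2 := hR r hr
    have h3 := profile_nonneg (a := a) hδ r
    have h4 := hr.1
    constructor <;> nlinarith

end Profile

/-! ### Supersolutions of the Riccati equation -/

section Riccati

/-- The defect of the Riccati inequality for `z = 1 + y` with the weight `W = 1 + w`, where `η`
stands for `r y'`. It is concave in `y` and decreasing in `w`. -/
def riccati (w r y η : ℝ) : ℝ := η - (2 * w * (1 + y) + 2 * y * r + y ^ 2 * (1 + w + r))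

lemma riccati_anti {w w' r y η : ℝ} (h : w ≤ w') : riccati w' r y η ≤ riccati w r y η := by
  unfold riccati
  nlinarith [mul_nonneg (sub_nonneg.2 h) (add_nonneg zero_le_one (sq_nonneg (1 + y)))]

/-- By concavity, two ordered solutions of the Riccati inequality can be glued by a nondecreasing
cutoff `χ`, where `θ` stands for `r χ'`. -/
lemma riccati_interpolate {w r y₀ y₁ η₀ η₁ χ θ : ℝ} (hw : 0 ≤ 1 + w + r) (hχ0 : 0 ≤ χ) (hχ1 : χ ≤ 1)
    (hθ : 0 ≤ θ) (hy : y₀ ≤ y₁) (h0 : 0 ≤ riccati w r y₀ η₀) (h1 : 0 ≤ riccati w r y₁ η₁) :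
    0 ≤ riccati w r ((1 - χ) * y₀ + χ * y₁) ((1 - χ) * η₀ + χ * η₁ + θ * (y₁ - y₀)) := by
  have e : riccati w r ((1 - χ) * y₀ + χ * y₁) ((1 - χ) * η₀ + χ * η₁ + θ * (y₁ - y₀)) =
      (1 - χ) * riccati w r y₀ η₀ + χ * riccati w r y₁ η₁ + θ * (y₁ - y₀) +
        (1 + w + r) * (χ * (1 - χ) * (y₁ - y₀) ^ 2) := by
    unfold riccati; ring
  have h2 := mul_nonneg (sub_nonneg.2 hχ1) h0
  have h3 := mul_nonneg hχ0 h1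
  have h4 := mul_nonneg hθ (sub_nonneg.2 hy)
  have h5 := mul_nonneg hw (mul_nonneg (mul_nonneg hχ0 (sub_nonneg.2 hχ1)) (sq_nonneg (y₁ - y₀)))
  linarith

/-- The supersolution near the origin. The first term solves the leading order equation
`r y' = y² + 2w` exactly; the second one absorbs the remainder. -/
noncomputable def innerSol (a r : ℝ) : ℝ := seriesX a r / 2 + X a 1 r ^ 2

/-- The derivative of `innerSol` with respect to `log r`. -/
noncomputable def innerSolDeriv (a r : ℝ) : ℝ :=
  (seriesX a r ^ 2 + seriesSqX a r) / 4 + 2 * X a 1 r ^ 3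

/-- The supersolution away from the origin. -/
noncomputable def outerSol (κ r : ℝ) : ℝ := 3 / 4 / (κ - Real.log r)

variable {a r κ : ℝ}

lemma hasDerivAt_innerSol (ha : 1 < a) (hr : r ∈ Ioo 0 (Real.exp (a - 1))) :
    HasDerivAt (innerSol a) (innerSolDeriv a r / r) r := by
  refine (((hasDerivAt_seriesX ha hr).div_const 2).fun_add
    ((hasDerivAt_X ha hr 1).fun_pow 2)).congr_deriv ?_
  have := hr.1.ne'
  rw [prodX_one, innerSolDeriv]
  field_simp; ring

lemma contDiffOn_innerSol (ha : 1 < a) :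
    ContDiffOn ℝ 1 (innerSol a) (Ioo 0 (Real.exp (a - 1))) := by
  refine contDiffOn_one_of_hasDerivAt isOpen_Ioo (fun r hr => hasDerivAt_innerSol ha hr)
    fun r hr => ContinuousAt.continuousWithinAt ?_
  have h1 := (hasDerivAt_seriesX ha hr).continuousAt
  have h2 := (hasDerivAt_seriesSqX ha hr).continuousAt
  have h3 := (hasDerivAt_X ha hr 1).continuousAt
  exact ((((h1.pow 2).add h2).div_const 4).add ((h3.pow 3).const_mul 2)).div continuousAt_id hr.1.ne'

lemma hasDerivAt_outerSol (hr : 0 < r) (hκ : 0 < κ - Real.log r) :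
    HasDerivAt (outerSol κ) (4 / 3 * outerSol κ r ^ 2 / r) r := by
  refine ((hasDerivAt_const r (3 / 4 : ℝ)).fun_div
    ((Real.hasDerivAt_log hr.ne').const_sub κ) hκ.ne').congr_deriv ?_
  rw [outerSol]
  field_simp; norm_num

lemma eventually_riccati_innerSol (ha : 1 < a) :
    ∀ᶠ r in 𝓝[>] (0 : ℝ), innerSol a r ≤ 3 / 5 * X a 1 r ∧
      0 ≤ riccati (seriesSqX a r / 8) r (innerSol a r) (innerSolDeriv a r) := by
  have h1 := eventually_seriesX_le ha (c := 11 / 10) (by norm_num)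
  have h2 := (tendsto_div_X_one_pow a 3).eventually_le_const (show (0 : ℝ) < 1 / 100 by norm_num)
  have h3 := ((tendsto_X a 1).mono_right nhdsWithin_le_nhds).eventually_le_const
    (show (0 : ℝ) < 1 / 20 by norm_num)
  filter_upwards [h1, h2, h3, Ioo_exp_mem a] with r h1 h2 h3 hr
  have hx := X_pos ha hr 1
  have hS := X_one_le_seriesX ha hr
  have hQ0 := seriesSqX_nonneg a r
  have hQ := seriesSqX_le ha hr
  rw [div_le_iff₀ (by positivity)] at h2
  have hr0 := hr.1
  unfold innerSol innerSolDeriv riccati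
  set x := X a 1 r
  set S := seriesX a r
  set Q := seriesSqX a r
  set y := S / 2 + x ^ 2 with hy
  have hx2 : x ^ 2 ≤ 1 / 20 * x := by rw [sq]; exact mul_le_mul_of_nonneg_right h3 hx.le
  have hyx : y ≤ 3 / 5 * x := by rw [hy]; linarith
  have hS0 : 0 ≤ S := hx.le.trans hS
  have hy0 : 0 ≤ y := by positivity
  refine ⟨hyx, ?_⟩
  have hx3 : x ^ 3 ≤ 1 / 400 * x := by nlinarith
  have hx4 : x ^ 4 ≤ 1 / 20 * x ^ 3 := by
    have : x ^ 4 = x * x ^ 3 := by ring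
    rw [this]; exact mul_le_mul_of_nonneg_right h3 (by positivity)
  have hQ2 : Q ≤ 11 / 10 * x ^ 2 := by nlinarith
  have t1 : Q * y ≤ 11 / 10 * x ^ 2 * (3 / 5 * x) :=
    mul_le_mul hQ2 hyx hy0 (by positivity)
  have t2 : y * r ≤ 3 / 5 * x * (1 / 100 * x ^ 3) := mul_le_mul hyx h2 hr0.le (by positivity)
  have t3 : S * x ^ 2 ≤ 11 / 10 * x * x ^ 2 := mul_le_mul_of_nonneg_right h1 (by positivity)
  have t4 : y ^ 2 * (Q / 8 + r) ≤ (3 / 5 * x) ^ 2 * (1 / 5 * x ^ 2) := by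
    refine mul_le_mul (pow_le_pow_left₀ hy0 hyx 2) ?_ (by positivity) (by positivity)
    nlinarith
  have e : y ^ 2 = S ^ 2 / 4 + S * x ^ 2 + x ^ 4 := by rw [hy]; ring
  have e2 : y ^ 2 * (1 + Q / 8 + r) = S ^ 2 / 4 + S * x ^ 2 + x ^ 4 + y ^ 2 * (Q / 8 + r) := by
    rw [← e]; ring
  rw [e2]
  have hx3' : 0 < x ^ 3 := by positivity
  nlinarith

/-- The loss `ℓ` pays for the terms proportional to `r`, and the factor `4/3` for the remaining
part `q` of the weight. -/
lemma riccati_outerSol {R q y ℓ : ℝ} (hr : 0 < r) (hrR : r < R) (hy0 : 0 < y)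
    (hy : y ≤ 1 / (16 * (1 + R))) (hq0 : 0 ≤ q) (hq : q ≤ y ^ 2 / 9) (hℓ : r / (4 + r) ≤ ℓ) :
    0 ≤ riccati (q - ℓ) r y (4 / 3 * y ^ 2) := by
  have hR : 0 < R := hr.trans hrR
  have hy' : y * (16 * (1 + R)) ≤ 1 := (le_div_iff₀ (by positivity)).1 hy
  have hy1 : y ≤ 1 / 16 := by nlinarith [mul_pos hy0 hR]
  have hℓ1 : 4 * (y * r) ≤ ℓ := by
    refine le_trans ?_ hℓ
    rw [le_div_iff₀ (by positivity)]
    have : y * (4 + r) ≤ 1 / 4 := by nlinarith [mul_pos hy0 hR, mul_pos hy0 hr]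
    nlinarith
  have hℓ0 : 0 ≤ ℓ := le_trans (by positivity) hℓ
  unfold riccati
  have e : 4 / 3 * y ^ 2 - (2 * (q - ℓ) * (1 + y) + 2 * y * r + y ^ 2 * (1 + (q - ℓ) + r)) =
      (y ^ 2 / 3 - q * (2 + 2 * y + y ^ 2)) + (ℓ * (2 + 2 * y + y ^ 2) - (2 * (y * r) + y * (y * r)))
      := by ring
  rw [e]
  have h1 : q * (2 + 2 * y + y ^ 2) ≤ q * 3 := mul_le_mul_of_nonneg_left (by nlinarith) hq0
  have h2 : ℓ * 2 ≤ ℓ * (2 + 2 * y + y ^ 2) :=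
    mul_le_mul_of_nonneg_left (by nlinarith [sq_nonneg y]) hℓ0
  have h3 : y * (y * r) ≤ 1 * (y * r) := mul_le_mul_of_nonneg_right (by linarith) (by positivity)
  have h4 : 0 < y * r := by positivity
  linarith

lemma eventually_innerSol_le_outerSol (ha : 1 < a) (κ : ℝ) :
    ∀ᶠ r in 𝓝[>] (0 : ℝ), innerSol a r ≤ outerSol κ r := by
  have h1 := Real.tendsto_log_nhdsGT_zero.eventually_le_atBot (-(4 * |κ|) - 5 * |a|)
  filter_upwards [eventually_riccati_innerSol ha, h1, Ioo_exp_mem a, Ioo_mem_nhdsGT zero_lt_one]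
    with r h2 h1 hr hr1
  refine h2.1.trans ?_
  have hlog : Real.log r < 0 := Real.log_neg hr1.1 hr1.2
  have ha' : 0 < a - Real.log r := by linarith [(X_mem ha hr 0).2, X_zero a r]
  have h3 := neg_abs_le κ
  have h4 := le_abs_self κ
  have h5 := le_abs_self a
  have h6 := abs_nonneg κ
  have h7 := abs_nonneg a
  have h8 : a ≤ |a| := le_abs_self a
  rw [outerSol, X_succ, X_zero, ← div_eq_mul_inv, div_le_div_iff₀ ha' (by linarith)]
  linarith

end Riccati

section Optimal

/-- For every `a` and `R` the profile that equals `W_∞` up to a small `δ` satisfies the Dirac–Hardy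
inequality on the ball of radius `R`. -/
theorem exists_profile {a R : ℝ} (ha : 1 < a) (hR : 0 < R) :
    ∃ δ : ℝ, 0 < δ ∧ IsProfile R (profile a δ) ∧ DiracHardyOn R (profile a δ) := by
  set κ := Real.log R + 12 * (1 + R) with hκ
  have hκr : ∀ r ∈ Ioo 0 R, 12 * (1 + R) ≤ κ - Real.log r := fun r hr => by
    have := Real.log_le_log hr.1 hr.2.le
    linarith
  have hκ0 : ∀ r ∈ Ioo 0 R, 0 < κ - Real.log r := fun r hr => by linarith [hκr r hr]
  have hout0 : ∀ r ∈ Ioo 0 R, 0 < outerSol κ r := fun r hr => by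
    have := hκ0 r hr
    unfold outerSol; positivity
  have hout1 : ∀ r ∈ Ioo 0 R, outerSol κ r ≤ 1 / (16 * (1 + R)) := fun r hr => by
    have h1 := hκr r hr
    rw [outerSol, div_le_div_iff₀ (hκ0 r hr) (by positivity)]
    linarith
  -- `d`: up to `2d` the inner solution works, and on `[d, 2d]` one passes to the outer one
  obtain ⟨d₀, hd₀, hd₀'⟩ := mem_nhdsGT_iff_exists_Ioo_subset.1
    ((eventually_riccati_innerSol ha).and (eventually_innerSol_le_outerSol ha κ))
  obtain ⟨d, hd, hdd, hdR, hda⟩ : ∃ d, 0 < d ∧ 2 * d < d₀ ∧ 2 * d < R ∧ 2 * d < Real.exp (a - 1) := by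
    refine ⟨min d₀ (min R (Real.exp (a - 1))) / 3, ?_, ?_, ?_, ?_⟩
    · have := lt_min (show 0 < d₀ from hd₀) (lt_min hR (Real.exp_pos (a - 1)))
      linarith
    all_goals
      have h1 := min_le_left d₀ (min R (Real.exp (a - 1)))
      have h2 := (min_le_right d₀ (min R (Real.exp (a - 1)))).trans (min_le_left _ _)
      have h3 := (min_le_right d₀ (min R (Real.exp (a - 1)))).trans (min_le_right _ _)
      have h4 : 0 < d₀ := hd₀
      have h5 := Real.exp_pos (a - 1)
      linarith
  have hd2 : d ∈ Ioo 0 R := ⟨hd, by linarith⟩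
  -- `δ`: small enough for the outer solution to absorb `W_∞(2δ) - 1` beyond `d`
  have hη : 0 < outerSol κ d ^ 2 / 9 := by have := hout0 d hd2; positivity
  obtain ⟨δ₀, hδ₀, hδ₀'⟩ := mem_nhdsGT_iff_exists_Ioo_subset.1
    (((tendsto_seriesSqX ha).eventually_le_const (show 0 < 8 * (outerSol κ d ^ 2 / 9) by positivity)).and
      ((tendsto_seriesDerivX ha).eventually_le_const (show 0 < 8 * (1 + R)⁻¹ by positivity)))
  obtain ⟨δ, hδ, hδ1, hδ2⟩ : ∃ δ, 0 < δ ∧ 2 * δ < δ₀ ∧ 2 * δ < d := by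
    have h0 : 0 < δ₀ := hδ₀
    refine ⟨min δ₀ d / 3, ?_, ?_, ?_⟩
    · have := lt_min h0 hd
      linarith
    all_goals
      have h1 := min_le_left δ₀ d
      have h2 := min_le_right δ₀ d
      linarith
  have hδa : 2 * δ < Real.exp (a - 1) := by linarith
  have hsmall : ∀ r, 0 < r → seriesSqX a (saturate δ r) ≤ 8 * (outerSol κ d ^ 2 / 9) ∧
      seriesDerivX a (saturate δ r) ≤ 8 * (1 + R)⁻¹ := fun r hr =>
    hδ₀' ⟨saturate_pos hδ hr, (saturate_le hδ hr).trans_lt hδ1⟩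
  have hW2 : ∀ r ∈ Ioo 0 R, r * profileDeriv a δ r ≤ profile a δ r := fun r hr => by
    have h1 := mul_profileDeriv_le ha hδ hδa hr.1
    have h2 := (hsmall r hr.1).2
    have h3 := profile_lower (a := a) hδ hr.1
    have h4 : (1 + R)⁻¹ ≤ (1 + r)⁻¹ := inv_anti₀ (by linarith [hr.1]) (by linarith [hr.2])
    linarith
  refine ⟨δ, hδ, isProfile_profile ha hδ hδa hW2, ?_⟩
  have hinner : ∀ r, 0 < r → r ≤ 2 * d →
      0 ≤ riccati (profile a δ r - 1) r (innerSol a r) (innerSolDeriv a r) := fun r hr hrd => by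
    have h1 := (hd₀' ⟨hr, by linarith⟩ : _ ∧ _).1.2
    refine h1.trans (riccati_anti ?_)
    rw [profile_of_pos hr]
    have h2 := loss_nonneg (δ := δ) hr
    have h3 := seriesSqX_mono ha (saturate_pos hδ hr) (saturate_le_self (δ := δ) hr)
      (by linarith : r < Real.exp (a - 1))
    linarith
  have houter : ∀ r, d ≤ r → r < R →
      0 ≤ riccati (profile a δ r - 1) r (outerSol κ r) (4 / 3 * outerSol κ r ^ 2) := fun r hdr hrR => by
    have hr : 0 < r := by linarith
    have h1 : outerSol κ d ≤ outerSol κ r := by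
      have := Real.log_le_log hd hdr
      have := hκ0 r ⟨hr, hrR⟩
      unfold outerSol
      gcongr
    have e : profile a δ r - 1 = seriesSqX a (saturate δ r) / 8 - loss δ r := by
      rw [profile_of_pos hr]; ring
    rw [e]
    refine riccati_outerSol hr hrR (hout0 r ⟨hr, hrR⟩) (hout1 r ⟨hr, hrR⟩) ?_ ?_
      (le_loss hδ (by linarith))
    · have := seriesSqX_nonneg a (saturate δ r)
      positivity
    · have h2 := (hsmall r hr).1
      have h3 := pow_le_pow_left₀ (hout0 d hd2).le h1 2
      linarith
  have hle : ∀ r, d ≤ r → r ≤ 2 * d → innerSol a r ≤ outerSol κ r := fun r h1 h2 =>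
    (hd₀' ⟨by linarith, by linarith⟩ : _ ∧ _).2
  set χ : ℝ → ℝ := fun r => Real.smoothTransition ((r - d) / d) with hχ
  have hχs : ContDiff ℝ 1 χ := (Real.smoothTransition.contDiff (n := 1)).comp (by fun_prop)
  have hχd : ∀ r, HasDerivAt χ (deriv χ r) r := fun r =>
    (hχs.differentiable (by norm_num) r).hasDerivAt
  have hχmono : Monotone χ := fun r s hrs => Real.smoothTransition.monotone (by gcongr)
  have hχ0 : ∀ r, r ≤ d → χ r = 0 := fun r hr =>
    Real.smoothTransition.zero_of_nonpos (div_nonpos_of_nonpos_of_nonneg (by linarith) hd.le)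
  have hχ1 : ∀ r, 2 * d ≤ r → χ r = 1 := fun r hr =>
    Real.smoothTransition.one_of_one_le (by rw [le_div_iff₀ hd]; linarith)
  set y : ℝ → ℝ := fun r => (1 - χ r) * innerSol a r + χ r * outerSol κ r with hy
  have hyin : ∀ r, r < d → y =ᶠ[𝓝 r] innerSol a := fun r hr => by
    filter_upwards [gt_mem_nhds hr] with t ht
    simp [hy, hχ0 t ht.le]
  have hyout : ∀ r, 2 * d < r → y =ᶠ[𝓝 r] outerSol κ := fun r hr => by
    filter_upwards [lt_mem_nhds hr] with t ht
    simp [hy, hχ1 t ht.le]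
  have houts : ContDiffOn ℝ 1 (outerSol κ) (Ioo 0 R) := by
    refine contDiffOn_one_of_hasDerivAt isOpen_Ioo
      (fun r hr => hasDerivAt_outerSol hr.1 (hκ0 r hr)) fun r hr => ContinuousAt.continuousWithinAt ?_
    have := (hasDerivAt_outerSol hr.1 (hκ0 r hr)).continuousAt
    exact ((this.pow 2).const_mul (4 / 3)).div continuousAt_id hr.1.ne'
  have hys : ContDiffOn ℝ 1 y (Ioo 0 R) := fun r hr => by
    refine ContDiffAt.contDiffWithinAt ?_
    have ho := houts.contDiffAt (Ioo_mem_nhds hr.1 hr.2)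
    rcases lt_or_ge (2 * d) r with h | h
    · exact ho.congr_of_eventuallyEq (hyout r h)
    · have hi := (contDiffOn_innerSol ha).contDiffAt
        (Ioo_mem_nhds hr.1 (by linarith : r < Real.exp (a - 1)))
      exact ((contDiffAt_const.sub hχs.contDiffAt).mul hi).add (hχs.contDiffAt.mul ho)
  have hric : ∀ r ∈ Ioo 0 R, 0 ≤ riccati (profile a δ r - 1) r (y r) (r * deriv y r) := by
    intro r hr
    have hr0 := hr.1.ne'
    have hdo := hasDerivAt_outerSol hr.1 (hκ0 r hr)
    rcases lt_or_ge (2 * d) r with h | h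
    · rw [(hyout r h).deriv_eq, (hyout r h).self_of_nhds, hdo.deriv, mul_div_cancel₀ _ hr0]
      exact houter r (by linarith) hr.2
    · have hdi := hasDerivAt_innerSol ha (⟨hr.1, by linarith⟩ : r ∈ Ioo 0 (Real.exp (a - 1)))
      rcases lt_or_ge r d with h' | h'
      · rw [(hyin r h').deriv_eq, (hyin r h').self_of_nhds, hdi.deriv, mul_div_cancel₀ _ hr0]
        exact hinner r hr.1 h
      · have hdy : r * deriv y r = (1 - χ r) * innerSolDeriv a r + χ r * (4 / 3 * outerSol κ r ^ 2) +
            r * deriv χ r * (outerSol κ r - innerSol a r) := by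
          have := ((((hχd r).const_sub 1).fun_mul hdi).fun_add ((hχd r).fun_mul hdo)).deriv
          rw [hy, this]
          field_simp; ring
        rw [hdy]
        have hpos := profile_nonneg (a := a) hδ r
        exact riccati_interpolate (by linarith [hr.1]) (Real.smoothTransition.nonneg _)
          (Real.smoothTransition.le_one _) (mul_nonneg hr.1.le hχmono.deriv_nonneg)
          (hle r h' h) (hinner r hr.1 h) (houter r h' hr.2)
  refine diracHardyOn_of_supersolution (z := fun r => 1 + y r) (continuousOn_profile ha hδ hδa)
    (fun s _ => profile_nonneg hδ s)
    ((contDiffOn_profile ha hδ hδa).mono fun r hr => hr.1) (contDiffOn_const.add hys)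
    (fun r hr => ?_) (fun r hr => ?_) fun r hr => ?_
  · rw [(hasDerivAt_profile ha hδ hδa hr.1).deriv]
    exact neg_one_le_profileDeriv ha hδ hδa hr.1
  · rw [(hasDerivAt_profile ha hδ hδa hr.1).deriv]
    exact hW2 r hr
  · have h := hric r hr
    rw [deriv_const_add]
    unfold riccati at h
    linarith

end Optimal

/-! ### Radial test spinors -/

section RadialTest

lemma memH10_of_isTestSpinor {R : ℝ} {ψ : Space → Spinor} (hψ : IsTestSpinor R ψ) :
    MemH10 R ψ fun j => partialDeriv j ψ := by
  have hc1 := fun j => continuous_partialDeriv j (hψ.1.of_le (by exact_mod_cast le_top))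
  have hcs := fun j => hψ.2.1.of_isClosed_subset (isClosed_tsupport _)
    (tsupport_partialDeriv_subset ψ j)
  refine ⟨⟨hψ.1.continuous.memLp_of_hasCompactSupport hψ.2.1,
    fun j => (hc1 j).memLp_of_hasCompactSupport (hcs j), fun j η hη hηc => ?_⟩,
    fun ε hε => ⟨ψ, hψ, by simpa using hε, fun j => by simpa using hε⟩⟩
  have hη1 := continuous_partialDeriv j (hη.of_le (by exact_mod_cast le_top))
  have hηc1 : HasCompactSupport (partialDeriv j η) :=
    hηc.of_isClosed_subset (isClosed_tsupport _) (tsupport_partialDeriv_subset η j)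
  have h := integral_smul_fderiv_eq_neg_fderiv_smul_of_integrable (𝕜 := ℝ) (f := η) (g := ψ)
    (μ := (volume : Measure Space)) (v := EuclideanSpace.single j (1 : ℝ))
    ((hη1.smul hψ.1.continuous).integrable_of_hasCompactSupport (f := fun x => partialDeriv j η x • ψ x)
      hηc1.smul_right)
    ((hη.continuous.smul (hc1 j)).integrable_of_hasCompactSupport
      (f := fun x => η x • partialDeriv j ψ x) hηc.smul_right)
    ((hη.continuous.smul hψ.1.continuous).integrable_of_hasCompactSupport
      (f := fun x => η x • ψ x) hηc.smul_right)
    (fun x _ => hη.differentiable (by norm_num) x)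
    (fun x _ => hψ.1.differentiable (by norm_num) x)
  simp only [partialDeriv] at h ⊢
  rw [h, neg_neg]

/-- The inequality for a radial function times a constant spinor. -/
lemma radial_inequality {R r₁ r₂ : ℝ} {W F : ℝ → ℝ} (hWc : ContinuousOn W (Ici 0))
    (hWnn : ∀ s, 0 ≤ s → 0 ≤ W s) (hW : DiracHardyOn R W) (h1 : 0 < r₁) (h2 : r₂ < R)
    (h12 : r₁ ≤ r₂) (hF : ContDiff ℝ ∞ F) (hF0 : ∀ r, r ∉ Icc r₁ r₂ → F r = 0) :
    IntegrableOn (fun r => r ^ 2 * (deriv F r ^ 2 / (1 + W r / r) + F r ^ 2 - W r / r * F r ^ 2))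
      (Icc r₁ r₂) ∧
    0 ≤ ∫ r in r₁..r₂, r ^ 2 * (deriv F r ^ 2 / (1 + W r / r) + F r ^ 2 - W r / r * F r ^ 2) := by
  have htsF : tsupport F ⊆ Icc r₁ r₂ :=
    closure_minimal (fun r hr => by_contra fun h => hr (hF0 r h)) isClosed_Icc
  have hdF0 : ∀ r, r ∉ Icc r₁ r₂ → deriv F r = 0 := fun r hr => by
    have := (notMem_tsupport_iff_eventuallyEq.1 fun h => hr (htsF h)).deriv_eq
    rw [this]; simp
  set f : Space → ℝ := fun x => F ‖x‖ with hf
  have hnear : f =ᶠ[𝓝 0] 0 := by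
    filter_upwards [Metric.ball_mem_nhds (0 : Space) h1] with x hx
    rw [mem_ball_zero_iff] at hx
    exact hF0 _ fun h => absurd h.1 (not_le.2 hx)
  have hfs : ContDiff ℝ ∞ f := contDiff_iff_contDiffAt.2 fun x => by
    rcases eq_or_ne x 0 with rfl | hx
    · exact contDiffAt_const.congr_of_eventuallyEq hnear
    · exact contDiffAt_radial hx hF.contDiffAt
  have hfts : tsupport f ⊆ Metric.closedBall 0 r₂ := by
    refine closure_minimal (fun x hx => ?_) Metric.isClosed_closedBall
    rw [mem_closedBall_zero_iff]
    by_contra h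
    exact hx (hF0 _ fun h' => h h'.2)
  set e : Spinor := EuclideanSpace.single 0 1 with he
  set ψ : Space → Spinor := fun x => f x • e with hψdef
  have hψs : ContDiff ℝ ∞ ψ := hfs.smul contDiff_const
  have hψts : tsupport ψ ⊆ tsupport f := closure_mono fun x hx hx' => hx (by simp [hψdef, hx'])
  have hψ : IsTestSpinor R ψ := by
    refine ⟨hψs, (isCompact_closedBall (0 : Space) r₂).of_isClosed_subset (isClosed_tsupport _)
      (hψts.trans hfts), (hψts.trans hfts).trans (Metric.closedBall_subset_ball h2)⟩
  have hcoord : ∀ c x, coord c (ψ x) = if c = 0 then f x else 0 := fun c x => by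
    rw [hψdef, map_smul, he]
    fin_cases c <;> simp [coord_zero, coord_one, coord_two, coord_three]
  have hnorm : ∀ x, ‖ψ x‖ ^ 2 = F ‖x‖ ^ 2 := fun x => by
    rw [norm_sq_spinor]
    simp [hcoord, hf]
  have hpart : ∀ j x, partialDeriv j f x = deriv F ‖x‖ * (x j / ‖x‖) := fun j x => by
    rcases eq_or_ne x 0 with rfl | hx
    · have : fderiv ℝ f 0 = 0 := by rw [hnear.fderiv_eq]; simp
      simp [partialDeriv, this]
    · exact partialDeriv_radial hx (hF.differentiable (by norm_num) _) j
  have hsig : ∀ x, ‖sigmaGrad (fun j => partialDeriv j ψ) x‖ ^ 2 = deriv F ‖x‖ ^ 2 := fun x => by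
    have hg : (fun c j => coord c (partialDeriv j ψ x)) =
        fun c j => if c = 0 then deriv F ‖x‖ * (x j / ‖x‖) else 0 := by
      funext c j
      rw [← partialDeriv_coord_comp (hψs.differentiable (by norm_num) x)]
      simp only [hcoord]
      split_ifs with h
      · exact hpart j x
      · simp [partialDeriv]
    rw [norm_sq_sigmaGrad, hg]
    simp only [gradSq, crossTerm, Fin.sum_univ_four, Fin.sum_univ_three]
    rcases eq_or_ne x 0 with rfl | hx
    · have : deriv F 0 = 0 := hdF0 0 fun h => absurd h.1 (not_le.2 h1)
      simp [this]
    · have hn := norm_sq_eq x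
      have hn0 : ‖x‖ ≠ 0 := norm_ne_zero_iff.2 hx
      simp
      field_simp
      rw [hn]
  have key := hW ψ _ (memH10_of_isTestSpinor hψ)
  simp only [hnorm, hsig] at key
  set G₁ : ℝ → ℝ := fun r => W r / r * F r ^ 2 with hG₁
  set G₂ : ℝ → ℝ := fun r => deriv F r ^ 2 / (1 + W r / r) + F r ^ 2 with hG₂
  have hdFc : Continuous (deriv F) := hF.continuous_deriv (by norm_num)
  have hWr : ContinuousOn (fun r => W r / r) (Icc r₁ r₂) :=
    (hWc.mono fun r hr => h1.le.trans hr.1).div continuousOn_id fun r hr => (h1.trans_le hr.1).ne'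
  have hWr0 : ∀ r ∈ Icc r₁ r₂, 0 ≤ W r / r := fun r hr =>
    div_nonneg (hWnn r (h1.le.trans hr.1)) (h1.le.trans hr.1)
  have hc1 : ContinuousOn G₁ (Icc r₁ r₂) := hWr.mul (hF.continuous.continuousOn.pow 2)
  have hc2 : ContinuousOn G₂ (Icc r₁ r₂) :=
    ((hdFc.continuousOn.pow 2).div (continuousOn_const.add hWr) fun r hr => by
      have : 0 < 1 + W r / r := by linarith [hWr0 r hr]
      exact this.ne').add (hF.continuous.continuousOn.pow 2)
  have hz1 : ∀ r, r ∉ Icc r₁ r₂ → G₁ r = 0 := fun r hr => by simp [hG₁, hF0 r hr]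
  have hz2 : ∀ r, r ∉ Icc r₁ r₂ → G₂ r = 0 := fun r hr => by simp [hG₂, hF0 r hr, hdF0 r hr]
  have hnn1 : ∀ r, 0 ≤ G₁ r := fun r => by
    by_cases hr : r ∈ Icc r₁ r₂
    · have := hWr0 r hr
      simp only [hG₁]; positivity
    · exact (hz1 r hr).ge
  have hnn2 : ∀ r, 0 ≤ G₂ r := fun r => by
    by_cases hr : r ∈ Icc r₁ r₂
    · have := hWr0 r hr
      simp only [hG₂]; positivity
    · exact (hz2 r hr).ge
  have hdim : Module.finrank ℝ Space - 1 = 2 := by rw [finrank_euclideanSpace_fin]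
  have hsubset : Icc r₁ r₂ ⊆ Ioi (0 : ℝ) := fun r hr => h1.trans_le hr.1
  have hIcc : ∀ G : ℝ → ℝ, ContinuousOn G (Icc r₁ r₂) →
      IntegrableOn (fun r => r ^ 2 * G r) (Icc r₁ r₂) := fun G hG =>
    ((continuousOn_id.pow 2).mul hG).integrableOn_Icc
  have hint : ∀ G : ℝ → ℝ, ContinuousOn G (Icc r₁ r₂) → (∀ r, r ∉ Icc r₁ r₂ → G r = 0) →
      Integrable fun x : Space => G ‖x‖ := fun G hG hG0 => by
    rw [integrable_fun_norm_addHaar, hdim]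
    simp only [smul_eq_mul]
    exact (hIcc G hG).of_forall_sdiff_eq_zero measurableSet_Ioi fun r hr => by simp [hG0 r hr.2]
  have hval : ∀ G : ℝ → ℝ, (∀ r, r ∉ Icc r₁ r₂ → G r = 0) →
      ∫ x : Space, G ‖x‖ = 3 * volume.real (Metric.ball (0 : Space) 1) *
        ∫ r in r₁..r₂, r ^ 2 * G r := fun G hG0 => by
    rw [integral_fun_norm_addHaar, hdim, finrank_euclideanSpace_fin,
      intervalIntegral.integral_of_le h12, ← integral_Icc_eq_integral_Ioc,
      setIntegral_eq_of_subset_of_forall_sdiff_eq_zero measurableSet_Ioi hsubset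
        fun r hr => by simp [hG0 r hr.2]]
    simp [mul_assoc]
  rw [← ofReal_integral_eq_lintegral_ofReal (hint G₁ hc1 hz1) (Eventually.of_forall fun x => hnn1 _),
    ← ofReal_integral_eq_lintegral_ofReal (hint G₂ hc2 hz2) (Eventually.of_forall fun x => hnn2 _),
    ENNReal.ofReal_le_ofReal_iff (integral_nonneg fun x => hnn2 _), hval G₁ hz1, hval G₂ hz2] at key
  have hvol : 0 < 3 * volume.real (Metric.ball (0 : Space) 1) := by
    have : 0 < volume.real (Metric.ball (0 : Space) 1) :=
      ENNReal.toReal_pos (Metric.measure_ball_pos _ _ one_pos).ne' measure_ball_lt_top.ne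
    positivity
  have key2 := le_of_mul_le_mul_left key hvol
  have hi1 := hIcc G₁ hc1
  have hi2 := hIcc G₂ hc2
  have e1 : ∀ r, r ^ 2 * (deriv F r ^ 2 / (1 + W r / r) + F r ^ 2 - W r / r * F r ^ 2) =
      r ^ 2 * G₂ r - r ^ 2 * G₁ r := fun r => by simp only [hG₁, hG₂]; ring
  simp only [e1]
  refine ⟨hi2.sub hi1, ?_⟩
  rw [intervalIntegral.integral_sub]
  · linarith
  · exact (intervalIntegrable_iff_integrableOn_Icc_of_le h12).2 hi2
  · exact (intervalIntegrable_iff_integrableOn_Icc_of_le h12).2 hi1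

end RadialTest

/-! ### Optimality of the coefficient -/

section Optimality

/-- Beyond every `V` there are bumps `η` with `∫ η'² < ε ∫ η²`, obtained by stretching. -/
lemma exists_wide_bump {ε : ℝ} (hε : 0 < ε) (V : ℝ) :
    ∃ (η : ℝ → ℝ) (V' : ℝ), ContDiff ℝ ∞ η ∧ (∀ t, t ∉ Ioo V V' → η t = 0) ∧
      ∀ V'', V' ≤ V'' → ∫ t in V..V'', (deriv η t ^ 2 - ε * η t ^ 2) < 0 := by
  let b : ContDiffBump (0 : ℝ) := ⟨1, 2, by norm_num, by norm_num⟩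
  have hb : ContDiff ℝ ∞ b := b.contDiff
  have hbc : Continuous fun s => b s ^ 2 := hb.continuous.pow 2
  have hdc : Continuous fun s => deriv b s ^ 2 := (hb.continuous_deriv (by norm_num)).pow 2
  set A := ∫ s in (-2 : ℝ)..2, deriv b s ^ 2 with hA
  set B := ∫ s in (-2 : ℝ)..2, b s ^ 2 with hB
  have hBpos : 0 < B := by
    refine intervalIntegral.intervalIntegral_pos_of_pos_on (hbc.intervalIntegrable _ _)
      (fun s hs => ?_) (by norm_num)
    have : 0 < b s := b.pos_of_mem_ball (by
      rw [mem_ball_zero_iff]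
      exact abs_lt.2 hs)
    positivity
  have hA0 : 0 ≤ A := intervalIntegral.integral_nonneg (by norm_num) fun s _ => sq_nonneg _
  obtain ⟨L, hL1, hL⟩ : ∃ L : ℝ, 1 ≤ L ∧ A < L * (ε * B) := by
    refine ⟨A / (ε * B) + 1, ?_, ?_⟩
    · have : 0 ≤ A / (ε * B) := by positivity
      linarith
    · have : 0 < ε * B := by positivity
      rw [add_mul, div_mul_cancel₀ _ this.ne']
      linarith
  have hL0 : 0 < L := by linarith
  set d := V / L + 2 with hd
  set η : ℝ → ℝ := fun t => b (t / L - d) with hη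
  have hηs : ContDiff ℝ ∞ η := hb.comp (by fun_prop)
  have hη0 : ∀ t, t ∉ Ioo V (V + 4 * L) → η t = 0 := fun t ht => by
    refine Function.notMem_support.1 fun h => ht ?_
    have h' : t / L - d ∈ Function.support b := h
    rw [b.support_eq, mem_ball_zero_iff, Real.norm_eq_abs] at h'
    change |t / L - d| < 2 at h'
    obtain ⟨h1, h2⟩ := abs_lt.1 h'
    have e : t = (t / L - d) * L + V + 2 * L := by rw [hd]; field_simp; ring
    constructor <;> nlinarith
  have hderiv : ∀ t, deriv η t = deriv b (t / L - d) / L := fun t => by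
    have h1 := ((hb.differentiable (by norm_num)) (t / L - d)).hasDerivAt.comp t
      (((hasDerivAt_id' t).div_const L).sub_const d)
    have : deriv η t = _ := h1.deriv
    rw [this]; ring
  have hcont : Continuous fun t => deriv η t ^ 2 - ε * η t ^ 2 :=
    ((hηs.continuous_deriv (by norm_num)).pow 2).sub ((hηs.continuous.pow 2).const_mul ε)
  have hmain : ∫ t in V..(V + 4 * L), (deriv η t ^ 2 - ε * η t ^ 2) < 0 := by
    have e : ∀ t, deriv η t ^ 2 - ε * η t ^ 2 =
        (fun s => deriv b s ^ 2 / L ^ 2 - ε * b s ^ 2) (t / L - d) := fun t => by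
      rw [hderiv t]; simp only [hη]; ring
    rw [intervalIntegral.integral_congr fun t _ => e t,
      intervalIntegral.integral_comp_div_sub (fun s => deriv b s ^ 2 / L ^ 2 - ε * b s ^ 2) hL0.ne']
    have e1 : V / L - d = -2 := by rw [hd]; ring
    have e2 : (V + 4 * L) / L - d = 2 := by rw [hd]; field_simp; ring
    rw [e1, e2, intervalIntegral.integral_sub ((hdc.div_const _).intervalIntegrable _ _)
      ((hbc.const_mul ε).intervalIntegrable _ _), intervalIntegral.integral_div,
      intervalIntegral.integral_const_mul, ← hA, ← hB, smul_eq_mul]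
    refine mul_neg_of_pos_of_neg hL0 ?_
    rw [sub_neg, div_lt_iff₀ (by positivity)]
    have : 0 < ε * B := by positivity
    nlinarith
  refine ⟨η, V + 4 * L, hηs, hη0, fun V'' hV'' => ?_⟩
  rw [← intervalIntegral.integral_add_adjacent_intervals (b := V + 4 * L)
    (hcont.intervalIntegrable _ _) (hcont.intervalIntegrable _ _)]
  have hz : ∫ t in (V + 4 * L)..V'', (deriv η t ^ 2 - ε * η t ^ 2) = 0 := by
    rw [intervalIntegral.integral_of_le hV'']
    refine setIntegral_eq_zero_of_forall_eq_zero fun t ht => ?_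
    have h1 : η =ᶠ[𝓝 t] fun _ => 0 := by
      filter_upwards [lt_mem_nhds ht.1] with s hs using hη0 s fun h => absurd h.2 (not_lt.2 hs.le)
    rw [h1.deriv_eq, h1.self_of_nhds]; simp
  rw [hz, add_zero]
  exact hmain

/-- `X_{j+1} = X_j ∘ X₁`. -/
lemma X_comp (a : ℝ) (j : ℕ) (s : ℝ) : X a (j + 1) s = X a j (X a 1 s) := by
  induction j with
  | zero => rfl
  | succ j ih => rw [X_succ, ih, ← X_succ a j (X a 1 s)]

lemma prodX_comp (a : ℝ) (n : ℕ) (s : ℝ) :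
    prodX a (n + 1) s = X a 1 s * prodX a n (X a 1 s) := by
  induction n with
  | zero => simp [prodX_one, prodX_zero]
  | succ n ih => rw [prodX_succ, ih, prodX_succ a n (X a 1 s), X_comp a (n + 1) s, mul_assoc]

lemma tendsto_div_prodX (a : ℝ) (n : ℕ) : Tendsto (fun s => s / prodX a n s) (𝓝[>] 0) (𝓝 0) := by
  induction n with
  | zero =>
    simp only [prodX_zero, div_one]
    exact tendsto_id'.2 nhdsWithin_le_nhds
  | succ n ih =>
    have h := (tendsto_div_X_one_pow a 2).mul (ih.comp (tendsto_X a 1))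
    rw [mul_zero] at h
    refine h.congr' ?_
    filter_upwards [(tendsto_X a 1).eventually self_mem_nhdsWithin] with s hs
    have hs' : X a 1 s ≠ 0 := ne_of_gt hs
    simp only [Function.comp, prodX_comp]
    field_simp

lemma sumSqX_le {a s : ℝ} (ha : 1 < a) (hs : s ∈ Ioo 0 (Real.exp (a - 1))) (k : ℕ) :
    sumSqX a k s ≤ k * X a 1 s ^ 2 := by
  induction k with
  | zero => simp [sumSqX]
  | succ k ih =>
    rw [sumSqX_succ]
    have h1 : prodX a (k + 1) s ≤ X a 1 s := (prodX_succ_le ha hs k).trans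
      (mul_le_of_le_one_right (X_pos ha hs 1).le
        (pow_le_one₀ (by positivity) (inv_lt_one_of_one_lt₀ ha).le))
    have h2 := pow_le_pow_left₀ (prodX_pos ha hs (k + 1)).le h1 2
    push_cast
    linarith

lemma hasDerivAt_sumSqX {a s : ℝ} (ha : 1 < a) (hs : s ∈ Ioo 0 (Real.exp (a - 1))) (k : ℕ) :
    ∃ D, 0 ≤ D ∧ HasDerivAt (sumSqX a k) (D / s) s := by
  induction k with
  | zero =>
    have : sumSqX a 0 = fun _ => 0 := by funext s; simp [sumSqX]
    exact ⟨0, le_rfl, by simpa [this] using hasDerivAt_const s (0 : ℝ)⟩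
  | succ k ih =>
    obtain ⟨D, hD0, hD⟩ := ih
    have h1 := prodX_pos ha hs (k + 1)
    have h2 := sumX_nonneg ha hs (k + 1)
    refine ⟨D + 2 * prodX a (k + 1) s ^ 2 * sumX a (k + 1) s, by positivity, ?_⟩
    have e : sumSqX a (k + 1) = fun s => sumSqX a k s + prodX a (k + 1) s ^ 2 :=
      funext (sumSqX_succ a k)
    rw [e]
    refine (hD.fun_add (hasDerivAt_prodX_sq ha hs (k + 1))).congr_deriv ?_
    ring

/-- A lower bound for `W + r - 1` if, at the order of `X₁²⋯X_k²`, the coefficient of `W` exceeds the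
critical one by `ε`. -/
noncomputable def comparison (a ε : ℝ) (k : ℕ) (s : ℝ) : ℝ :=
  sumSqX a k s / 8 + ε * prodX a k s ^ 2 + s

lemma hasDerivAt_comparison {a s ε : ℝ} (hε : 0 < ε) (ha : 1 < a)
    (hs : s ∈ Ioo 0 (Real.exp (a - 1))) (k : ℕ) :
    ∃ D, 0 ≤ D ∧ HasDerivAt (comparison a ε k) (D / s) s := by
  obtain ⟨D, hD0, hD⟩ := hasDerivAt_sumSqX ha hs k
  have h1 := prodX_pos ha hs k
  have h2 := sumX_nonneg ha hs k
  have hs0 := hs.1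
  refine ⟨D / 8 + ε * (2 * prodX a k s ^ 2 * sumX a k s) + s, by positivity, ?_⟩
  refine (((hD.div_const 8).fun_add ((hasDerivAt_prodX_sq ha hs k).const_mul ε)).fun_add
    (hasDerivAt_id' s)).congr_deriv ?_
  field_simp

/-- The comparison function is `o(X₁⋯X_{k+1})`, so that its square is negligible against the
term `ε X₁²⋯X_{k+1}²`. -/
lemma tendsto_comparison_div {a : ℝ} (ε : ℝ) (ha : 1 < a) (k : ℕ) :
    Tendsto (fun s => comparison a ε (k + 1) s / prodX a (k + 1) s) (𝓝[>] 0) (𝓝 0) := by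
  have h1 : Tendsto (fun s => sumSqX a (k + 1) s / prodX a (k + 1) s) (𝓝[>] 0) (𝓝 0) := by
    have h := ((tendsto_div_prodX a k).comp (tendsto_X a 1)).const_mul ((k + 1 : ℕ) : ℝ)
    rw [mul_zero] at h
    refine tendsto_of_tendsto_of_tendsto_of_le_of_le' tendsto_const_nhds h ?_ ?_
    · filter_upwards [Ioo_exp_mem a] with s hs
      exact div_nonneg (sumSqX_nonneg a _ s) (prodX_pos ha hs _).le
    · filter_upwards [Ioo_exp_mem a] with s hs
      have hx := X_pos ha hs 1
      have hp := prodX_pos ha hs (k + 1)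
      rw [div_le_iff₀ hp]
      have h2 := sumSqX_le ha hs (k + 1)
      rw [prodX_comp] at hp ⊢
      have hp' : 0 < prodX a k (X a 1 s) := pos_of_mul_pos_right hp hx.le
      simp only [Function.comp]
      calc _ ≤ _ := h2
        _ = _ := by field_simp
  have h2 : Tendsto (fun s => ε * prodX a (k + 1) s) (𝓝[>] 0) (𝓝 0) := by
    have h : Tendsto (fun s => prodX a (k + 1) s) (𝓝[>] 0) (𝓝 0) := by
      refine tendsto_of_tendsto_of_tendsto_of_le_of_le' tendsto_const_nhds
        ((tendsto_X a 1).mono_right nhdsWithin_le_nhds) ?_ ?_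
      · filter_upwards [Ioo_exp_mem a] with s hs using (prodX_pos ha hs _).le
      · filter_upwards [Ioo_exp_mem a] with s hs
        exact (prodX_succ_le ha hs k).trans (mul_le_of_le_one_right (X_pos ha hs 1).le
          (pow_le_one₀ (by positivity) (inv_lt_one_of_one_lt₀ ha).le))
    simpa using h.const_mul ε
  have h := ((h1.div_const 8).add h2).add (tendsto_div_prodX a (k + 1))
  simp only [zero_div, add_zero] at h
  refine h.congr' ?_
  filter_upwards [Ioo_exp_mem a] with s hs
  have hp := (prodX_pos ha hs (k + 1)).ne'
  rw [comparison]
  field_simp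

/-- The integrand of `radial_inequality` for `F = g/r`, multiplied by `r`, where `γ` stands for
`r g'`. The bound follows from `1/(1 + u) ≤ 1 - u + u²`. On the right, `2(u - 1) g γ` is a derivative
up to the term `r u' g²`, which has a favourable sign. -/
lemma radial_integrand_le {W r u g γ : ℝ} (hr : 0 < r) (hu : r ≤ u) (hu2 : u ≤ 1 / 2)
    (hW : 1 + u ≤ W + r) :
    (γ - g) ^ 2 / (W + r) + (r - W) * g ^ 2 ≤
      2 * (u - 1) * g * γ + γ ^ 2 - (2 * (u - r) - 2 * u ^ 2) * g ^ 2 := by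
  have hu0 : 0 < u := hr.trans_le hu
  have h1 : (γ - g) ^ 2 / (W + r) ≤ (γ - g) ^ 2 * (1 - u + u ^ 2) := by
    rw [div_le_iff₀ (by linarith), mul_assoc]
    refine le_mul_of_one_le_right (sq_nonneg _) ?_
    have : (1 - u + u ^ 2) * (1 + u) ≤ (1 - u + u ^ 2) * (W + r) :=
      mul_le_mul_of_nonneg_left hW (by nlinarith)
    nlinarith [pow_pos hu0 3]
  have h2 : (r - W) * g ^ 2 ≤ (2 * r - 1 - u) * g ^ 2 :=
    mul_le_mul_of_nonneg_right (by linarith) (sq_nonneg _)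
  -- `u²(γ - g)² ≤ 2u²γ² + 2u²g²`, and `2u² ≤ u`
  have h3 : u ^ 2 * (γ - g) ^ 2 ≤ u ^ 2 * (2 * γ ^ 2 + 2 * g ^ 2) :=
    mul_le_mul_of_nonneg_left (by nlinarith [sq_nonneg (γ + g)]) (sq_nonneg _)
  have h4 : 0 ≤ (u - 2 * u ^ 2) * γ ^ 2 := mul_nonneg (by nlinarith) (sq_nonneg _)
  nlinarith

/-- No weight satisfying the Dirac–Hardy inequality exceeds `W_∞` at any order. -/
theorem growthCoeff_le {a R : ℝ} (ha : 1 < a) (hR : 0 < R) {W : ℝ → ℝ} (hprof : IsProfile R W)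
    (hW : DiracHardyOn R W) (k : ℕ) : growthCoeff a W k ≤ ((1 / 8 : ℝ) : EReal) := by
  by_contra! hlt
  obtain ⟨c, hc1, hc2⟩ := EReal.lt_iff_exists_real_btwn.1 hlt
  have hc : 1 / 8 < c := EReal.coe_lt_coe_iff.1 hc1
  set ε := c - 1 / 8 with hε
  have hε0 : 0 < ε := by linarith
  set θ := min (1 / 2) (ε / 2) with hθ
  have hθ0 : 0 < θ := by positivity
  have hθ1 : θ ≤ 1 / 2 := min_le_left _ _
  have hθ2 : θ ≤ ε / 2 := min_le_right _ _
  have hexp : ∀ᶠ s in 𝓝[>] (0 : ℝ), s ∈ Ioo 0 (Real.exp (a - 1)) := Ioo_exp_mem a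
  have hlR : ∀ᶠ s in 𝓝[>] (0 : ℝ), s ∈ Ioo 0 R := Ioo_mem_nhdsGT hR
  obtain ⟨ρ, hρ, hρ'⟩ := mem_nhdsGT_iff_exists_Ioo_subset.1
    (((eventually_lt_of_lt_liminf hc2).and
      ((tendsto_comparison_div ε ha k).eventually_le_const hθ0)).and (hexp.and hlR))
  have hρ0 : 0 < ρ := hρ
  set P := prodX a (k + 1) with hP
  set σ := sumX a (k + 1) with hσ
  set u := comparison a ε (k + 1) with hu
  have hmem : ∀ r ∈ Ioo 0 ρ, r ∈ Ioo 0 (Real.exp (a - 1)) := fun r hr => (hρ' hr).2.1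
  have hPpos : ∀ r ∈ Ioo 0 ρ, 0 < P r := fun r hr => prodX_pos ha (hmem r hr) _
  have huθ : ∀ r ∈ Ioo 0 ρ, u r ≤ θ * P r := fun r hr =>
    (div_le_iff₀ (hPpos r hr)).1 (hρ' hr).1.2
  have hWu : ∀ r ∈ Ioo 0 ρ, 1 + u r ≤ W r + r := fun r hr => by
    have h1 := EReal.coe_lt_coe_iff.1 (hρ' hr).1.1
    rw [lt_div_iff₀ (pow_pos (hPpos r hr) 2)] at h1
    have h2 := sumSqX_succ a k r
    rw [sumSqX, sumSqX] at h2
    rw [hu, comparison, sumSqX, h2]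
    have h3 : c = ε + 1 / 8 := by rw [hε]; ring
    rw [h3] at h1
    linarith
  -- the logarithmic variable in which the remaining radial problem has constant coefficients
  set v : ℝ → ℝ := fun r => a - Real.log (X a (k + 1) r) with hv
  have hvd : ∀ r ∈ Ioo 0 ρ, HasDerivAt v (-(P r / r)) r := fun r hr => by
    have hX := (X_pos ha (hmem r hr) (k + 1)).ne'
    refine (((hasDerivAt_X ha (hmem r hr) (k + 1)).log hX).const_sub a).congr_deriv ?_
    field_simp
    rfl
  have hvanti : AntitoneOn v (Ioo 0 ρ) := by
    refine antitoneOn_of_deriv_nonpos (convex_Ioo _ _)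
      (fun r hr => (hvd r hr).continuousAt.continuousWithinAt) (fun r hr => ?_) fun r hr => ?_
    · rw [interior_Ioo] at hr
      exact (hvd r hr).differentiableAt.differentiableWithinAt
    · rw [interior_Ioo] at hr
      rw [(hvd r hr).deriv, neg_nonpos]
      exact div_nonneg (hPpos r hr).le hr.1.le
  set r₂ := ρ / 2 with hr₂
  have hr₂mem : r₂ ∈ Ioo 0 ρ := ⟨by positivity, by rw [hr₂]; linarith⟩
  obtain ⟨η, V', hηs, hη0, hηneg⟩ := exists_wide_bump hε0 (v r₂)
  have hvtop : Tendsto v (𝓝[>] 0) atTop := by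
    have := tendsto_neg_atBot_atTop.comp (Real.tendsto_log_nhdsGT_zero.comp (tendsto_X a (k + 1)))
    exact (tendsto_atTop_add_const_left _ a this).congr fun s => by simp [hv, sub_eq_add_neg]
  obtain ⟨r₁, hr₁V, hr₁0, hr₁2⟩ := ((hvtop.eventually_ge_atTop V').and
    (Ioo_mem_nhdsGT hr₂mem.1 : ∀ᶠ s in 𝓝[>] (0 : ℝ), s ∈ Ioo 0 r₂)).exists
  have hsub : Icc r₁ r₂ ⊆ Ioo 0 ρ := fun r hr => ⟨hr₁0.trans_le hr.1, hr.2.trans_lt hr₂mem.2⟩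
  set g : ℝ → ℝ := fun r => (√(P r))⁻¹ * η (v r) with hg
  -- the formula is used only where the iterated logarithms are defined
  set F : ℝ → ℝ := fun r => if r ∈ Ioo 0 ρ then g r / r else 0 with hFdef
  have hFeq : ∀ r ∈ Ioo 0 ρ, F =ᶠ[𝓝 r] fun r => g r / r := fun r hr => by
    filter_upwards [Ioo_mem_nhds hr.1 hr.2] with t ht
    simp only [hFdef, if_pos ht]
  have hF0 : ∀ r, r ∉ Icc r₁ r₂ → F r = 0 := fun r hr => by
    by_cases hm : r ∈ Ioo 0 ρ
    · have h1 : η (v r) = 0 := by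
        refine hη0 _ fun h => hr ⟨?_, ?_⟩
        · by_contra! h2
          have := hvanti hm (hsub (left_mem_Icc.2 hr₁2.le)) h2.le
          linarith [h.2]
        · by_contra! h2
          have := hvanti hr₂mem hm h2.le
          linarith [h.1]
      simp only [hFdef, if_pos hm, hg, h1]
      simp
    · simp only [hFdef, if_neg hm]
  have hFs : ContDiff ℝ ∞ F := contDiff_iff_contDiffAt.2 fun r => by
    by_cases hr : r ∈ Icc r₁ r₂
    swap
    · exact contDiffAt_const.congr_of_eventuallyEq
        (eventually_of_mem (isClosed_Icc.isOpen_compl.mem_nhds hr) hF0)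
    have hm := hsub hr
    have hX := contDiffAt_X ha (hmem r hm) (k + 1)
    have hPs := contDiffAt_prodX ha (hmem r hm) (k + 1)
    have hvs : ContDiffAt ℝ ∞ v r := contDiffAt_const.sub (hX.log (X_pos ha (hmem r hm) _).ne')
    have hgs : ContDiffAt ℝ ∞ g r :=
      ((hPs.sqrt (hPpos r hm).ne').inv (Real.sqrt_pos.2 (hPpos r hm)).ne').mul
        (hηs.contDiffAt.comp r hvs)
    exact (hgs.div contDiffAt_id hm.1.ne').congr_of_eventuallyEq (hFeq r hm)
  obtain ⟨hint, hpos⟩ := radial_inequality hprof.continuousOn hprof.nonneg hW hr₁0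
    (hρ' hr₂mem).2.2.2 hr₁2.le hFs hF0
  set Φ : ℝ → ℝ := fun t => ∫ s in (v r₂)..t, (deriv η s ^ 2 - ε * η s ^ 2) with hΦ
  have hcont : Continuous fun t => deriv η t ^ 2 - ε * η t ^ 2 :=
    ((hηs.continuous_deriv (by norm_num)).pow 2).sub ((hηs.continuous.pow 2).const_mul ε)
  have hΦd : ∀ t, HasDerivAt Φ (deriv η t ^ 2 - ε * η t ^ 2) t := fun t =>
    (hcont.integral_hasStrictDerivAt (v r₂) t).hasDerivAt
  set γ : ℝ → ℝ := fun r => -((√(P r))⁻¹ * (σ r / 2 * η (v r) + P r * deriv η (v r))) with hγ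
  have hgd : ∀ r ∈ Ioo 0 ρ, HasDerivAt g (γ r / r) r := fun r hr => by
    have hp := hPpos r hr
    have hs := Real.sqrt_pos.2 hp
    have h1 := ((hasDerivAt_prodX ha (hmem r hr) (k + 1)).sqrt hp.ne').fun_inv hs.ne'
    have h2 := ((hηs.differentiable (by norm_num) (v r)).hasDerivAt).comp r (hvd r hr)
    refine (h1.fun_mul h2).congr_deriv ?_
    have h3 : √(prodX a (k + 1) r) ^ 2 = prodX a (k + 1) r := Real.sq_sqrt hp.le
    have hr0 := hr.1.ne'
    have hs' : √(prodX a (k + 1) r) ≠ 0 := hs.ne'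
    have hp' : prodX a (k + 1) r ≠ 0 := hp.ne'
    simp only [hγ, hP, hσ, Function.comp, h3]
    field_simp
    ring
  choose! D hD0 hD using fun r (hr : r ∈ Ioo 0 ρ) => hasDerivAt_comparison hε0 ha (hmem r hr) (k + 1)
  -- the derivative of `H` dominates the radial integrand, and `H` has a negative increment
  set H : ℝ → ℝ := fun r => (u r - 1) * g r ^ 2 - σ r / 2 * g r ^ 2 - Φ (v r) with hH
  set H' : ℝ → ℝ := fun r => (D r * g r ^ 2 + 2 * (u r - 1) * g r * γ r -
    (σ r ^ 2 + sumSqX a (k + 1) r) / 4 * g r ^ 2 - σ r * g r * γ r +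
    (deriv η (v r) ^ 2 - ε * η (v r) ^ 2) * P r) / r with hH'
  have hHd : ∀ r ∈ Ioo 0 ρ, HasDerivAt H (H' r) r := fun r hr => by
    have hg2 := (hgd r hr).fun_pow 2
    have h1 := ((hD r hr).sub_const 1).fun_mul hg2
    have h2 := ((hasDerivAt_sumX ha (hmem r hr) (k + 1)).div_const 2).fun_mul hg2
    have h3 := (hΦd (v r)).comp r (hvd r hr)
    refine ((h1.fun_sub h2).fun_sub h3).congr_deriv ?_
    have hr0 := hr.1.ne'
    simp only [hH', hσ, hu]
    push_cast
    field_simp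
    ring
  have hle : ∀ r ∈ Ioo r₁ r₂,
      r ^ 2 * (deriv F r ^ 2 / (1 + W r / r) + F r ^ 2 - W r / r * F r ^ 2) ≤ H' r := fun r hr => by
    have hm := hsub (Ioo_subset_Icc_self hr)
    have hr0 := hm.1
    have hp := hPpos r hm
    have hdF : deriv F r = (γ r - g r) / r ^ 2 := by
      rw [(hFeq r hm).deriv_eq, ((hgd r hm).fun_div (hasDerivAt_id' r) hr0.ne').deriv]
      field_simp
    have hFr : F r = g r / r := (hFeq r hm).self_of_nhds
    have hW0 := hprof.nonneg r hr0.le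
    have hWr : 0 < W r + r := by linarith
    have e1 : r ^ 2 * (deriv F r ^ 2 / (1 + W r / r) + F r ^ 2 - W r / r * F r ^ 2) =
        ((γ r - g r) ^ 2 / (W r + r) + (r - W r) * g r ^ 2) / r := by
      have h1 : 1 + W r / r = (W r + r) / r := by field_simp; ring
      rw [h1, hdF, hFr]
      field_simp
      ring
    rw [e1]
    simp only [hH']
    rw [div_le_div_iff_of_pos_right hr0]
    have hQ : 0 ≤ sumSqX a (k + 1) r := sumSqX_nonneg _ _ _
    have hur : u r = sumSqX a (k + 1) r / 8 + ε * P r ^ 2 + r := rfl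
    have hru : r ≤ u r := by rw [hur]; have := sq_nonneg (P r); nlinarith
    have hu0 : 0 ≤ u r := hr0.le.trans hru
    have huP := huθ r hm
    have hP1 : P r ≤ 1 := prodX_le_one ha (hmem r hm) _
    have hθP : θ * P r ≤ θ := mul_le_of_le_one_right hθ0.le hP1
    have hu2 : u r ≤ 1 / 2 := by linarith
    have hb := radial_integrand_le (g := g r) (γ := γ r) hr0 hru hu2 (hWu r hm)
    have husq : 2 * u r ^ 2 ≤ ε * P r ^ 2 := by
      have h1 : u r ^ 2 ≤ (θ * P r) ^ 2 := pow_le_pow_left₀ hu0 huP 2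
      have h2 : θ ^ 2 ≤ ε / 2 := by
        have h4 : θ * θ ≤ θ * 1 := mul_le_mul_of_nonneg_left (by linarith) hθ0.le
        linarith [sq θ]
      have h3 := mul_le_mul_of_nonneg_right h2 (sq_nonneg (P r))
      rw [mul_pow] at h1
      linarith
    have husq' := mul_le_mul_of_nonneg_right husq (sq_nonneg (g r))
    -- completing the square leaves only the derivative of the bump
    have hG : (√(P r))⁻¹ ^ 2 * P r = 1 := by
      rw [inv_pow, Real.sq_sqrt hp.le, inv_mul_cancel₀ hp.ne']
    have hsq : (γ r + σ r / 2 * g r) ^ 2 = P r * deriv η (v r) ^ 2 := by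
      have : (γ r + σ r / 2 * g r) ^ 2 =
          (√(P r))⁻¹ ^ 2 * P r * (P r * deriv η (v r) ^ 2) := by
        simp only [hγ, hg]; ring
      rw [this, hG, one_mul]
    have hgsq : P r ^ 2 * g r ^ 2 = P r * η (v r) ^ 2 := by
      have : P r ^ 2 * g r ^ 2 = (√(P r))⁻¹ ^ 2 * P r * (P r * η (v r) ^ 2) := by
        simp only [hg]; ring
      rw [this, hG, one_mul]
    have hDg := mul_nonneg (hD0 r hm) (sq_nonneg (g r))
    have e2 : (2 * (u r - r) - 2 * u r ^ 2) * g r ^ 2 =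
        sumSqX a (k + 1) r / 4 * g r ^ 2 + 2 * ε * (P r ^ 2 * g r ^ 2) - 2 * u r ^ 2 * g r ^ 2 := by
      rw [hur]; ring
    rw [e2, hgsq] at hb
    have e3 : ε * P r ^ 2 * g r ^ 2 = ε * (P r * η (v r) ^ 2) := by rw [← hgsq]; ring
    rw [e3] at husq'
    have e4 : (γ r + σ r / 2 * g r) ^ 2 =
        γ r ^ 2 + σ r * g r * γ r + σ r ^ 2 / 4 * g r ^ 2 := by ring
    rw [hsq] at e4
    linarith
  have hcontH : ContinuousOn H (Icc r₁ r₂) := fun r hr =>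
    (hHd r (hsub hr)).continuousAt.continuousWithinAt
  have hfinal := intervalIntegral.integral_le_sub_of_hasDeriv_right_of_le hr₁2.le hcontH
    (fun r hr => (hHd r (hsub (Ioo_subset_Icc_self hr))).hasDerivWithinAt) hint hle
  have hη2 : η (v r₂) = 0 := hη0 _ fun h => lt_irrefl _ h.1
  have hη1 : η (v r₁) = 0 := hη0 _ fun h => absurd h.2 (not_lt.2 hr₁V)
  have hH2 : H r₂ = 0 := by simp [hH, hg, hη2, hΦ]
  have hH1 : H r₁ = -Φ (v r₁) := by simp [hH, hg, hη1]
  have hΦ1 : Φ (v r₁) < 0 := hηneg _ hr₁V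
  linarith

end Optimality

end DiracHardy

theorem mainTheorem6 (a : ℝ) (ha : 1 < a) (R : ℝ) (hR : 0 < R) :
    (∀ s ∈ Set.Ioo (0 : ℝ) (Real.exp (a - 1)),
      Summable fun j : ℕ => DiracHardy.prodX a (j + 1) s ^ 2) ∧
    (∀ W : ℝ → ℝ, DiracHardy.IsProfile R W → DiracHardy.DiracHardyOn R W →
      ∀ k : ℕ, DiracHardy.growthCoeff a W k ≤ ((1 / 8 : ℝ) : EReal)) ∧
    (∃ W : ℝ → ℝ, DiracHardy.IsProfile R W ∧ DiracHardy.DiracHardyOn R W ∧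
      (∀ᶠ s in nhdsWithin (0 : ℝ) (Set.Ioi 0), W s = DiracHardy.WInf a s) ∧
      ∀ k : ℕ, DiracHardy.growthCoeff a W k = ((1 / 8 : ℝ) : EReal)) := by
  refine ⟨fun s hs => DiracHardy.summable_prodX_sq ha hs,
    fun W hprof hW k => DiracHardy.growthCoeff_le ha hR hprof hW k, ?_⟩
  obtain ⟨δ, hδ, hprof, hW⟩ := DiracHardy.exists_profile ha hR
  have heq : ∀ᶠ s in 𝓝[>] (0 : ℝ), DiracHardy.profile a δ s = DiracHardy.WInf a s := by
    filter_upwards [Ioo_mem_nhdsGT hδ] with s hs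
      using DiracHardy.profile_eq_WInf hs.1 hs.2.le
  refine ⟨_, hprof, hW, heq, fun k => Tendsto.liminf_eq ?_⟩
  refine (continuous_coe_real_ereal.tendsto _).comp
    ((DiracHardy.tendsto_growth_WInf ha k).congr' ?_)
  filter_upwards [heq] with s hs
  rw [hs]
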